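/- Let $(M,g)$ be a smooth connected complete Riemannian manifold without boundary, with Riemannian distance $d$. Let $(P_t)_{t\ge 0}$ be a Markov semigroup on $M$, given by transition probabilities $P_t^x$, $P_tf(x)=\int f\,dP_t^x$, with $P_0=\mathrm{Id}$ and $P_{t+s}=P_t\circ P_s$. Let $Lf=\partial_t P_tf|_{t=0}$ be its generator. Let $\mathcal A$ be an algebra (with constants) of bounded $C^\infty$ functions on $M$ that contains $C_c^\infty(M)$, is stable under $P_t$, under $L$ and under composition with $C^\infty$ functions $\mathbb R\to\mathbb R$, and on which $\partial_tP_tf=P_tLf$ holds pointwise for $t\ge0$. Put, for $f,g\in\mathcal A$, $$\Gamma(f,g)=\tfrac12\big(L(fg)-fLg-gLf\big),\quad \Gamma(f)=\Gamma(f,f),\quad \Gamma_2(f)=\tfrac12\big(L\Gamma(f)-2\Gamma(f,Lf)\big).$$ Assume that $L$ is a diffusion operator, i.e. $L\phi(f)=\phi'(f)Lf+\phi''(f)\Gamma(f)$ for all $f\in\mathcal A$, $\phi\in C^\infty(\mathbb R)$, and that $\Gamma(f)=|\nabla f|^2$ for all $f\in\mathcal A$, where $|\nabla f|$ is the Riemannian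 length of the gradient. For $\rho\in\mathbb R$ and real $n\ge1$, $CD(\rho,\infty)$ means $\Gamma_2(f)\ge\rho\,\Gamma(f)$ on $M$ for all $f\in\mathcal A$, and $CD(\rho,n)$ means $\Gamma_2(f)\ge\rho\,\Gamma(f)+\frac1n(Lf)^2$ on $M$ for all $f\in\mathcal A$. For probability measures $\nu,\mu$ on $M$, let $W_2(\nu,\mu)=\inf_\pi\sqrt{\int \frac{d(x,y)^2}{2}\,d\pi(x,y)}$, the infimum being over all couplings $\pi$ of $\nu$ and $\mu$. For a probability measure $\mu$ and a measurable $h\ge0$ with $\int h\,d\mu=1$, let $\mathrm{Ent}_\mu(h)=\int h\log h\,d\mu\in[0,+\infty]$. Let $A_\lambda=\lambda-1-\log\lambda$ for $\lambda>0$ and $A_0=+\infty$. Write $h\mu$ for the measure with density $h$ with respect to $\mu$. 1. For every $\rho\in\mathbb R$, the following are equivalent: (i) $CD(\rho,\infty)$ holds; (ii) for all $u\ge0$, all $x\in M$ and all measurable $h\ge0$ with $P_uh(x)=1$, $$W_2^2(hP_u^x,P_u^x)\le\frac{1-e^{-2\rho u}}{\rho}\,\mathrm{Ent}_{P_u^x}(h),$$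 where $\frac{1-e^{-2\rho u}}{\rho}$ is replaced by $2u$ if $\rho=0$. 2. For every real $n\ge1$, the following are equivalent: (i) $CD(0,n)$ holds; (ii) for all $u_1>0$, $u_2\ge0$, all $x\in M$ and all measurable $h\ge0$ with $P_{u_1}h(x)=1$, $$W_2^2(hP_{u_1}^x,P_{u_2}^x)\le 2u_1\Big(\mathrm{Ent}_{P_{u_1}^x}(h)+\frac n2A_{u_2/u_1}\Big).$$ -/

import Mathlib

open scoped Manifold ContDiff ENNReal NNReal Bundle
open MeasureTheory ProbabilityTheory Bundle

noncomputable section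

namespace LocalTransport

section Semigroup

variable {M : Type*} [MeasurableSpace M]

/-- A Markov semigroup, given by its transition probabilities: `P t x` is the law `P_t^x`. -/
structure IsMarkovSemigroup (P : ℝ≥0 → Kernel M M) : Prop where
  markov : ∀ t, IsMarkovKernel (P t)
  zero : P 0 = Kernel.id
  add : ∀ s t, P (s + t) = P t ∘ₖ P s

/-- The operator `P_t f (x) = ∫ f dP_t^x`. -/
def semigroupOp (P : ℝ≥0 → Kernel M M) (t : ℝ≥0) (f : M → ℝ) (x : M) : ℝ :=
  ∫ y, f y ∂(P t x)

/-- The infinitesimal generator `L f = ∂_t P_t f` at `t = 0`. -/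
def generator (P : ℝ≥0 → Kernel M M) (f : M → ℝ) (x : M) : ℝ :=
  derivWithin (fun t : ℝ => semigroupOp P t.toNNReal f x) (Set.Ici 0) 0

/-- The carré du champ `Γ(f,g) = (L(fg) - f Lg - g Lf) / 2`. -/
def carreDuChamp (P : ℝ≥0 → Kernel M M) (f g : M → ℝ) (x : M) : ℝ :=
  (generator P (f * g) x - f x * generator P g x - g x * generator P f x) / 2

/-- `Γ₂(f) = (L Γ(f) - 2 Γ(f, Lf)) / 2`. -/
def gammaTwo (P : ℝ≥0 → Kernel M M) (f : M → ℝ) (x : M) : ℝ :=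
  (generator P (carreDuChamp P f f) x - 2 * carreDuChamp P f (generator P f) x) / 2

/-- The criterion `CD(ρ, ∞)` on the algebra `A`. -/
def CDInfty (P : ℝ≥0 → Kernel M M) (A : Subalgebra ℝ (M → ℝ)) (ρ : ℝ) : Prop :=
  ∀ f ∈ A, ∀ x, ρ * carreDuChamp P f f x ≤ gammaTwo P f x

/-- The criterion `CD(ρ, n)` on the algebra `A`, for finite (real) `n`. -/
def CD (P : ℝ≥0 → Kernel M M) (A : Subalgebra ℝ (M → ℝ)) (ρ n : ℝ) : Prop :=
  ∀ f ∈ A, ∀ x, ρ * carreDuChamp P f f x + 1 / n * generator P f x ^ 2 ≤ gammaTwo P f x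

/-- `Ent_μ(h) = ∫ h log h dμ - (∫ h dμ) log (∫ h dμ)` for `h ≥ 0` with finite integral; it is `+∞`
when `h log h` is not integrable. By Jensen's inequality it is nonnegative when `μ` is a
probability measure. -/
def entropy (μ : Measure M) (h : M → ℝ) : ℝ≥0∞ :=
  open scoped Classical in
  if Integrable (fun y => h y * Real.log (h y)) μ then
    ENNReal.ofReal (∫ y, h y * Real.log (h y) ∂μ - (∫ y, h y ∂μ) * Real.log (∫ y, h y ∂μ))
  else ⊤

/-- The measure `h μ`, for `h ≥ 0`. -/
def weighted (h : M → ℝ) (μ : Measure M) : Measure M :=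
  μ.withDensity fun y => ENNReal.ofReal (h y)

/-- `κ` is a coupling of `ν` and `μ`. -/
structure IsCoupling (κ : Measure (M × M)) (ν μ : Measure M) : Prop where
  isProbabilityMeasure : IsProbabilityMeasure κ
  map_fst : κ.map Prod.fst = ν
  map_snd : κ.map Prod.snd = μ

/-- The Wasserstein distance for the cost `d² / 2`. -/
def W₂ [PseudoEMetricSpace M] (ν μ : Measure M) : ℝ≥0∞ :=
  ⨅ (κ : Measure (M × M)) (_ : IsCoupling κ ν μ),
    (∫⁻ z, edist z.1 z.2 ^ 2 / 2 ∂κ) ^ (1 / 2 : ℝ)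

end Semigroup

/-- `(1 - e^{-2ρu}) / ρ`, replaced by `2u` if `ρ = 0`. -/
def talagrandConst (ρ u : ℝ) : ℝ :=
  if ρ = 0 then 2 * u else (1 - Real.exp (-2 * ρ * u)) / ρ

/-- `A_l = l - 1 - log l ≥ 0` for `l > 0`, and `A_0 = +∞`. -/
def dimDefect (l : ℝ) : ℝ≥0∞ :=
  if 0 < l then ENNReal.ofReal (l - 1 - Real.log l) else ⊤

section Manifold

variable {m : ℕ} {M : Type*} [TopologicalSpace M] [ChartedSpace (EuclideanSpace ℝ (Fin m)) M]

/-- The differential of a real function at `x`, as a linear form on the tangent space. -/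
def differential (f : M → ℝ) (x : M) : TangentSpace (𝓡 m) x →L[ℝ] ℝ :=
  mfderiv (𝓡 m) 𝓘(ℝ, ℝ) f x

/-- The Riemannian gradient: the vector representing the differential. -/
def riemGradient [RiemannianBundle (fun x : M => TangentSpace (𝓡 m) x)] (f : M → ℝ) (x : M) :
    TangentSpace (𝓡 m) x :=
  haveI : FiniteDimensional ℝ (TangentSpace (𝓡 m) x) :=
    inferInstanceAs (FiniteDimensional ℝ (EuclideanSpace ℝ (Fin m)))
  haveI : CompleteSpace (TangentSpace (𝓡 m) x) := FiniteDimensional.complete ℝ _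
  (InnerProductSpace.toDual ℝ (TangentSpace (𝓡 m) x)).symm (differential f x)

/-- `P` is a diffusion semigroup with (standard) algebra `A`: `A` is an algebra of bounded smooth
functions which contains the test functions, is stable under composition with smooth functions
of one variable, under the semigroup and under its generator `L`; on `A` the heat equation
`∂_t P_t f = P_t L f` holds, so that `A` lies in the domain of `L`; and `L` is a diffusion operator,
`L φ(f) = φ'(f) L f + φ''(f) Γ(f)`. -/
structure IsDiffusionSemigroup [MeasurableSpace M] (P : ℝ≥0 → Kernel M M)
    (A : Subalgebra ℝ (M → ℝ)) : Prop extends IsMarkovSemigroup P where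
  smooth : ∀ f ∈ A, ContMDiff (𝓡 m) 𝓘(ℝ, ℝ) ∞ f
  bounded : ∀ f ∈ A, ∃ C : ℝ, ∀ x, |f x| ≤ C
  test_mem : ∀ f : M → ℝ, ContMDiff (𝓡 m) 𝓘(ℝ, ℝ) ∞ f → HasCompactSupport f → f ∈ A
  comp_mem : ∀ φ : ℝ → ℝ, ContDiff ℝ ∞ φ → ∀ f ∈ A, φ ∘ f ∈ A
  semigroup_mem : ∀ t, ∀ f ∈ A, semigroupOp P t f ∈ A
  generator_mem : ∀ f ∈ A, generator P f ∈ A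
  heat : ∀ f ∈ A, ∀ x, ∀ t : ℝ≥0,
    HasDerivWithinAt (fun s : ℝ => semigroupOp P s.toNNReal f x)
      (semigroupOp P t (generator P f) x) (Set.Ici 0) (t : ℝ)
  diffusion : ∀ φ : ℝ → ℝ, ContDiff ℝ ∞ φ → ∀ f ∈ A, ∀ x,
    generator P (φ ∘ f) x =
      deriv φ (f x) * generator P f x + deriv (deriv φ) (f x) * carreDuChamp P f f x

end Manifold

end LocalTransport

end

open LocalTransport

/-! Duality links Γ₂ to transport. By Kantorovich, W₂²(ν,μ) ≤ K as soon as ∫φ dν − ∫ψ dμ ≤ K for all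
φ, ψ in `A` with φ(x) − ψ(y) ≤ d(x,y)²/2. Such a pair is joined, up to ε, by a smooth subsolution w
of ∂_θ w + ½Γ(w) ≤ 0, with w_1 ≥ φ − ε and w_0 below ψ + ε in mean for a prescribed measure
(`exists_subsolution`).

From curvature to transport. The function s ↦ P_s(P_{t−s}f)² has first derivative 2P_sΓ(P_{t−s}f)
and second-order coefficient 4P_sΓ₂(P_{t−s}f). Comparison with a linear ODE gives e^{2ρt}Γ(P_t f) ≤
P_tΓ(f) under CD(ρ,∞), and Γ(P_t f) + (2t/n)(LP_t f)² ≤ P_tΓ(f) under CD(0,n). For a density h put v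
= P_{u−s}h and k = P_{τ(s)}w_{θ(s)}, and differentiate P_s(vk) − C P_s(v log v) at x
(`transport_interpolation`). The entropy term −CΓ(v)/v absorbs the cross term 2Γ(v,k) up to vΓ(k)/C,
which Hamilton-Jacobi and the gradient bound pay for. Under CD(ρ,∞), τ = u − s and the time change θ
fixes the value of C. Under CD(0,n), τ runs from u₂ to 0; the remaining multiple of Lk is bounded by
completing the square against (Lk)², and this bound integrates to the dimensional defect. Taking h
proportional to e^{φ/C} yields C log P_{u₁}e^{φ/C} ≤ P_{u₂}ψ + D (`log_realOp_exp_le`), and the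
Gibbs variational inequality returns to an arbitrary h.

From transport to curvature. Apply the inequality to h = 1 + εg with the admissible pair φ = εf −
ε²Γ(f)/2 − Kε³, ψ = εf. The order ε² is a variance bound for P_u (`variance_le_of_transport`), whose
expansion to order u² as u → 0 is the Γ₂ bound (`le_gammaTwo_of_variance_le`). For CD(0,n) the
second time is u(1+εa), and optimizing over a produces (Lf)²/n.

The subsolution is a soft minimum of functions b_i + ρ_i²/(2(θ+s₀)), where the ρ_i are smooth, of
gradient at most one, and close to truncated distances. They come from mollification in charts where
the metric is nearly constant, glued by a partition of unity; completeness enters through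
compactness of closed balls. On the analytic side, time derivatives are taken uniformly on M,
because P_t contracts the sup norm and therefore preserves uniform remainders. -/

noncomputable section

namespace LocalTransport

open Filter Topology Asymptotics Set

/-! ### Time derivatives that are uniform on the space -/

section SemigroupCalculus

variable {M : Type*} [MeasurableSpace M]

/-- The part of the definition of a diffusion semigroup that does not refer to the manifold. -/
structure IsDiffusionAlgebra (P : ℝ≥0 → Kernel M M) (A : Subalgebra ℝ (M → ℝ)) : Prop
    extends IsMarkovSemigroup P where
  measurable : ∀ f ∈ A, Measurable f
  bounded : ∀ f ∈ A, ∃ C : ℝ, ∀ x, |f x| ≤ C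
  comp_mem : ∀ φ : ℝ → ℝ, ContDiff ℝ ∞ φ → ∀ f ∈ A, φ ∘ f ∈ A
  semigroup_mem : ∀ t, ∀ f ∈ A, semigroupOp P t f ∈ A
  generator_mem : ∀ f ∈ A, generator P f ∈ A
  heat : ∀ f ∈ A, ∀ x, ∀ t : ℝ≥0,
    HasDerivWithinAt (fun s : ℝ => semigroupOp P s.toNNReal f x)
      (semigroupOp P t (generator P f) x) (Set.Ici 0) (t : ℝ)
  diffusion : ∀ φ : ℝ → ℝ, ContDiff ℝ ∞ φ → ∀ f ∈ A, ∀ x,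
    generator P (φ ∘ f) x =
      deriv φ (f x) * generator P f x + deriv (deriv φ) (f x) * carreDuChamp P f f x
  carre_nonneg : ∀ f ∈ A, ∀ x, 0 ≤ carreDuChamp P f f x

/-- The semigroup operator, indexed by real times. -/
def realOp (P : ℝ≥0 → Kernel M M) (t : ℝ) (f : M → ℝ) (x : M) : ℝ :=
  semigroupOp P t.toNNReal f x

/-- `F'` is the derivative at `s` of `r ↦ F r` within `S`, uniformly on `M`. -/
def HasUniformDerivWithinAt {M : Type*} (F : ℝ → M → ℝ) (F' : M → ℝ) (S : Set ℝ) (s : ℝ) : Prop :=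
  (fun p : ℝ × M => F p.1 p.2 - F s p.2 - (p.1 - s) * F' p.2)
    =o[𝓝[S] s ×ˢ (⊤ : Filter M)] fun p => p.1 - s

namespace HasUniformDerivWithinAt

variable {M : Type*} {F G : ℝ → M → ℝ} {F' G' : M → ℝ} {S : Set ℝ} {s : ℝ}

theorem eventually_le (h : HasUniformDerivWithinAt F F' S s) {ε : ℝ} (hε : 0 < ε) :
    ∀ᶠ r in 𝓝[S] s, ∀ x, |F r x - F s x - (r - s) * F' x| ≤ ε * |r - s| := by
  have := h.bound hε
  rw [Filter.eventually_prod_iff] at this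
  obtain ⟨pa, ha, pb, hb, H⟩ := this
  filter_upwards [ha] with r hr x
  have : pb x := by
    rw [Filter.eventually_top] at hb; exact hb x
  simpa using H hr this

theorem isBigO_const {f : M → ℝ} {l : Filter ℝ} {C : ℝ} (hf : ∀ x, |f x| ≤ C) :
    (fun p : ℝ × M => f p.2) =O[l ×ˢ (⊤ : Filter M)] fun _ => (1 : ℝ) :=
  IsBigO.of_bound C (Eventually.of_forall fun p => by simpa using hf p.2)

theorem tendsto_fst_sub : Tendsto (fun p : ℝ × M => p.1 - s) (𝓝[S] s ×ˢ (⊤ : Filter M)) (𝓝 0) := by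
  have : Tendsto (fun r : ℝ => r - s) (𝓝[S] s) (𝓝 0) := by
    have : Tendsto (fun r : ℝ => r - s) (𝓝 s) (𝓝 (s - s)) := by
      exact (continuous_id.sub continuous_const).tendsto s
    simpa using this.mono_left nhdsWithin_le_nhds
  exact this.comp tendsto_fst

theorem isLittleO_one : (fun p : ℝ × M => p.1 - s) =o[𝓝[S] s ×ˢ (⊤ : Filter M)] fun _ => (1 : ℝ) :=
  (isLittleO_one_iff ℝ).2 tendsto_fst_sub

theorem sub_isBigO (h : HasUniformDerivWithinAt F F' S s) {C : ℝ} (hF' : ∀ x, |F' x| ≤ C) :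
    (fun p : ℝ × M => F p.1 p.2 - F s p.2) =O[𝓝[S] s ×ˢ (⊤ : Filter M)] fun p => p.1 - s := by
  have h2 : (fun p : ℝ × M => (p.1 - s) * F' p.2)
      =O[𝓝[S] s ×ˢ (⊤ : Filter M)] fun p => p.1 - s := by
    simpa using (isBigO_refl (fun p : ℝ × M => p.1 - s) _).mul (isBigO_const hF')
  exact (h.isBigO.add h2).congr_left fun p => by ring

theorem congr_deriv (h : HasUniformDerivWithinAt F F' S s) (h' : ∀ x, F' x = G' x) :
    HasUniformDerivWithinAt F G' S s := by
  rwa [show G' = F' from funext fun x => (h' x).symm]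

theorem const (f : M → ℝ) : HasUniformDerivWithinAt (fun _ => f) 0 S s := by
  simp [HasUniformDerivWithinAt]

theorem mul (hF : HasUniformDerivWithinAt F F' S s) (hG : HasUniformDerivWithinAt G G' S s)
    (bF : ∃ C, ∀ x, |F s x| ≤ C) (bF' : ∃ C, ∀ x, |F' x| ≤ C)
    (bG : ∃ C, ∀ x, |G s x| ≤ C) (bG' : ∃ C, ∀ x, |G' x| ≤ C) :
    HasUniformDerivWithinAt (fun r => F r * G r) (F' * G s + F s * G') S s := by
  obtain ⟨_, bF⟩ := bF
  obtain ⟨_, bF'⟩ := bF'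
  obtain ⟨_, bG⟩ := bG
  obtain ⟨_, bG'⟩ := bG'
  have h1 : _ =o[𝓝[S] s ×ˢ (⊤ : Filter M)] fun p => (p.1 - s) * 1 :=
    IsLittleO.mul_isBigO hF (isBigO_const bG)
  have h2 : _ =o[𝓝[S] s ×ˢ (⊤ : Filter M)] fun p => (p.1 - s) * 1 :=
    IsLittleO.mul_isBigO hG (isBigO_const bF)
  have h3 := (hF.sub_isBigO bF').mul_isLittleO ((hG.sub_isBigO bG').trans_isLittleO isLittleO_one)
  refine (((h1.add h2).add h3).congr_left fun p => ?_).congr_right fun p => mul_one _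
  simp only [Pi.add_apply, Pi.mul_apply]
  ring

theorem smul_const {c : ℝ → ℝ} {c' : ℝ} (hc : HasDerivWithinAt c c' S s) {f : M → ℝ}
    (bf : ∃ C, ∀ x, |f x| ≤ C) :
    HasUniformDerivWithinAt (fun r x => c r * f x) (fun x => c' * f x) S s := by
  obtain ⟨C, bf⟩ := bf
  have h := hasDerivWithinAt_iff_isLittleO.1 hc
  have h2 : (fun p : ℝ × M => c p.1 - c s - (p.1 - s) • c')
      =o[𝓝[S] s ×ˢ (⊤ : Filter M)] fun p => p.1 - s := h.comp_tendsto tendsto_fst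
  refine ((h2.mul_isBigO (isBigO_const bf)).congr_left fun p => ?_).congr_right fun p => mul_one _
  simp only [smul_eq_mul]
  ring

theorem comp_time {τ : ℝ → ℝ} {τ' : ℝ} {T : Set ℝ} (hτ : HasDerivWithinAt τ τ' T s)
    (hF : HasUniformDerivWithinAt F F' S (τ s)) (hmaps : MapsTo τ T S)
    (bF' : ∃ C, ∀ x, |F' x| ≤ C) :
    HasUniformDerivWithinAt (fun r => F (τ r)) (fun x => τ' * F' x) T s := by
  have ht : Tendsto τ (𝓝[T] s) (𝓝[S] (τ s)) :=
    hτ.continuousWithinAt.tendsto_nhdsWithin hmaps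
  have h1 : (fun p : ℝ × M => F (τ p.1) p.2 - F (τ s) p.2 - (τ p.1 - τ s) * F' p.2)
      =o[𝓝[T] s ×ˢ (⊤ : Filter M)] fun p => τ p.1 - τ s :=
    (hF.comp_tendsto (ht.prodMap (tendsto_id (x := (⊤ : Filter M)))))
  have h2 : (fun r => τ r - τ s) =O[𝓝[T] s] fun r => r - s := hτ.hasFDerivWithinAt.isBigO_sub
  have h3 : (fun p : ℝ × M => τ p.1 - τ s) =O[𝓝[T] s ×ˢ (⊤ : Filter M)] fun p => p.1 - s :=
    h2.comp_tendsto tendsto_fst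
  refine ((h1.trans_isBigO h3).add (smul_const hτ bF')).congr_left fun p => ?_
  ring

/-- Since F_s is bounded and F_r is uniformly close to it, only a compact range of φ matters. There
φ'' is bounded, so the Taylor remainder of φ is uniformly quadratic. -/
theorem comp_smooth {φ : ℝ → ℝ} (hφ : ContDiff ℝ ∞ φ) (hF : HasUniformDerivWithinAt F F' S s)
    (bF : ∃ C, ∀ x, |F s x| ≤ C) (bF' : ∃ C, ∀ x, |F' x| ≤ C) :
    HasUniformDerivWithinAt (fun r x => φ (F r x)) (fun x => deriv φ (F s x) * F' x) S s := by
  obtain ⟨C, bF⟩ := bF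
  obtain ⟨C', bF'⟩ := bF'
  have hφ1 : Differentiable ℝ φ := hφ.differentiable (by simp)
  have hφ' : ContDiff ℝ ∞ (deriv φ) := (contDiff_infty_iff_deriv.1 hφ).2
  have hφ1' : Differentiable ℝ (deriv φ) := hφ'.differentiable (by simp)
  have hφ'' : Continuous (deriv (deriv φ)) := (contDiff_infty_iff_deriv.1 hφ').2.continuous
  obtain ⟨K, hK⟩ := (isCompact_Icc (a := -C - 1) (b := C + 1)).exists_bound_of_continuousOn
    hφ''.continuousOn
  have key : ∀ a ∈ Icc (-C - 1) (C + 1), ∀ b ∈ Icc (-C - 1) (C + 1),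
      |φ b - φ a - deriv φ a * (b - a)| ≤ K * |b - a| * |b - a| := by
    intro a ha b hb
    have hsub : uIcc a b ⊆ Icc (-C - 1) (C + 1) := uIcc_subset_Icc ha hb
    have h1 : ∀ z ∈ uIcc a b, ‖deriv φ z - deriv φ a‖ ≤ K * |b - a| := by
      intro z hz
      have hK0 : 0 ≤ K := (norm_nonneg _).trans (hK a ha)
      have := (convex_uIcc a b).norm_image_sub_le_of_norm_deriv_le (f := deriv φ) (C := K)
        (fun x _ => hφ1' x) (fun x hx => hK x (hsub hx)) left_mem_uIcc hz
      refine this.trans (mul_le_mul_of_nonneg_left ?_ hK0)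
      exact abs_sub_left_of_mem_uIcc hz
    have := (convex_uIcc a b).norm_image_sub_le_of_norm_hasDerivWithin_le
      (f := fun z => φ z - deriv φ a * z) (f' := fun z => deriv φ z - deriv φ a)
      (C := K * |b - a|) (fun x _ => (((hφ1 x).hasDerivAt).sub
        (by simpa using (hasDerivAt_id x).const_mul (deriv φ a))).hasDerivWithinAt)
      h1 left_mem_uIcc right_mem_uIcc
    simp only [Real.norm_eq_abs] at this
    convert this using 2
    ring
  have hO := hF.sub_isBigO bF'
  have hsmall : ∀ᶠ p in 𝓝[S] s ×ˢ (⊤ : Filter M), |F p.1 p.2 - F s p.2| ≤ 1 := by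
    simpa using (hO.trans_isLittleO isLittleO_one).bound one_pos
  have h2 : (fun p : ℝ × M => φ (F p.1 p.2) - φ (F s p.2) - deriv φ (F s p.2) *
      (F p.1 p.2 - F s p.2)) =O[𝓝[S] s ×ˢ (⊤ : Filter M)]
      fun p => (F p.1 p.2 - F s p.2) * (F p.1 p.2 - F s p.2) := by
    refine IsBigO.of_bound K ?_
    filter_upwards [hsmall] with p hp
    have hb := abs_le.1 (bF p.2)
    have hp' := abs_le.1 hp
    have := key (F s p.2) ⟨by linarith, by linarith⟩ (F p.1 p.2) ⟨by linarith, by linarith⟩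
    simpa [abs_mul, mul_assoc] using this
  have h3 := h2.trans_isLittleO (hO.mul_isLittleO (hO.trans_isLittleO isLittleO_one))
  obtain ⟨D, hD⟩ := (isCompact_Icc (a := -C) (b := C)).exists_bound_of_continuousOn
    hφ'.continuous.continuousOn
  have bD : ∀ x, |deriv φ (F s x)| ≤ D := fun x => hD _ (abs_le.1 (bF x))
  have h4 := IsLittleO.mul_isBigO hF (isBigO_const (l := 𝓝[S] s) bD)
  refine ((h3.add h4).congr_left fun p => ?_).congr_right fun p => mul_one _
  ring

end HasUniformDerivWithinAt

end SemigroupCalculus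

end LocalTransport

end

/-! ### Calculus of P_t, L and Γ on the algebra -/

noncomputable section

namespace LocalTransport

open Filter Topology Asymptotics Set

section AlgebraCalculus

variable {M : Type*} [MeasurableSpace M] {P : ℝ≥0 → Kernel M M} {A : Subalgebra ℝ (M → ℝ)}

namespace IsDiffusionAlgebra

variable (hA : IsDiffusionAlgebra P A)

include hA

theorem isProbabilityMeasure (t : ℝ≥0) (x : M) : IsProbabilityMeasure (P t x) := by
  have := hA.markov t
  infer_instance

theorem integrable {f : M → ℝ} (hf : f ∈ A) (t : ℝ≥0) (x : M) : Integrable f (P t x) := by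
  have := hA.isProbabilityMeasure t x
  obtain ⟨C, hC⟩ := hA.bounded f hf
  exact Integrable.of_bound (hA.measurable f hf).aestronglyMeasurable C
    (Eventually.of_forall hC)

omit [MeasurableSpace M] hA in
theorem const_mem (c : ℝ) : (fun _ => c) ∈ A := A.algebraMap_mem c

theorem realOp_mem {f : M → ℝ} (hf : f ∈ A) (t : ℝ) : realOp P t f ∈ A :=
  hA.semigroup_mem _ f hf

theorem realOp_add {f g : M → ℝ} (hf : f ∈ A) (hg : g ∈ A) (t : ℝ) (x : M) :
    realOp P t (f + g) x = realOp P t f x + realOp P t g x :=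
  integral_add (hA.integrable hf _ x) (hA.integrable hg _ x)

theorem realOp_sub {f g : M → ℝ} (hf : f ∈ A) (hg : g ∈ A) (t : ℝ) (x : M) :
    realOp P t (f - g) x = realOp P t f x - realOp P t g x :=
  integral_sub (hA.integrable hf _ x) (hA.integrable hg _ x)

omit hA in
theorem realOp_smul (c : ℝ) (f : M → ℝ) (t : ℝ) (x : M) :
    realOp P t (c • f) x = c * realOp P t f x :=
  integral_const_mul c f

theorem realOp_const (c : ℝ) (t : ℝ) (x : M) : realOp P t (fun _ => c) x = c := by
  have := hA.isProbabilityMeasure t.toNNReal x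
  simp [realOp, semigroupOp]

theorem realOp_mono {f g : M → ℝ} (hf : f ∈ A) (hg : g ∈ A) (h : ∀ y, f y ≤ g y) (t : ℝ) (x : M) :
    realOp P t f x ≤ realOp P t g x :=
  integral_mono (hA.integrable hf _ x) (hA.integrable hg _ x) h

omit hA in
theorem realOp_nonneg {f : M → ℝ} (h : ∀ y, 0 ≤ f y) (t : ℝ) (x : M) :
    0 ≤ realOp P t f x :=
  integral_nonneg h

theorem abs_realOp_le {f : M → ℝ} {C : ℝ} (h : ∀ y, |f y| ≤ C) (t : ℝ) (x : M) :
    |realOp P t f x| ≤ C := by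
  have := hA.isProbabilityMeasure t.toNNReal x
  have := norm_integral_le_of_norm_le_const (μ := P t.toNNReal x) (f := f) (C := C)
    (Eventually.of_forall h)
  simpa [realOp, semigroupOp] using this

theorem realOp_zero {f : M → ℝ} (hf : f ∈ A) (x : M) : realOp P 0 f x = f x := by
  simp only [realOp, semigroupOp, Real.toNNReal_zero, hA.zero, Kernel.id_apply]
  exact integral_dirac' _ _ (hA.measurable f hf).stronglyMeasurable

theorem realOp_realOp {f : M → ℝ} (hf : f ∈ A) {s t : ℝ} (hs : 0 ≤ s) (ht : 0 ≤ t) (x : M) :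
    realOp P s (realOp P t f) x = realOp P (s + t) f x := by
  simp only [realOp, semigroupOp, Real.toNNReal_add hs ht]
  have h := hA.integrable hf (s.toNNReal + t.toNNReal) x
  rw [hA.add] at h ⊢
  rw [Kernel.integral_comp h]

theorem hasDerivWithinAt_realOp {f : M → ℝ} (hf : f ∈ A) {t : ℝ} (ht : 0 ≤ t) (x : M) :
    HasDerivWithinAt (fun s => realOp P s f x) (realOp P t (generator P f) x) (Ici 0) t := by
  have := hA.heat f hf x t.toNNReal
  rw [Real.coe_toNNReal t ht] at this
  exact this

theorem continuousOn_realOp {f : M → ℝ} (hf : f ∈ A) (x : M) :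
    ContinuousOn (fun s => realOp P s f x) (Ici 0) :=
  fun _ ht => (hA.hasDerivWithinAt_realOp hf ht x).continuousWithinAt

theorem hasDerivWithinAt_zero {f : M → ℝ} (hf : f ∈ A) (x : M) :
    HasDerivWithinAt (fun s => realOp P s f x) (generator P f x) (Ici 0) 0 := by
  simpa [hA.realOp_zero (hA.generator_mem f hf)] using hA.hasDerivWithinAt_realOp hf le_rfl x

omit hA in
theorem generator_eq_of_hasDerivWithinAt {f : M → ℝ} {x : M} {d : ℝ}
    (h : HasDerivWithinAt (fun s => realOp P s f x) d (Ici 0) 0) : generator P f x = d :=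
  h.derivWithin (uniqueDiffOn_Ici 0 0 self_mem_Ici)

theorem generator_add {f g : M → ℝ} (hf : f ∈ A) (hg : g ∈ A) :
    generator P (f + g) = generator P f + generator P g := by
  ext x
  refine generator_eq_of_hasDerivWithinAt ?_
  simp only [hA.realOp_add hf hg]
  exact (hA.hasDerivWithinAt_zero hf x).add (hA.hasDerivWithinAt_zero hg x)

theorem generator_smul {f : M → ℝ} (hf : f ∈ A) (c : ℝ) :
    generator P (c • f) = c • generator P f := by
  ext x
  refine generator_eq_of_hasDerivWithinAt ?_
  simp only [realOp_smul]
  exact (hA.hasDerivWithinAt_zero hf x).const_mul c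

theorem generator_sub {f g : M → ℝ} (hf : f ∈ A) (hg : g ∈ A) :
    generator P (f - g) = generator P f - generator P g := by
  have : f - g = f + (-1 : ℝ) • g := by ext; simp [sub_eq_add_neg]
  rw [this, hA.generator_add hf (A.smul_mem hg _), hA.generator_smul hg]
  ext; simp [sub_eq_add_neg]

/-- The semigroup law makes P_s P_t f = P_{t+s} f, so the derivative at s = 0 is the heat equation
for f at time t. -/
theorem generator_realOp {f : M → ℝ} (hf : f ∈ A) {t : ℝ} (ht : 0 ≤ t) :
    generator P (realOp P t f) = realOp P t (generator P f) := by
  ext x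
  refine generator_eq_of_hasDerivWithinAt ?_
  have h := hA.hasDerivWithinAt_realOp hf ht x
  have h' : HasDerivWithinAt (fun s => realOp P (t + s) f x)
      (realOp P t (generator P f) x) (Ici 0) 0 := by
    have h2 : HasDerivWithinAt (fun s : ℝ => t + s) 1 (Ici 0) 0 :=
      ((hasDerivAt_id 0).const_add t).hasDerivWithinAt
    have h3 := HasDerivWithinAt.scomp (x := (0 : ℝ)) (h := fun s : ℝ => t + s)
      (h' := 1) (g₁ := fun s => realOp P s f x)
      (g₁' := realOp P t (generator P f) x) (t' := Ici 0) (s := Ici 0)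
      (by simpa using h) h2 (fun s hs => by simp at hs ⊢; linarith)
    simpa [Function.comp_def] using h3
  refine h'.congr (fun s hs => ?_) ?_
  · rw [hA.realOp_realOp hf hs ht, add_comm]
  · rw [hA.realOp_realOp hf le_rfl ht, add_comm]

theorem carreDuChamp_mem {f g : M → ℝ} (hf : f ∈ A) (hg : g ∈ A) : carreDuChamp P f g ∈ A := by
  have : carreDuChamp P f g = (1 / 2 : ℝ) • (generator P (f * g) - f * generator P g
      - g * generator P f) := by
    ext x; simp [carreDuChamp]; ring
  rw [this]
  exact A.smul_mem (A.sub_mem (A.sub_mem (hA.generator_mem _ (A.mul_mem hf hg))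
    (A.mul_mem hf (hA.generator_mem _ hg))) (A.mul_mem hg (hA.generator_mem _ hf))) _

omit hA in
theorem generator_mul {f g : M → ℝ} (x : M) :
    generator P (f * g) x = f x * generator P g x + g x * generator P f x
      + 2 * carreDuChamp P f g x := by
  simp only [carreDuChamp]; ring

omit hA in
theorem carreDuChamp_comm (f g : M → ℝ) : carreDuChamp P f g = carreDuChamp P g f := by
  ext x; simp only [carreDuChamp, mul_comm f g]; ring

theorem carreDuChamp_add_right {f g k : M → ℝ} (hf : f ∈ A) (hg : g ∈ A) (hk : k ∈ A) (x : M) :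
    carreDuChamp P f (g + k) x = carreDuChamp P f g x + carreDuChamp P f k x := by
  simp only [carreDuChamp, mul_add, hA.generator_add (A.mul_mem hf hg) (A.mul_mem hf hk),
    hA.generator_add hg hk, Pi.add_apply]
  ring

theorem carreDuChamp_smul_right {f g : M → ℝ} (hf : f ∈ A) (hg : g ∈ A) (c : ℝ) (x : M) :
    carreDuChamp P f (c • g) x = c * carreDuChamp P f g x := by
  simp only [carreDuChamp, mul_smul_comm, hA.generator_smul (A.mul_mem hf hg),
    hA.generator_smul hg, Pi.smul_apply, smul_eq_mul]
  ring

/-- Cauchy-Schwarz: the quadratic polynomial c ↦ Γ(f + cg) is nonnegative, so its discriminant is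
nonpositive. -/
theorem carreDuChamp_sq_le {f g : M → ℝ} (hf : f ∈ A) (hg : g ∈ A) (x : M) :
    carreDuChamp P f g x ^ 2 ≤ carreDuChamp P f f x * carreDuChamp P g g x := by
  have key : ∀ c : ℝ, 0 ≤ carreDuChamp P g g x * (c * c) + (2 * carreDuChamp P f g x) * c
      + carreDuChamp P f f x := by
    intro c
    have hc := A.smul_mem hg c
    have hfc := A.add_mem hf hc
    have h := hA.carre_nonneg _ hfc x
    rw [hA.carreDuChamp_add_right hfc hf hc, hA.carreDuChamp_smul_right hfc hg,
      carreDuChamp_comm _ f, carreDuChamp_comm _ g, hA.carreDuChamp_add_right hf hf hc,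
      hA.carreDuChamp_smul_right hf hg, hA.carreDuChamp_add_right hg hf hc,
      hA.carreDuChamp_smul_right hg hg, carreDuChamp_comm g f] at h
    linarith
  have := discrim_le_zero key
  simp only [discrim] at this
  nlinarith

/-- The variance of `f` is nonnegative. -/
theorem sq_realOp_le {f : M → ℝ} (hf : f ∈ A) (t : ℝ) (x : M) :
    realOp P t f x ^ 2 ≤ realOp P t (f * f) x := by
  set c := realOp P t f x with hc
  have h : 0 ≤ realOp P t ((f * f + (-2 * c) • f) + fun _ => c ^ 2) x :=
    realOp_nonneg (fun y => by
      simp only [Pi.add_apply, Pi.mul_apply, Pi.smul_apply, smul_eq_mul]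
      nlinarith [sq_nonneg (f y - c)]) t x
  rw [hA.realOp_add (A.add_mem (A.mul_mem hf hf) (A.smul_mem hf _)) (const_mem _),
    hA.realOp_add (A.mul_mem hf hf) (A.smul_mem hf _), realOp_smul, hA.realOp_const, ← hc] at h
  nlinarith

theorem abs_realOp_sub_le {f : M → ℝ} (hf : f ∈ A) {C : ℝ} (hC : ∀ y, |generator P f y| ≤ C)
    {s t : ℝ} (hs : 0 ≤ s) (ht : 0 ≤ t) (x : M) :
    |realOp P t f x - realOp P s f x| ≤ C * |t - s| :=
  (convex_Ici 0).norm_image_sub_le_of_norm_hasDerivWithin_le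
    (f := fun r => realOp P r f x) (fun _ hr => hA.hasDerivWithinAt_realOp hf hr x)
    (fun _ _ => hA.abs_realOp_le hC _ x) hs ht

/-- As `A` is stable under L, every L^k f is bounded, and Taylor bounds for P_t f hold uniformly in
x and in the base time. The constants are not sharp; only the orders are needed. -/
theorem abs_realOp_sub_sub_le {f : M → ℝ} (hf : f ∈ A) {C : ℝ}
    (hC : ∀ y, |generator P (generator P f) y| ≤ C) {s t : ℝ} (hs : 0 ≤ s) (ht : 0 ≤ t) (x : M) :
    |realOp P t f x - realOp P s f x - (t - s) * realOp P s (generator P f) x|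
      ≤ C * |t - s| ^ 2 := by
  have hsub : uIcc s t ⊆ Ici 0 := fun r hr => (le_min hs ht).trans hr.1
  have := (convex_uIcc s t).norm_image_sub_le_of_norm_hasDerivWithin_le
    (f := fun r => realOp P r f x - r * realOp P s (generator P f) x)
    (f' := fun r => realOp P r (generator P f) x - realOp P s (generator P f) x)
    (C := C * |t - s|)
    (fun r hr => (((hA.hasDerivWithinAt_realOp hf (hsub hr) x).mono hsub).sub
      (by simpa using ((hasDerivAt_id r).mul_const
        (realOp P s (generator P f) x)).hasDerivWithinAt)))
    (fun r hr => by
      have hC0 : 0 ≤ C := (abs_nonneg _).trans (hC x)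
      refine (hA.abs_realOp_sub_le (hA.generator_mem f hf) hC hs (hsub hr) x).trans ?_
      exact mul_le_mul_of_nonneg_left (abs_sub_left_of_mem_uIcc hr) hC0)
    left_mem_uIcc right_mem_uIcc
  simp only [Real.norm_eq_abs] at this
  convert this using 1
  · congr 1; ring
  · ring

theorem abs_realOp_taylor_two_le {f : M → ℝ} (hf : f ∈ A) {C : ℝ}
    (hC : ∀ y, |generator P (generator P (generator P f)) y| ≤ C) {s t : ℝ} (hs : 0 ≤ s)
    (ht : 0 ≤ t) (x : M) :
    |realOp P t f x - realOp P s f x - (t - s) * realOp P s (generator P f) x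
      - (t - s) ^ 2 / 2 * realOp P s (generator P (generator P f)) x| ≤ C * |t - s| ^ 3 := by
  have hsub : uIcc s t ⊆ Ici 0 := fun r hr => (le_min hs ht).trans hr.1
  have := (convex_uIcc s t).norm_image_sub_le_of_norm_hasDerivWithin_le
    (f := fun r => realOp P r f x - r * realOp P s (generator P f) x
      - (r - s) ^ 2 / 2 * realOp P s (generator P (generator P f)) x)
    (f' := fun r => realOp P r (generator P f) x - realOp P s (generator P f) x
      - (r - s) * realOp P s (generator P (generator P f)) x)
    (C := C * |t - s| ^ 2)
    (fun r hr => by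
      have h1 := (hA.hasDerivWithinAt_realOp hf (hsub hr) x).mono hsub
      have h2 : HasDerivWithinAt (fun r => r * realOp P s (generator P f) x)
        (realOp P s (generator P f) x) (uIcc s t) r := by
        simpa using ((hasDerivAt_id r).mul_const
          (realOp P s (generator P f) x)).hasDerivWithinAt
      have h3 : HasDerivWithinAt (fun r => (r - s) ^ 2 / 2 *
          realOp P s (generator P (generator P f)) x)
        ((r - s) * realOp P s (generator P (generator P f)) x) (uIcc s t) r := by
        have := ((((hasDerivAt_id r).sub_const s).pow 2).div_const 2).mul_const
          (realOp P s (generator P (generator P f)) x)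
        refine (this.congr_deriv ?_).hasDerivWithinAt
        simp
      exact (h1.sub h2).sub h3)
    (fun r hr => by
      have hC0 : 0 ≤ C := (abs_nonneg _).trans (hC x)
      refine (hA.abs_realOp_sub_sub_le (hA.generator_mem f hf) hC hs (hsub hr) x).trans ?_
      exact mul_le_mul_of_nonneg_left
        (pow_le_pow_left₀ (abs_nonneg _) (abs_sub_left_of_mem_uIcc hr) 2) hC0)
    left_mem_uIcc right_mem_uIcc
  simp only [Real.norm_eq_abs] at this
  convert this using 1
  · congr 1; ring
  · ring

/-- The derivative of `P_{τ(r)} F_r`, uniformly on `M`. -/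
theorem hasUniformDerivWithinAt_realOp {F : ℝ → M → ℝ} {F' : M → ℝ} {S : Set ℝ} {s : ℝ}
    (hs : s ∈ S) (hF : HasUniformDerivWithinAt F F' S s) (hFA : ∀ r ∈ S, F r ∈ A) (hF'A : F' ∈ A)
    {τ : ℝ → ℝ} {τ' : ℝ} (hτ : HasDerivWithinAt τ τ' S s) (hτ0 : ∀ r ∈ S, 0 ≤ τ r) :
    HasUniformDerivWithinAt (fun r => realOp P (τ r) (F r))
      (realOp P (τ s) (F' + τ' • generator P (F s))) S s := by
  have hLF := hA.generator_mem _ (hFA s hs)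
  obtain ⟨C1, hC1⟩ := hA.bounded _ hLF
  obtain ⟨C2, hC2⟩ := hA.bounded _ (hA.generator_mem _ hLF)
  obtain ⟨C3, hC3⟩ := hA.bounded _ (hA.generator_mem _ hF'A)
  have hτO : (fun p : ℝ × M => τ p.1 - τ s) =O[𝓝[S] s ×ˢ (⊤ : Filter M)] fun p => p.1 - s :=
    (show (fun r => τ r - τ s) =O[𝓝[S] s] fun r => r - s from
      hτ.hasFDerivWithinAt.isBigO_sub).comp_tendsto tendsto_fst
  have hτo := hτO.trans_isLittleO HasUniformDerivWithinAt.isLittleO_one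
  have memS : ∀ᶠ p in 𝓝[S] s ×ˢ (⊤ : Filter M), p.1 ∈ S :=
    tendsto_fst.eventually (eventually_mem_nhdsWithin (a := s) (s := S))
  -- The increment of P_τ F splits into four uniform errors: the remainder of F, kept small by
  -- sup-norm contraction; the remainder of τ ↦ P_τ F_s; the replacement of P_{τ(r)}F' by
  -- P_{τ(s)}F'; and the remainder of τ.
  have e1 : (fun p : ℝ × M => realOp P (τ p.1) (F p.1 - F s - (p.1 - s) • F') p.2)
      =o[𝓝[S] s ×ˢ (⊤ : Filter M)] fun p => p.1 - s := by
    refine IsLittleO.of_bound fun ε hε => ?_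
    filter_upwards [tendsto_fst.eventually (hF.eventually_le hε)] with p hp
    exact hA.abs_realOp_le hp _ _
  have e2 : (fun p : ℝ × M => realOp P (τ p.1) (F s) p.2 - realOp P (τ s) (F s) p.2
      - (τ p.1 - τ s) * realOp P (τ s) (generator P (F s)) p.2)
      =o[𝓝[S] s ×ˢ (⊤ : Filter M)] fun p => p.1 - s := by
    have : (fun p : ℝ × M => realOp P (τ p.1) (F s) p.2 - realOp P (τ s) (F s) p.2
      - (τ p.1 - τ s) * realOp P (τ s) (generator P (F s)) p.2)
      =O[𝓝[S] s ×ˢ (⊤ : Filter M)] fun p => (τ p.1 - τ s) * (τ p.1 - τ s) := by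
      refine IsBigO.of_bound C2 ?_
      filter_upwards [memS] with p hp
      have := hA.abs_realOp_sub_sub_le (hFA s hs) hC2 (hτ0 s hs) (hτ0 p.1 hp) p.2
      simpa [pow_two] using this
    exact (this.trans_isLittleO (hτO.mul_isLittleO hτo)).congr_right fun p => mul_one _
  have e3 : (fun p : ℝ × M => (p.1 - s) * (realOp P (τ p.1) F' p.2 - realOp P (τ s) F' p.2))
      =o[𝓝[S] s ×ˢ (⊤ : Filter M)] fun p => p.1 - s := by
    have : (fun p : ℝ × M => realOp P (τ p.1) F' p.2 - realOp P (τ s) F' p.2)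
        =O[𝓝[S] s ×ˢ (⊤ : Filter M)] fun p => τ p.1 - τ s := by
      refine IsBigO.of_bound C3 ?_
      filter_upwards [memS] with p hp
      exact hA.abs_realOp_sub_le hF'A hC3 (hτ0 s hs) (hτ0 p.1 hp) p.2
    exact ((isBigO_refl _ _).mul_isLittleO (this.trans_isLittleO hτo)).congr_right
      fun p => mul_one _
  have e4 : (fun p : ℝ × M => (τ p.1 - τ s - (p.1 - s) * τ') *
      realOp P (τ s) (generator P (F s)) p.2) =o[𝓝[S] s ×ˢ (⊤ : Filter M)] fun p => p.1 - s := by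
    have h : (fun p : ℝ × M => τ p.1 - τ s - (p.1 - s) • τ')
        =o[𝓝[S] s ×ˢ (⊤ : Filter M)] fun p => p.1 - s :=
      (hasDerivWithinAt_iff_isLittleO.1 hτ).comp_tendsto tendsto_fst
    exact (h.mul_isBigO (HasUniformDerivWithinAt.isBigO_const
      (fun x => hA.abs_realOp_le hC1 (τ s) x))).congr_right fun p => mul_one _
  refine (((e1.add e2).add e3).add e4).congr' ?_ EventuallyEq.rfl
  filter_upwards [memS] with p hp
  rw [hA.realOp_sub (A.sub_mem (hFA _ hp) (hFA _ hs)) (A.smul_mem hF'A _),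
    hA.realOp_sub (hFA _ hp) (hFA _ hs), realOp_smul,
    hA.realOp_add hF'A (A.smul_mem hLF _), realOp_smul]
  ring

/-- The derivative of `P_{τ(r)} F_r` at a point. -/
theorem hasDerivWithinAt_realOp_comp {F : ℝ → M → ℝ} {F' : M → ℝ} {S : Set ℝ} {s : ℝ}
    (hs : s ∈ S) (hF : HasUniformDerivWithinAt F F' S s) (hFA : ∀ r ∈ S, F r ∈ A) (hF'A : F' ∈ A)
    {τ : ℝ → ℝ} {τ' : ℝ} (hτ : HasDerivWithinAt τ τ' S s) (hτ0 : ∀ r ∈ S, 0 ≤ τ r) (x : M) :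
    HasDerivWithinAt (fun r => realOp P (τ r) (F r) x)
      (realOp P (τ s) (F' + τ' • generator P (F s)) x) S s := by
  have h := hA.hasUniformDerivWithinAt_realOp hs hF hFA hF'A hτ hτ0
  rw [hasDerivWithinAt_iff_isLittleO]
  refine IsLittleO.of_bound fun ε hε => ?_
  filter_upwards [h.eventually_le hε] with r hr
  simpa using hr x

end IsDiffusionAlgebra

end AlgebraCalculus

end LocalTransport

end

/-! ### A comparison principle with Peano second derivatives -/

noncomputable section

namespace LocalTransport

open Filter Topology Asymptotics Set

/-- A Peano expansion of order two of a twice differentiable function. -/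
theorem isLittleO_taylor_two {Y Y' : ℝ → ℝ} {c s : ℝ} (hY : ∀ r, HasDerivAt Y (Y' r) r)
    (hY' : HasDerivAt Y' c s) :
    (fun r => Y r - Y s - (r - s) * Y' s - (r - s) ^ 2 / 2 * c) =o[𝓝 s] fun r => (r - s) ^ 2 := by
  have h1 : (fun r => Y' r - Y' s - (r - s) * c) =o[𝓝 s] fun r => (r - s) ^ 1 := by
    simpa using hasDerivAt_iff_isLittleO.1 hY'
  have h2 : ∀ r ∈ (univ : Set ℝ), HasDerivWithinAt
      (fun r => Y r - Y s - (r - s) * Y' s - (r - s) ^ 2 / 2 * c)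
      (Y' r - Y' s - (r - s) * c) univ r := by
    intro r _
    have e1 := (hY r).sub_const (Y s)
    have e2 := ((hasDerivAt_id r).sub_const s).mul_const (Y' s)
    have e3 := ((((hasDerivAt_id r).sub_const s).pow 2).div_const 2).mul_const c
    refine (((e1.sub e2).sub e3).congr_deriv ?_).hasDerivWithinAt
    simp
  have := convex_univ.isLittleO_pow_succ_real (mem_univ s) (n := 1) h2 (by simpa using h1)
  simpa using this

/-- Comparison with the solutions of `Y'' = 2ρY' + κ`, for a function `g` which only has second
derivatives in the sense of Peano. -/
theorem peano_comparison {g g' g₂ Y Y' : ℝ → ℝ} {t ρ κ : ℝ} (ht : 0 < t)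
    (hg : ∀ s ∈ Icc 0 t, HasDerivWithinAt g (g' s) (Icc 0 t) s)
    (hg₂ : ∀ s ∈ Ioo 0 t, (fun r => g r - g s - (r - s) * g' s - (r - s) ^ 2 / 2 * g₂ s)
      =o[𝓝 s] fun r => (r - s) ^ 2)
    (hineq : ∀ s ∈ Ioo 0 t, 2 * ρ * g' s + κ ≤ g₂ s)
    (hY : ∀ s, HasDerivAt Y (Y' s) s) (hY' : ∀ s, HasDerivAt Y' (2 * ρ * Y' s + κ) s)
    (h0 : g 0 = Y 0) (h1 : g t = Y t) : g' 0 ≤ Y' 0 ∧ Y' t ≤ g' t := by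
  -- Maximum principle: g is a subsolution of the equation solved by Y, with the same boundary
  -- values. Replacing Y by Y − εe^{ks} with k > 2ρ makes the inequality strict.
  have hle : ∀ s ∈ Icc 0 t, g s ≤ Y s := by
    intro s₁ hs₁
    by_contra! hlt
    set k := 2 * |ρ| + 1
    have hk : 0 < k := by positivity
    have hkρ : 0 < k - 2 * ρ := by have := le_abs_self ρ; simp only [k]; linarith
    -- Small enough that g − Z at the endpoints, at most εe^{kt}, stays below its value at s₁; the
    -- maximum is then interior.
    set ε := (g s₁ - Y s₁) / (2 * Real.exp (k * t)) with hε
    have hε0 : 0 < ε := div_pos (by linarith) (by positivity)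
    have hεt : ε * Real.exp (k * t) < g s₁ - Y s₁ := by
      rw [hε]; field_simp; linarith
    set Z : ℝ → ℝ := fun s => Y s - ε * Real.exp (k * s)
    set Z' : ℝ → ℝ := fun s => Y' s - ε * (k * Real.exp (k * s))
    have hexp : ∀ s, HasDerivAt (fun s => Real.exp (k * s)) (k * Real.exp (k * s)) s := by
      intro s
      have := ((hasDerivAt_id s).const_mul k).exp
      simpa [mul_comm] using this
    have hZ : ∀ s, HasDerivAt Z (Z' s) s := fun s => (hY s).sub ((hexp s).const_mul ε)
    have hZ' : ∀ s, HasDerivAt Z' (2 * ρ * Y' s + κ - ε * (k * (k * Real.exp (k * s)))) s :=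
      fun s => (hY' s).sub (((hexp s).const_mul k).const_mul ε)
    have hcont : ContinuousOn (fun s => g s - Z s) (Icc 0 t) := fun s hs =>
      (hg s hs).continuousWithinAt.sub (hZ s).continuousAt.continuousWithinAt
    obtain ⟨a, ha, hmax⟩ := isCompact_Icc.exists_isMaxOn (nonempty_Icc.2 ht.le) hcont
    have hmax1 : g s₁ - Z s₁ ≤ g a - Z a := hmax hs₁
    have hpos : ∀ s, 0 < ε * Real.exp (k * s) := fun s => by positivity
    have hmon : ∀ s ≤ t, ε * Real.exp (k * s) ≤ ε * Real.exp (k * t) := fun s hs =>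
      mul_le_mul_of_nonneg_left (Real.exp_le_exp.2 (mul_le_mul_of_nonneg_left hs hk.le)) hε0.le
    have ha' : a ∈ Ioo 0 t := by
      refine ⟨lt_of_le_of_ne ha.1 ?_, lt_of_le_of_ne ha.2 ?_⟩
      · rintro rfl
        simp only [Z] at hmax1
        linarith [hpos s₁, hmon 0 ht.le]
      · rintro rfl
        simp only [Z] at hmax1
        linarith [hpos s₁]
    have hnhds : Icc 0 t ∈ 𝓝 a := Icc_mem_nhds ha'.1 ha'.2
    have hloc : IsLocalMax (fun s => g s - Z s) a := hmax.isLocalMax hnhds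
    have hder : g' a - Z' a = 0 :=
      hloc.hasDerivAt_eq_zero (((hg a ha).hasDerivAt hnhds).sub (hZ a))
    have hd := (hg₂ a ha').sub (isLittleO_taylor_two hZ (hZ' a))
    -- At the maximum g' = Z', so q is the Peano second-order coefficient of g − Z, and q ≥ (k −
    -- 2ρ)εke^{ka} > 0. A nearby point r ≠ a then has a larger value, a contradiction.
    set q := g₂ a - (2 * ρ * Y' a + κ - ε * (k * (k * Real.exp (k * a)))) with hq
    have hqpos : 0 < q := by
      have h3 := hineq a ha'
      have h4 : g' a - Y' a = -(ε * (k * Real.exp (k * a))) := by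
        simp only [Z'] at hder; linarith
      have h5 : q ≥ (k - 2 * ρ) * (ε * (k * Real.exp (k * a))) := by
        have : 2 * ρ * g' a - 2 * ρ * Y' a = 2 * ρ * -(ε * (k * Real.exp (k * a))) := by
          rw [← h4]; ring
        rw [hq]
        nlinarith
      have : 0 < (k - 2 * ρ) * (ε * (k * Real.exp (k * a))) := by positivity
      linarith
    have hb := hd.bound (show 0 < q / 4 by positivity)
    have hev := hb.and hloc
    have hne : ∃ᶠ r in 𝓝 a, r ≠ a := by
      have : ∃ᶠ r in 𝓝[≠] a, r ∈ ({a}ᶜ : Set ℝ) :=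
        (eventually_mem_nhdsWithin (a := a) (s := {a}ᶜ)).frequently
      exact (this.filter_mono nhdsWithin_le_nhds)
    obtain ⟨r, hr, hbr, hlr⟩ := (hne.and_eventually hev).exists
    simp only [Real.norm_eq_abs, abs_pow, sq_abs] at hbr
    have hsq : 0 < (r - a) ^ 2 := by have := sub_ne_zero.2 hr; positivity
    have h6 := (abs_le.1 hbr).1
    have h7 : (r - a) * g' a = (r - a) * Z' a := by
      rw [show g' a = Z' a by linarith]
    have : (r - a) ^ 2 / 2 * q ≤ q / 4 * (r - a) ^ 2 := by
      rw [hq] at h6 ⊢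
      linarith
    nlinarith
  -- As g − Y ≤ 0 vanishes at both endpoints, its one-sided derivatives there have a sign.
  have hqd : ∀ s ∈ Icc 0 t, HasDerivWithinAt (fun s => g s - Y s) (g' s - Y' s) (Icc 0 t) s :=
    fun s hs => (hg s hs).sub (hY s).hasDerivWithinAt
  constructor
  · have h := (hqd 0 ⟨le_rfl, ht.le⟩)
    have hmax : IsMaxOn (fun s => g s - Y s) (Icc 0 t) 0 := fun s hs => by
      simp only [mem_ofPred_eq]; linarith [hle s hs]
    have := hmax.localize.hasFDerivWithinAt_nonpos h.hasFDerivWithinAt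
      (mem_posTangentConeAt_of_segment_subset (y := t) (by
        rw [zero_add, segment_eq_Icc ht.le]))
    simp at this
    by_contra! hc
    nlinarith
  · have h := (hqd t ⟨ht.le, le_rfl⟩)
    have hmax : IsMaxOn (fun s => g s - Y s) (Icc 0 t) t := fun s hs => by
      simp only [mem_ofPred_eq]; linarith [hle s hs]
    have := hmax.localize.hasFDerivWithinAt_nonpos h.hasFDerivWithinAt
      (mem_posTangentConeAt_of_segment_subset (y := -t) (by
        rw [add_neg_cancel, segment_symm, segment_eq_Icc ht.le]))
    simp at this
    by_contra! hc
    nlinarith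

/-! ### Gradient bounds from lower bounds on Γ₂ -/

section GradientBound

variable {M : Type*} [MeasurableSpace M] {P : ℝ≥0 → Kernel M M} {A : Subalgebra ℝ (M → ℝ)}

namespace IsDiffusionAlgebra

variable (hA : IsDiffusionAlgebra P A)

include hA

theorem gammaTwo_mem {f : M → ℝ} (hf : f ∈ A) : gammaTwo P f ∈ A := by
  have : gammaTwo P f = (1 / 2 : ℝ) • (generator P (carreDuChamp P f f)
      - (2 : ℝ) • carreDuChamp P f (generator P f)) := by
    ext x; simp [gammaTwo]; ring
  rw [this]
  exact A.smul_mem (A.sub_mem (hA.generator_mem _ (hA.carreDuChamp_mem hf hf))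
    (A.smul_mem (hA.carreDuChamp_mem hf (hA.generator_mem _ hf)) _)) _

/-- The combination on the right is what the second-order expansion of s ↦ P_s(P_{t−s}f)² produces,
with v = P_{t−s}f. -/
theorem four_smul_gammaTwo {v : M → ℝ} (hv : v ∈ A) :
    (4 : ℝ) • gammaTwo P v = generator P (generator P (v * v))
      - (4 : ℝ) • generator P (v * generator P v)
      + (2 : ℝ) • (generator P v * generator P v + v * generator P (generator P v)) := by
  have hL := hA.generator_mem _ hv
  have hΓ : carreDuChamp P v v = (1 / 2 : ℝ) • generator P (v * v) - v * generator P v := by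
    ext x; simp [carreDuChamp]; ring
  ext x
  simp only [gammaTwo, hΓ, hA.generator_sub (A.smul_mem (hA.generator_mem _ (A.mul_mem hv hv)) _)
    (A.mul_mem hv hL), hA.generator_smul (hA.generator_mem _ (A.mul_mem hv hv)), Pi.smul_apply,
    Pi.sub_apply, Pi.add_apply, Pi.mul_apply, smul_eq_mul, carreDuChamp]
  ring

/-- The derivative of `s ↦ P_s (P_{t-s} f)²`. -/
theorem hasDerivWithinAt_interpolation {f : M → ℝ} (hf : f ∈ A) {t : ℝ} (x : M) {s : ℝ}
    (hs : s ∈ Icc 0 t) :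
    HasDerivWithinAt (fun r => realOp P r (realOp P (t - r) f * realOp P (t - r) f) x)
      (2 * realOp P s (carreDuChamp P (realOp P (t - s) f) (realOp P (t - s) f)) x)
      (Icc 0 t) s := by
  have hτ : HasDerivWithinAt (fun r : ℝ => t - r) (-1) (Icc 0 t) s :=
    ((hasDerivAt_id s).const_sub t).hasDerivWithinAt
  have hτ0 : ∀ r ∈ Icc 0 t, 0 ≤ t - r := fun r hr => by linarith [hr.2]
  have hu := hA.hasUniformDerivWithinAt_realOp hs (HasUniformDerivWithinAt.const f)
    (fun _ _ => hf) A.zero_mem hτ hτ0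
  set v := realOp P (t - s) f with hv
  have hvA : v ∈ A := hA.realOp_mem hf _
  have hLA := hA.generator_mem _ hvA
  have hv' : realOp P (t - s) (0 + (-1 : ℝ) • generator P f) = (-1 : ℝ) • generator P v := by
    ext y
    rw [zero_add, realOp_smul, hv, hA.generator_realOp hf (hτ0 s hs)]
    rfl
  rw [hv'] at hu
  have hbv' := hA.bounded _ (A.smul_mem hLA (-1))
  have hm := hu.mul hu (hA.bounded _ hvA) hbv' (hA.bounded _ hvA) hbv'
  have hFA : ∀ r ∈ Icc 0 t, realOp P (t - r) f * realOp P (t - r) f ∈ A := fun r _ =>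
    A.mul_mem (hA.realOp_mem hf _) (hA.realOp_mem hf _)
  have := hA.hasDerivWithinAt_realOp_comp hs hm hFA
    (A.add_mem (A.mul_mem (A.smul_mem hLA _) hvA) (A.mul_mem hvA (A.smul_mem hLA _)))
    (τ := fun r => r) (hasDerivWithinAt_id s _) (fun r hr => hr.1) x
  refine this.congr_deriv ?_
  rw [← realOp_smul]
  congr 1
  ext y
  simp only [← hv, Pi.add_apply, Pi.mul_apply, Pi.smul_apply, smul_eq_mul, generator_mul]
  ring

/-- An expansion at a point replaces a genuine second derivative. Differentiating P_sΓ(P_{t−s}f)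
directly would apply L to remainders known only to be small in sup norm. Here the remainder of
(P_{t−r}f)² meets only P_r, and L acts on fixed elements of `A`. -/
theorem interpolation_taylor {f : M → ℝ} (hf : f ∈ A) {t : ℝ} (x : M) {s : ℝ}
    (hs : s ∈ Ioo 0 t) :
    (fun r => realOp P r (realOp P (t - r) f * realOp P (t - r) f) x
      - realOp P s (realOp P (t - s) f * realOp P (t - s) f) x
      - (r - s) * (2 * realOp P s (carreDuChamp P (realOp P (t - s) f) (realOp P (t - s) f)) x)
      - (r - s) ^ 2 / 2 * (4 * realOp P s (gammaTwo P (realOp P (t - s) f)) x))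
      =o[𝓝 s] fun r => (r - s) ^ 2 := by
  have hts : 0 ≤ t - s := by linarith [hs.2]
  set v := realOp P (t - s) f with hv
  have hvA : v ∈ A := hA.realOp_mem hf _
  set a := generator P v with ha
  have haA : a ∈ A := hA.generator_mem _ hvA
  set b := generator P a with hb
  have hbA : b ∈ A := hA.generator_mem _ haA
  have ha' : a = realOp P (t - s) (generator P f) := hA.generator_realOp hf hts
  have hb' : b = realOp P (t - s) (generator P (generator P f)) := by
    rw [hb, ha', hA.generator_realOp (hA.generator_mem _ hf) hts]
  obtain ⟨Cf, hCf⟩ := hA.bounded _ hf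
  obtain ⟨Ca, hCa⟩ := hA.bounded _ haA
  obtain ⟨Cb, hCb⟩ := hA.bounded _ hbA
  obtain ⟨C3, hC3⟩ := hA.bounded _
    (hA.generator_mem _ (hA.generator_mem _ (hA.generator_mem _ hf)))
  have hvvA := A.mul_mem hvA hvA
  have hvaA := A.mul_mem hvA haA
  have hmA : a * a + v * b ∈ A := A.add_mem (A.mul_mem haA haA) (A.mul_mem hvA hbA)
  set l := 𝓝 s ×ˢ (⊤ : Filter M)
  have hrange : ∀ᶠ r in 𝓝 s, r ∈ Icc 0 t := Icc_mem_nhds hs.1 hs.2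
  have δ1 : (fun p : ℝ × M => p.1 - s) =o[l] fun _ => (1 : ℝ) := by
    have := HasUniformDerivWithinAt.isLittleO_one (M := M) (S := univ) (s := s)
    rwa [nhdsWithin_univ] at this
  -- the remainder of `P_{t-r} f`
  set e : ℝ × M → ℝ := fun p => realOp P (t - p.1) f p.2 -
    (v p.2 - (p.1 - s) * a p.2 + (p.1 - s) ^ 2 / 2 * b p.2) with he
  have heO : e =O[l] fun p => (p.1 - s) ^ 3 := by
    refine IsBigO.of_bound C3 ?_
    filter_upwards [tendsto_fst.eventually hrange] with p hp
    have := hA.abs_realOp_taylor_two_le hf hC3 hts (sub_nonneg.2 hp.2) p.2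
    rw [show t - p.1 - (t - s) = -(p.1 - s) by ring] at this
    simp only [Real.norm_eq_abs, abs_pow, abs_neg] at this ⊢
    convert this using 2
    rw [he, hb', ha', hv]; ring
  have hbdd : (fun p : ℝ × M => 2 * realOp P (t - p.1) f p.2) =O[l] fun _ => (1 : ℝ) := by
    refine IsBigO.of_bound (2 * Cf) (Eventually.of_forall fun p => ?_)
    have := hA.abs_realOp_le hCf (t - p.1) p.2
    simp only [norm_mul, Real.norm_eq_abs, abs_two, norm_one, mul_one]
    linarith
  have hδ3 : (fun p : ℝ × M => (p.1 - s) ^ 3) =o[l] fun p => (p.1 - s) ^ 2 :=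
    ((isBigO_refl (fun p : ℝ × M => (p.1 - s) ^ 2) l).mul_isLittleO δ1).congr
      (fun p => by ring) (fun p => by ring)
  have he1 : e =O[l] fun _ => (1 : ℝ) := by
    have := δ1.isBigO.pow 3
    simp only [one_pow] at this
    exact heO.trans this
  -- With w = P_{t−r}f and T its quadratic Taylor polynomial, e = w − T and w² − T² = e(2w − e). The
  -- terms of T² of order at least three are collected in `r2`.
  have r1 : (fun p => e p * (2 * realOp P (t - p.1) f p.2 - e p)) =o[l] fun p => (p.1 - s) ^ 2 :=
    ((heO.mul (hbdd.sub he1)).congr_right fun p => mul_one _).trans_isLittleO hδ3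
  have r2 : (fun p : ℝ × M => (p.1 - s) ^ 3 * ((p.1 - s) * ((b p.2 * b p.2) / 4) -
      a p.2 * b p.2)) =o[l] fun p => (p.1 - s) ^ 2 := by
    have ba := HasUniformDerivWithinAt.isBigO_const (l := 𝓝 s) hCa
    have bb := HasUniformDerivWithinAt.isBigO_const (l := 𝓝 s) hCb
    have hO : (fun p : ℝ × M => (p.1 - s) * ((b p.2 * b p.2) / 4) - a p.2 * b p.2)
        =O[l] fun _ => (1 : ℝ) := by
      have h1 := δ1.isBigO.mul ((bb.mul bb).mul (isBigO_refl (fun _ : ℝ × M => (1 / 4 : ℝ)) l))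
      have h1' : (fun p : ℝ × M => (p.1 - s) * ((b p.2 * b p.2) / 4)) =O[l] fun _ => (1 : ℝ) := by
        refine (h1.congr_left fun p => by ring).trans ?_
        exact isBigO_const_const _ one_ne_zero _
      have h2 := (ba.mul bb).congr_right fun p => mul_one _
      exact h1'.sub h2
    exact (((isBigO_refl _ l).mul hO).congr_right fun p => mul_one _).trans_isLittleO hδ3
  have r3 : (fun p : ℝ × M => (realOp P (t - p.1) f * realOp P (t - p.1) f - v * v
      + (2 * (p.1 - s)) • (v * a) - ((p.1 - s) ^ 2) • (a * a + v * b)) p.2)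
      =o[l] fun p => (p.1 - s) ^ 2 := by
    refine (r1.add r2).congr_left fun p => ?_
    simp only [he, Pi.add_apply, Pi.sub_apply, Pi.mul_apply, Pi.smul_apply, smul_eq_mul]
    ring
  have R : (fun r => realOp P r (realOp P (t - r) f * realOp P (t - r) f - v * v
      + (2 * (r - s)) • (v * a) - ((r - s) ^ 2) • (a * a + v * b)) x)
      =o[𝓝 s] fun r => (r - s) ^ 2 := by
    refine IsLittleO.of_bound fun ε hε => ?_
    have := r3.bound hε
    rw [Filter.eventually_prod_iff] at this
    obtain ⟨pa, ha, pb, hb, H⟩ := this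
    rw [Filter.eventually_top] at hb
    filter_upwards [ha] with r hr
    exact hA.abs_realOp_le (fun y => by simpa using H hr (hb y)) r x
  have hδ3' : (fun r : ℝ => (r - s) ^ 3) =o[𝓝 s] fun r => (r - s) ^ 2 := by
    have h : Tendsto (fun r : ℝ => r - s) (𝓝 s) (𝓝 0) := by
      have : Tendsto (fun r : ℝ => r - s) (𝓝 s) (𝓝 (s - s)) :=
        (continuous_id.sub continuous_const).tendsto s
      simpa using this
    exact ((isBigO_refl (fun r : ℝ => (r - s) ^ 2) _).mul_isLittleO
      ((isLittleO_one_iff ℝ).2 h)).congr (fun p => by ring) (fun p => by ring)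
  -- The coefficients of 1, r − s and (r − s)² in (P_{t−r}f)² are expanded under P_r to orders two,
  -- one and zero; the resulting second-order coefficient is half of 4P_sΓ₂(v).
  have T1 : (fun r => realOp P r (v * v) x - realOp P s (v * v) x
      - (r - s) * realOp P s (generator P (v * v)) x
      - (r - s) ^ 2 / 2 * realOp P s (generator P (generator P (v * v))) x)
      =o[𝓝 s] fun r => (r - s) ^ 2 := by
    obtain ⟨C, hC⟩ := hA.bounded _
      (hA.generator_mem _ (hA.generator_mem _ (hA.generator_mem _ hvvA)))
    refine IsBigO.trans_isLittleO (IsBigO.of_bound C ?_) hδ3'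
    filter_upwards [hrange] with r hr
    simpa using hA.abs_realOp_taylor_two_le hvvA hC hs.1.le hr.1 x
  have T2 : (fun r => (r - s) * (realOp P r (v * a) x - realOp P s (v * a) x
      - (r - s) * realOp P s (generator P (v * a)) x))
      =o[𝓝 s] fun r => (r - s) ^ 2 := by
    obtain ⟨C, hC⟩ := hA.bounded _ (hA.generator_mem _ (hA.generator_mem _ hvaA))
    refine IsBigO.trans_isLittleO (IsBigO.of_bound C ?_) hδ3'
    filter_upwards [hrange] with r hr
    have := hA.abs_realOp_sub_sub_le hvaA hC hs.1.le hr.1 x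
    simp only [norm_mul, Real.norm_eq_abs, norm_pow]
    calc |r - s| * _ ≤ |r - s| * (C * |r - s| ^ 2) :=
          mul_le_mul_of_nonneg_left this (abs_nonneg _)
      _ = C * |r - s| ^ 3 := by ring
  have T3 : (fun r => (r - s) ^ 2 * (realOp P r (a * a + v * b) x
      - realOp P s (a * a + v * b) x)) =o[𝓝 s] fun r => (r - s) ^ 2 := by
    obtain ⟨C, hC⟩ := hA.bounded _ (hA.generator_mem _ hmA)
    refine IsBigO.trans_isLittleO (IsBigO.of_bound C ?_) hδ3'
    filter_upwards [hrange] with r hr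
    have := hA.abs_realOp_sub_le hmA hC hs.1.le hr.1 x
    simp only [norm_mul, Real.norm_eq_abs, norm_pow]
    calc |r - s| ^ 2 * _ ≤ |r - s| ^ 2 * (C * |r - s|) :=
          mul_le_mul_of_nonneg_left this (by positivity)
      _ = C * |r - s| ^ 3 := by ring
  have hΓ : (2 : ℝ) • carreDuChamp P v v = generator P (v * v) - (2 : ℝ) • (v * a) := by
    ext y; simp [carreDuChamp, ha]; ring
  have h4 := hA.four_smul_gammaTwo hvA
  rw [← ha, ← hb] at h4
  have hLA : ∀ {f}, f ∈ A → generator P f ∈ A := fun {f} hf => hA.generator_mem f hf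
  refine (((R.add T1).sub (T2.const_mul_left 2)).add T3).congr_left fun r => ?_
  have hwA : realOp P (t - r) f ∈ A := hA.realOp_mem hf _
  have hwwA := A.mul_mem hwA hwA
  rw [← realOp_smul 2, ← realOp_smul 4, hΓ, h4,
    hA.realOp_sub (hLA hvvA) (A.smul_mem hvaA _),
    hA.realOp_add (A.sub_mem (hLA (hLA hvvA)) (A.smul_mem (hLA hvaA) _)) (A.smul_mem hmA _),
    hA.realOp_sub (hLA (hLA hvvA)) (A.smul_mem (hLA hvaA) _),
    hA.realOp_sub (A.add_mem (A.sub_mem hwwA hvvA) (A.smul_mem hvaA _)) (A.smul_mem hmA _),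
    hA.realOp_add (A.sub_mem hwwA hvvA) (A.smul_mem hvaA _), hA.realOp_sub hwwA hvvA]
  simp only [realOp_smul]
  ring

/-- Comparison of the derivatives at `0` and at `t` of `s ↦ P_s (P_{t-s} f)²` under a lower bound
for `Γ₂`. -/
theorem interpolation_comparison {f : M → ℝ} (hf : f ∈ A) {t ρ κ : ℝ} (ht : 0 < t) (x : M)
    (hΓ₂ : ∀ s ∈ Ioo 0 t,
      4 * ρ * realOp P s (carreDuChamp P (realOp P (t - s) f) (realOp P (t - s) f)) x + κ
        ≤ 4 * realOp P s (gammaTwo P (realOp P (t - s) f)) x)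
    {E E' : ℝ → ℝ} (hE : ∀ s, HasDerivAt E (E' s) s)
    (hE' : ∀ s, HasDerivAt E' (2 * ρ * E' s) s) (hE0 : E 0 = 0) (hEt : E t ≠ 0)
    {Z Z' : ℝ → ℝ} (hZ : ∀ s, HasDerivAt Z (Z' s) s)
    (hZ' : ∀ s, HasDerivAt Z' (2 * ρ * Z' s + κ) s) :
    ∃ β : ℝ, 2 * carreDuChamp P (realOp P t f) (realOp P t f) x ≤ β * E' 0 + Z' 0 ∧
      β * E' t + Z' t ≤ 2 * realOp P t (carreDuChamp P f f) x := by
  set g : ℝ → ℝ := fun r => realOp P r (realOp P (t - r) f * realOp P (t - r) f) x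
  -- E solves the homogeneous equation and Z' the inhomogeneous one; β matches the boundary value at
  -- t, the value at 0 being matched by the additive constant.
  set β := (g t - g 0 - (Z t - Z 0)) / E t with hβ
  have hwA : ∀ r, realOp P r f ∈ A := fun r => hA.realOp_mem hf r
  have h := peano_comparison (g := g) (κ := κ) (ρ := ρ) ht
    (fun s hs => hA.hasDerivWithinAt_interpolation hf x hs)
    (fun s hs => hA.interpolation_taylor hf x hs)
    (fun s hs => by have := hΓ₂ s hs; linarith)
    (Y := fun s => g 0 - Z 0 + β * E s + Z s) (Y' := fun s => β * E' s + Z' s)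
    (fun s => (((hE s).const_mul β).const_add (g 0 - Z 0)).add (hZ s))
    (fun s => (((hE' s).const_mul β).add (hZ' s)).congr_deriv (by ring))
    (by simp [hE0]) (by
      simp only [hβ]; field_simp; ring)
  refine ⟨β, ?_, ?_⟩
  · have h1 := h.1
    rwa [sub_zero, hA.realOp_zero (hA.carreDuChamp_mem (hwA _) (hwA _))] at h1
  · have h2 := h.2
    rw [sub_self] at h2
    rwa [show realOp P 0 f = f from funext fun y => hA.realOp_zero hf y] at h2

/-- Compare with κ = 0 and E' = e^{2ρs}: the slope at 0 gives 2Γ(P_t f) ≤ β, the slope at t gives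
βe^{2ρt} ≤ 2P_tΓ(f). -/
theorem exp_mul_carreDuChamp_realOp_le {ρ : ℝ} (hCD : CDInfty P A ρ) {f : M → ℝ} (hf : f ∈ A)
    {t : ℝ} (ht : 0 ≤ t) (x : M) :
    Real.exp (2 * ρ * t) * carreDuChamp P (realOp P t f) (realOp P t f) x
      ≤ realOp P t (carreDuChamp P f f) x := by
  have hwA : ∀ r, realOp P r f ∈ A := fun r => hA.realOp_mem hf r
  rcases ht.eq_or_lt with rfl | ht
  · rw [show realOp P 0 f = f from funext fun y => hA.realOp_zero hf y,
      hA.realOp_zero (hA.carreDuChamp_mem hf hf)]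
    simp
  have hexp : ∀ s, HasDerivAt (fun s => Real.exp (2 * ρ * s)) (2 * ρ * Real.exp (2 * ρ * s)) s := by
    intro s
    have := ((hasDerivAt_id s).const_mul (2 * ρ)).exp
    simpa [mul_comm] using this
  obtain ⟨E, hE, hE0, hEt⟩ : ∃ E : ℝ → ℝ, (∀ s, HasDerivAt E (Real.exp (2 * ρ * s)) s) ∧
      E 0 = 0 ∧ E t ≠ 0 := by
    rcases eq_or_ne ρ 0 with rfl | hρ
    · exact ⟨id, fun s => by simpa using hasDerivAt_id s, rfl, ht.ne'⟩
    · refine ⟨fun s => (Real.exp (2 * ρ * s) - 1) / (2 * ρ), fun s => ?_, by simp, ?_⟩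
      · refine (((hexp s).sub_const 1).div_const (2 * ρ)).congr_deriv ?_
        field_simp
      · refine div_ne_zero (sub_ne_zero.2 ?_) (by simpa using hρ)
        rw [Ne, Real.exp_eq_one_iff]
        simp [hρ, ht.ne']
  obtain ⟨β, h1, h2⟩ := hA.interpolation_comparison hf (ρ := ρ) (κ := 0) ht x (fun s hs => by
      have := hA.realOp_mono (A.smul_mem (hA.carreDuChamp_mem (hwA (t - s)) (hwA (t - s))) ρ)
        (hA.gammaTwo_mem (hwA (t - s))) (fun y => hCD _ (hwA _) y) s x
      rw [realOp_smul] at this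
      linarith) hE hexp hE0 hEt (Z := fun _ => 0) (Z' := fun _ => 0)
    (fun s => hasDerivAt_const s 0) (fun s => by simpa using hasDerivAt_const s (0 : ℝ))
  simp only [mul_zero, Real.exp_zero, mul_one, add_zero] at h1 h2
  have := mul_le_mul_of_nonneg_left h1 (Real.exp_pos (2 * ρ * t)).le
  linarith

theorem carreDuChamp_realOp_add_sq_le {n : ℝ} (hn : 0 < n) (hCD : CD P A 0 n) {f : M → ℝ}
    (hf : f ∈ A) {t : ℝ} (ht : 0 ≤ t) (x : M) :
    carreDuChamp P (realOp P t f) (realOp P t f) x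
        + 2 * t / n * generator P (realOp P t f) x ^ 2
      ≤ realOp P t (carreDuChamp P f f) x := by
  have hwA : ∀ r, realOp P r f ∈ A := fun r => hA.realOp_mem hf r
  have hLA := hA.generator_mem f hf
  rcases ht.eq_or_lt with rfl | ht
  · rw [show realOp P 0 f = f from funext fun y => hA.realOp_zero hf y,
      hA.realOp_zero (hA.carreDuChamp_mem hf hf)]
    simp
  -- By Jensen and the semigroup law, P_s((LP_{t−s}f)²) ≥ (P_s LP_{t−s}f)² = (LP_t f)², which does
  -- not depend on s; hence a constant source term.
  set κ := 4 / n * generator P (realOp P t f) x ^ 2 with hκ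
  obtain ⟨β, h1, h2⟩ := hA.interpolation_comparison hf (ρ := 0) (κ := κ) ht x (fun s hs => by
      have hL' := hA.generator_mem _ (hwA (t - s))
      have := hA.realOp_mono (A.smul_mem (A.mul_mem hL' hL') (1 / n))
        (hA.gammaTwo_mem (hwA (t - s))) (fun y => by
          have := hCD _ (hwA (t - s)) y
          simpa [pow_two] using this) s x
      rw [realOp_smul] at this
      have hsq := hA.sq_realOp_le hL' s x
      rw [hA.generator_realOp hf (sub_nonneg.2 hs.2.le),
        hA.realOp_realOp hLA hs.1.le (sub_nonneg.2 hs.2.le)] at hsq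
      rw [hA.generator_realOp hf (sub_nonneg.2 hs.2.le)] at this
      rw [show s + (t - s) = t by ring, ← hA.generator_realOp hf ht.le] at hsq
      have h3 := mul_le_mul_of_nonneg_left hsq (show 0 ≤ 1 / n by positivity)
      have h4 : κ = 4 * (1 / n * generator P (realOp P t f) x ^ 2) := by rw [hκ]; ring
      rw [h4]
      linarith) (E := id) (E' := fun _ => 1) (fun s => hasDerivAt_id s)
    (fun s => by simpa using hasDerivAt_const s (1 : ℝ)) rfl ht.ne'
    (Z := fun s => κ * s ^ 2 / 2) (Z' := fun s => κ * s)
    (fun s => by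
      have := (((hasDerivAt_id s).pow 2).const_mul κ).div_const 2
      refine this.congr_deriv ?_
      simp; ring)
    (fun s => by simpa using (hasDerivAt_id s).const_mul κ)
  have h3 : κ * t = 2 * (2 * t / n * generator P (realOp P t f) x ^ 2) := by
    rw [hκ]; ring
  simp only [mul_zero, mul_one, add_zero] at h1 h2
  linarith

end IsDiffusionAlgebra

end GradientBound

end LocalTransport

end

/-! ### Entropy interpolation along Hamilton-Jacobi subsolutions -/

noncomputable section

namespace LocalTransport

open Filter Topology Asymptotics Set

/-- A smooth function on the line which coincides with the logarithm away from `0`. -/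
theorem exists_contDiff_eq_log {δ : ℝ} (hδ : 0 < δ) :
    ∃ ℓ : ℝ → ℝ, ContDiff ℝ ∞ ℓ ∧ ∀ x, δ ≤ x → ℓ x = Real.log x := by
  -- The transition factor vanishes for x ≤ δ/2 and equals 1 for x ≥ δ.
  refine ⟨fun x => Real.smoothTransition (2 * x / δ - 1) * Real.log x, ?_, fun x hx => ?_⟩
  · rw [contDiff_iff_contDiffAt]
    intro x
    rcases lt_or_ge (δ / 4) x with hx | hx
    · have h1 : ContDiffAt ℝ ∞ (fun x : ℝ => Real.smoothTransition (2 * x / δ - 1)) x := by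
        refine (Real.smoothTransition.contDiff (n := ⊤)).contDiffAt.comp x ?_
        exact (((contDiff_const.mul contDiff_id).div_const δ).sub contDiff_const).contDiffAt
      exact h1.mul (Real.contDiffAt_log.2 (ne_of_gt (by linarith)))
    · have : (fun x : ℝ => Real.smoothTransition (2 * x / δ - 1) * Real.log x) =ᶠ[𝓝 x]
          fun _ => 0 := by
        filter_upwards [Iio_mem_nhds (show x < δ / 2 by linarith)] with y hy
        rw [Real.smoothTransition.zero_of_nonpos, zero_mul]
        have : 2 * y / δ ≤ 1 := by
          rw [div_le_one hδ]; simp only [mem_Iio] at hy; linarith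
        linarith
      exact contDiffAt_const.congr_of_eventuallyEq this
  · have : 1 ≤ 2 * x / δ - 1 := by
      have : 2 ≤ 2 * x / δ := by rw [le_div_iff₀ hδ]; linarith
      linarith
    simp [Real.smoothTransition.one_of_one_le this]

/-- A smooth function on the line which coincides with `x log x` on `(δ, ∞)`. -/
theorem exists_contDiff_eq_mul_log {δ : ℝ} (hδ : 0 < δ) :
    ∃ Φ : ℝ → ℝ, ContDiff ℝ ∞ Φ ∧ ∀ x, δ < x → Φ x = x * Real.log x ∧
      deriv Φ x = Real.log x + 1 ∧ deriv (deriv Φ) x = 1 / x := by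
  obtain ⟨ℓ, hℓ, hℓe⟩ := exists_contDiff_eq_log hδ
  refine ⟨fun x => x * ℓ x, contDiff_id.mul hℓ, fun x hx => ?_⟩
  have h1 : ∀ y ∈ Ioi δ, deriv (fun x => x * ℓ x) y = Real.log y + 1 := by
    intro y hy
    have hy0 : y ≠ 0 := (hδ.trans hy).ne'
    have he : (fun x => x * ℓ x) =ᶠ[𝓝 y] fun x => x * Real.log x := by
      filter_upwards [Ioi_mem_nhds hy] with z hz
      rw [hℓe z (le_of_lt hz)]
    rw [he.deriv_eq, Real.deriv_mul_log hy0]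
  refine ⟨by simp only [hℓe x hx.le], h1 x hx, ?_⟩
  have he : deriv (fun x => x * ℓ x) =ᶠ[𝓝 x] fun y => Real.log y + 1 := by
    filter_upwards [Ioi_mem_nhds hx] with z hz using h1 z hz
  rw [he.deriv_eq]
  have := (Real.hasDerivAt_log (hδ.trans hx).ne').add_const 1
  rw [this.deriv, one_div]

/-- Used with z = Γ(v,k), X = Γ(v), Y = Γ(k): it splits the cross term into the entropy production
CΓ(v)/v and a term in Γ(k). -/
theorem two_mul_le_of_sq_le {z X Y C v : ℝ} (hC : 0 < C) (hv : 0 < v) (hX : 0 ≤ X) (hY : 0 ≤ Y)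
    (hz : z ^ 2 ≤ X * Y) : 2 * z ≤ C * (X / v) + v * Y / C := by
  have h1 : 0 ≤ C * (X / v) + v * Y / C := by positivity
  refine le_of_sq_le_sq ?_ h1
  have h2 : (C * (X / v)) * (v * Y / C) = X * Y := by field_simp
  nlinarith [sq_nonneg (C * (X / v) - v * Y / C)]

section Interpolation

variable {M : Type*} [MeasurableSpace M] {P : ℝ≥0 → Kernel M M} {A : Subalgebra ℝ (M → ℝ)}

namespace IsDiffusionAlgebra

/-- Along the curve of measures `f ↦ P_s (P_{u-s} h · P_{τ(s)} f) (x)`, tested against a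
subsolution `W` of a Hamilton-Jacobi equation, the entropy production controls the variation. -/
theorem transport_interpolation (hA : IsDiffusionAlgebra P A) {h : M → ℝ} (hh : h ∈ A) {α : ℝ}
    (hα : 0 < α) (hαh : ∀ y, α ≤ h y) {u : ℝ} (hu : 0 < u) (x : M) (hone : realOp P u h x = 1)
    {τ τ' θ' B B' a b : ℝ → ℝ} {C : ℝ} (hC : 0 < C) {W W' : ℝ → M → ℝ}
    (hWA : ∀ s ∈ Icc 0 u, W s ∈ A) (hW'A : ∀ s ∈ Icc 0 u, W' s ∈ A)
    (hW : ∀ s ∈ Icc 0 u, HasUniformDerivWithinAt W (W' s) (Icc 0 u) s)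
    (hθ' : ∀ s ∈ Icc 0 u, 0 ≤ θ' s)
    (hsub : ∀ s ∈ Icc 0 u, ∀ y, W' s y + θ' s / 2 * carreDuChamp P (W s) (W s) y ≤ 0)
    (hτ : ∀ s ∈ Icc 0 u, HasDerivWithinAt τ (τ' s) (Icc 0 u) s) (hτ0 : ∀ s ∈ Icc 0 u, 0 ≤ τ s)
    (hτu : τ u = 0)
    (hgrad : ∀ f ∈ A, ∀ s ∈ Icc 0 u, ∀ y,
      a s * carreDuChamp P (realOp P (τ s) f) (realOp P (τ s) f) y
        + b s * generator P (realOp P (τ s) f) y ^ 2 ≤ realOp P (τ s) (carreDuChamp P f f) y)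
    (ha : ∀ s ∈ Icc 0 u, 1 / C ≤ θ' s / 2 * a s)
    (hB : ∀ s ∈ Icc 0 u, HasDerivWithinAt B (B' s) (Icc 0 u) s)
    (hbB : ∀ s ∈ Icc 0 u, ∀ z : ℝ, (1 + τ' s) * z - θ' s / 2 * b s * z ^ 2 ≤ B' s) :
    realOp P u (h * W u) x - C * realOp P u (fun y => h y * Real.log (h y)) x - B u
      ≤ realOp P (τ 0) (W 0) x - B 0 := by
  obtain ⟨Φ, hΦ, hΦe⟩ := exists_contDiff_eq_mul_log (half_pos hα)
  set H : ℝ → M → ℝ := fun r => realOp P (u - r) h with hH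
  have hHA : ∀ r, H r ∈ A := fun r => hA.realOp_mem hh _
  have hHα : ∀ r y, α ≤ H r y := fun r y => by
    have := hA.realOp_mono (const_mem α) hh hαh (u - r) y
    rwa [hA.realOp_const] at this
  have hcomp : ∀ k ∈ A, (fun y => Φ (k y)) ∈ A := fun k hk => hA.comp_mem Φ hΦ k hk
  -- The claim is J(u) ≤ J(0), via J' ≤ 0. At 0 the entropy term vanishes, because H_0(x) = P_u h(x)
  -- = 1 and Φ(1) = 0.
  set J : ℝ → ℝ := fun r => realOp P r (H r * realOp P (τ r) (W r)) x
    - C * realOp P r (fun y => Φ (H r y)) x - B r with hJ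
  have hΦ' : ContDiff ℝ ∞ (deriv Φ) := (contDiff_infty_iff_deriv.1 hΦ).2
  have hder : ∀ s ∈ Icc 0 u, ∃ d ≤ 0, HasDerivWithinAt J d (Icc 0 u) s := by
    intro s hs
    have hus : ∀ r ∈ Icc 0 u, 0 ≤ u - r := fun r hr => by linarith [hr.2]
    have hHu : HasUniformDerivWithinAt H ((-1 : ℝ) • generator P (H s)) (Icc 0 u) s := by
      refine (hA.hasUniformDerivWithinAt_realOp hs (HasUniformDerivWithinAt.const h)
        (fun _ _ => hh) A.zero_mem (((hasDerivAt_id s).const_sub u).hasDerivWithinAt)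
        hus).congr_deriv fun y => ?_
      rw [zero_add, realOp_smul, hH, hA.generator_realOp hh (hus s hs)]
      rfl
    have hKu := hA.hasUniformDerivWithinAt_realOp hs (hW s hs) hWA (hW'A s hs) (hτ s hs) hτ0
    set v := H s with hv
    set k := realOp P (τ s) (W s) with hk
    have hvA : v ∈ A := hHA s
    have hkA : k ∈ A := hA.realOp_mem (hWA s hs) _
    have hLv := hA.generator_mem _ hvA
    have hLk := hA.generator_mem _ hkA
    have hQA := hA.realOp_mem (hW'A s hs) (τ s)
    have hK' : realOp P (τ s) (W' s + τ' s • generator P (W s))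
        = realOp P (τ s) (W' s) + τ' s • generator P k := by
      ext y
      rw [hA.realOp_add (hW'A s hs) (A.smul_mem (hA.generator_mem _ (hWA s hs)) _), realOp_smul,
        hk, hA.generator_realOp (hWA s hs) (hτ0 s hs)]
      rfl
    rw [hK'] at hKu
    have hK'A : realOp P (τ s) (W' s) + τ' s • generator P k ∈ A :=
      A.add_mem hQA (A.smul_mem hLk _)
    have hH'A : (-1 : ℝ) • generator P v ∈ A := A.smul_mem hLv _
    have h1 := hHu.mul hKu (hA.bounded _ hvA) (hA.bounded _ hH'A) (hA.bounded _ hkA)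
      (hA.bounded _ hK'A)
    have h1' := hA.hasDerivWithinAt_realOp_comp hs h1
      (fun r hr => A.mul_mem (hHA r) (hA.realOp_mem (hWA r hr) _))
      (A.add_mem (A.mul_mem hH'A hkA) (A.mul_mem hvA hK'A)) (τ := fun r => r)
      (hasDerivWithinAt_id s _) (fun r hr => hr.1) x
    have h2 := hHu.comp_smooth hΦ (hA.bounded _ hvA) (hA.bounded _ hH'A)
    have hF2'A : (fun y => deriv Φ (v y) * ((-1 : ℝ) • generator P v) y) ∈ A :=
      A.mul_mem (hA.comp_mem _ hΦ' v hvA) hH'A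
    have h2' := hA.hasDerivWithinAt_realOp_comp hs h2 (fun r _ => hcomp _ (hHA r)) hF2'A
      (τ := fun r => r) (hasDerivWithinAt_id s _) (fun r hr => hr.1) x
    refine ⟨_, ?_, (h1'.sub (h2'.const_mul C)).sub (hB s hs)⟩
    have hG1 := A.add_mem (A.add_mem (A.mul_mem hH'A hkA) (A.mul_mem hvA hK'A))
      (A.smul_mem (hA.generator_mem _ (A.mul_mem hvA hkA)) (1 : ℝ))
    have hG2 := A.add_mem hF2'A (A.smul_mem (hA.generator_mem _ (hcomp _ hvA)) (1 : ℝ))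
    -- The derivative of J is P_s(G₁ − CG₂)(x) − B'(s). Since P_s v(x) = P_u h(x) = 1, the pointwise
    -- bound G₁ − CG₂ ≤ B'(s)v is enough.
    have hle := hA.realOp_mono (A.sub_mem hG1 (A.smul_mem hG2 C)) (A.smul_mem hvA (B' s))
      (fun y => ?_) s x
    · rw [hA.realOp_sub hG1 (A.smul_mem hG2 C), realOp_smul, realOp_smul] at hle
      have hone' : realOp P s v x = 1 := by
        rw [hv, hH, hA.realOp_realOp hh hs.1 (hus s hs)]
        simpa using hone
      rw [hone', mul_one] at hle
      have : ∀ {p q r : ℝ}, p - q ≤ r → p - q - r ≤ 0 := fun h => by linarith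
      exact this hle
    · have hv0 : 0 < v y := hα.trans_le (hHα s y)
      have hvα : α / 2 < v y := lt_of_lt_of_le (by linarith) (hHα s y)
      obtain ⟨-, e1, e2⟩ := hΦe (v y) hvα
      have hdiff := hA.diffusion Φ hΦ v hvA y
      simp only [Function.comp_def] at hdiff
      have hWle : realOp P (τ s) (W' s) y
          ≤ -(θ' s / 2) * realOp P (τ s) (carreDuChamp P (W s) (W s)) y := by
        rw [← realOp_smul]
        refine hA.realOp_mono (hW'A s hs)
          (A.smul_mem (hA.carreDuChamp_mem (hWA s hs) (hWA s hs)) _) (fun z => ?_) _ _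
        have := hsub s hs z
        simp only [Pi.smul_apply, smul_eq_mul]
        linarith
      have hg := hgrad (W s) (hWA s hs) s hs y
      rw [← hk] at hg
      set G := carreDuChamp P k k y
      set X := carreDuChamp P v v y
      have hG0 : 0 ≤ G := hA.carre_nonneg _ hkA y
      have hX0 : 0 ≤ X := hA.carre_nonneg _ hvA y
      -- The diffusion property leaves v(P_τ W' + (1+τ')Lk) + 2Γ(v,k) − CΓ(v)/v. The last two terms
      -- are at most vΓ(k)/C, while P_τ W' ≤ −(θ'/2)(aΓ(k) + b(Lk)²) by the subsolution property and
      -- `hgrad`.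
      have hcs := two_mul_le_of_sq_le hC hv0 hX0 hG0 (hA.carreDuChamp_sq_le hvA hkA y)
      have hzB := hbB s hs (generator P k y)
      have h3 := mul_le_mul_of_nonneg_left hg (show 0 ≤ θ' s / 2 by linarith [hθ' s hs])
      have h4 := mul_le_mul_of_nonneg_right (ha s hs) hG0
      have h5 : realOp P (τ s) (W' s) y + (1 + τ' s) * generator P k y + G / C ≤ B' s := by
        have : G / C = 1 / C * G := by ring
        rw [this]
        nlinarith
      have h6 := mul_le_mul_of_nonneg_left h5 hv0.le
      simp only [Pi.sub_apply, Pi.add_apply, Pi.mul_apply, Pi.smul_apply, smul_eq_mul,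
        generator_mul, hdiff, e1, e2]
      have h7 : v y * G / C = v y * (G / C) := by ring
      have h8 : 1 / v y * X = X / v y := by ring
      rw [h8]
      rw [h7] at hcs
      nlinarith
  have hanti : J u ≤ J 0 := by
    have hcont : ContinuousOn J (Icc 0 u) := fun s hs => by
      obtain ⟨d, -, hd⟩ := hder s hs
      exact hd.continuousWithinAt
    have := antitoneOn_of_deriv_nonpos (convex_Icc 0 u) hcont (fun s hs => by
      rw [interior_Icc] at hs
      obtain ⟨d, -, hd⟩ := hder s (Ioo_subset_Icc_self hs)
      exact (hd.hasDerivAt (Icc_mem_nhds hs.1 hs.2)).differentiableAt.differentiableWithinAt)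
      (fun s hs => by
        rw [interior_Icc] at hs
        obtain ⟨d, hd0, hd⟩ := hder s (Ioo_subset_Icc_self hs)
        rwa [(hd.hasDerivAt (Icc_mem_nhds hs.1 hs.2)).deriv])
    exact this (left_mem_Icc.2 hu.le) (right_mem_Icc.2 hu.le) hu.le
  have hH0 : H 0 x = 1 := by simpa [hH] using hone
  have hHu : H u = h := by
    ext y
    simp [hH, hA.realOp_zero hh]
  have hW0 := hWA 0 (left_mem_Icc.2 hu.le)
  have hWu := hWA u (right_mem_Icc.2 hu.le)
  have hwu : realOp P (τ u) (W u) = W u := by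
    ext y; rw [hτu, hA.realOp_zero hWu]
  have hΦ1 : Φ (H 0 x) = 0 := by
    rw [(hΦe _ (lt_of_lt_of_le (by linarith) (hHα 0 x))).1, hH0]; simp
  have hΦh : (fun y => Φ (h y)) = fun y => h y * Real.log (h y) := by
    ext y; exact (hΦe _ (lt_of_lt_of_le (by linarith) (hαh y))).1
  simp only [hJ, hHu, hwu, hΦh] at hanti
  rw [hA.realOp_zero (A.mul_mem (hHA 0) (hA.realOp_mem hW0 _)),
    hA.realOp_zero (hcomp _ (hHA 0)), hΦ1, Pi.mul_apply, hH0] at hanti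
  linarith

end IsDiffusionAlgebra

end Interpolation

end LocalTransport

end

/-! ### Kantorovich duality over a test algebra -/

noncomputable section

namespace LocalTransport

open Filter Topology Set
open scoped BoundedContinuousFunction CompactlySupported

section Kantorovich

variable {M : Type*} [MetricSpace M]

/-- An algebra of bounded continuous functions which contains enough cut-off functions. -/
structure IsTestAlgebra (A : Subalgebra ℝ (M → ℝ)) : Prop where
  continuous : ∀ f ∈ A, Continuous f
  bounded : ∀ f ∈ A, ∃ C : ℝ, ∀ x, |f x| ≤ C
  bump : ∀ K U : Set M, IsCompact K → IsOpen U → K ⊆ U →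
    ∃ χ ∈ A, HasCompactSupport χ ∧ (∀ x, χ x ∈ Icc (0 : ℝ) 1) ∧ (∀ x ∈ K, χ x = 1) ∧
      ∀ x ∉ U, χ x = 0

variable {A : Subalgebra ℝ (M → ℝ)}

theorem IsTestAlgebra.exists_exhaustion [SigmaCompactSpace M] [WeaklyLocallyCompactSpace M]
    (hA : IsTestAlgebra A) :
    ∃ χ : ℕ → M → ℝ, (∀ k, χ k ∈ A) ∧ (∀ k, HasCompactSupport (χ k)) ∧
      (∀ k x, χ k x ∈ Icc (0 : ℝ) 1) ∧ ∀ x, ∀ᶠ k in atTop, χ k x = 1 := by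
  obtain K : CompactExhaustion M := default
  choose χ h1 h2 h3 h4 _ using fun k =>
    hA.bump (K k) univ (K.isCompact k) isOpen_univ (subset_univ _)
  refine ⟨χ, h1, h2, h3, fun x => ?_⟩
  obtain ⟨n, hn⟩ := K.exists_mem x
  filter_upwards [eventually_ge_atTop n] with k hk using h4 k x (K.subset hk hn)

theorem lintegral_le_of_eventually_eq {α : Type*} [MeasurableSpace α] {μ : Measure α}
    {f : ℕ → α → ℝ≥0∞} {g : α → ℝ≥0∞} {C : ℝ≥0∞} (hf : ∀ k, Measurable (f k))
    (hfg : ∀ x, ∀ᶠ k in atTop, f k x = g x) (h : ∀ k, ∫⁻ x, f k x ∂μ ≤ C) :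
    ∫⁻ x, g x ∂μ ≤ C := by
  have h1 : ∀ x, liminf (fun k => f k x) atTop = g x := fun x =>
    (tendsto_const_nhds.congr' (by
      filter_upwards [hfg x] with k hk using hk.symm)).liminf_eq
  calc ∫⁻ x, g x ∂μ = ∫⁻ x, liminf (fun k => f k x) atTop ∂μ := by simp only [h1]
    _ ≤ liminf (fun k => ∫⁻ x, f k x ∂μ) atTop := lintegral_liminf_le hf
    _ ≤ liminf (fun _ : ℕ => C) atTop := liminf_le_liminf (Eventually.of_forall h)
    _ = C := liminf_const C

variable [MeasurableSpace M] [BorelSpace M]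

theorem IsTestAlgebra.integrable (hA : IsTestAlgebra A) {f : M → ℝ} (hf : f ∈ A) (ν : Measure M)
    [IsFiniteMeasure ν] : Integrable f ν := by
  obtain ⟨C, hC⟩ := hA.bounded f hf
  exact Integrable.of_bound (hA.continuous f hf).measurable.aestronglyMeasurable C
    (Eventually.of_forall hC)

/-- A bump equal to 1 on K and 0 off U compares ν(K) with μ(U); outer regularity lets U shrink to K.
-/
theorem IsTestAlgebra.measure_isCompact_le (hA : IsTestAlgebra A) {ν μ : Measure M}
    [IsFiniteMeasure ν] [IsFiniteMeasure μ] (h : ∀ f ∈ A, ∫ x, f x ∂ν = ∫ x, f x ∂μ) {K : Set M}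
    (hK : IsCompact K) : ν K ≤ μ K := by
  rw [K.measure_eq_iInf_isOpen μ]
  refine le_iInf₂ fun U hKU => le_iInf fun hU => ?_
  obtain ⟨χ, hχ, -, h01, h1, h0⟩ := hA.bump K U hK hU hKU
  have e1 : ν.real K ≤ ∫ x, χ x ∂ν := by
    rw [← integral_indicator_one hK.measurableSet]
    refine integral_mono ((integrable_const 1).indicator hK.measurableSet)
      (hA.integrable hχ ν) fun x => ?_
    by_cases hx : x ∈ K
    · simp [hx, h1 x hx]
    · simpa [hx] using (h01 x).1
  have e2 : ∫ x, χ x ∂μ ≤ μ.real U := by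
    rw [← integral_indicator_one hU.measurableSet]
    refine integral_mono (hA.integrable hχ μ)
      ((integrable_const 1).indicator hU.measurableSet) fun x => ?_
    by_cases hx : x ∈ U
    · simpa [hx] using (h01 x).2
    · simp [hx, h0 x hx]
  rw [h χ hχ] at e1
  exact (ENNReal.toReal_le_toReal (measure_ne_top _ _) (measure_ne_top _ _)).1 (e1.trans e2)

theorem IsTestAlgebra.measure_ext [SecondCountableTopology M] [SigmaCompactSpace M]
    (hA : IsTestAlgebra A) {ν μ : Measure M} [IsFiniteMeasure ν] [IsFiniteMeasure μ]
    (h : ∀ f ∈ A, ∫ x, f x ∂ν = ∫ x, f x ∂μ) : ν = μ := by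
  ext s hs
  rw [hs.measure_eq_iSup_isCompact ν, hs.measure_eq_iSup_isCompact μ]
  refine iSup_congr fun K => iSup_congr fun _ => iSup_congr fun hK => le_antisymm ?_ ?_
  · exact hA.measure_isCompact_le h hK
  · exact hA.measure_isCompact_le (fun f hf => (h f hf).symm) hK

/-- The duality hypothesis, in homogeneous form. -/
theorem IsTestAlgebra.dual_homogeneous (hA : IsTestAlgebra A) {ν μ : Measure M}
    [IsProbabilityMeasure ν] [IsProbabilityMeasure μ] {K : ℝ}
    (hK : ∀ φ ∈ A, ∀ ψ ∈ A, (∀ x y, φ x - ψ y ≤ dist x y ^ 2 / 2) →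
      ∫ x, φ x ∂ν - ∫ x, ψ x ∂μ ≤ K) {φ ψ : M → ℝ} (hφ : φ ∈ A) (hψ : ψ ∈ A) {t c : ℝ} (ht : 0 ≤ t)
    (h : ∀ x y, c ≤ φ x + ψ y + t * (dist x y ^ 2 / 2)) :
    c ≤ ∫ x, φ x ∂ν + ∫ x, ψ x ∂μ + t * K := by
  have iφ := hA.integrable hφ ν
  have iψ := hA.integrable hψ μ
  rcases ht.eq_or_lt with rfl | ht
  · simp only [zero_mul, add_zero] at h ⊢
    have h1 : ∀ y, c - ∫ x, φ x ∂ν ≤ ψ y := fun y => by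
      have : ∫ _, c - ψ y ∂ν ≤ ∫ x, φ x ∂ν :=
        integral_mono (integrable_const _) iφ fun x => by have := h x y; linarith
      simp at this
      linarith
    have : ∫ _, c - ∫ x, φ x ∂ν ∂μ ≤ ∫ y, ψ y ∂μ := integral_mono (integrable_const _) iψ h1
    simp at this
    linarith
  · have h1 := hK (t⁻¹ • ((fun _ => c) - φ)) (A.smul_mem (A.sub_mem (A.algebraMap_mem c) hφ) _)
      (t⁻¹ • ψ) (A.smul_mem hψ _) (fun x y => by
        have := h x y
        simp only [Pi.smul_apply, Pi.sub_apply, smul_eq_mul]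
        rw [← mul_sub, inv_mul_le_iff₀ ht]
        linarith)
    simp only [Pi.smul_apply, Pi.sub_apply, smul_eq_mul, integral_const_mul] at h1
    rw [integral_sub (integrable_const _) iφ, integral_const, ← mul_sub, inv_mul_le_iff₀ ht] at h1
    simp at h1
    linarith

/-- The sublinear functional whose linear minorants are the transport plans of cost at most `K`. -/
def planSet (A : Subalgebra ℝ (M → ℝ)) (ν μ : Measure M) (K : ℝ) (F : M × M → ℝ) : Set ℝ :=
  {r | ∃ φ ∈ A, ∃ ψ ∈ A, ∃ t : ℝ, 0 ≤ t ∧ (∀ x y, F (x, y) ≤ φ x + ψ y + t * (dist x y ^ 2 / 2)) ∧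
    r = ∫ x, φ x ∂ν + ∫ x, ψ x ∂μ + t * K}

/-- A linear functional on bounded continuous functions with marginals `ν` and `μ` and with cost
at most `K`. -/
theorem IsTestAlgebra.exists_linear_plan (hA : IsTestAlgebra A) {ν μ : Measure M}
    [IsProbabilityMeasure ν] [IsProbabilityMeasure μ] {K : ℝ}
    (hK : ∀ φ ∈ A, ∀ ψ ∈ A, (∀ x y, φ x - ψ y ≤ dist x y ^ 2 / 2) →
      ∫ x, φ x ∂ν - ∫ x, ψ x ∂μ ≤ K) :
    ∃ Λ : (M × M →ᵇ ℝ) →ₗ[ℝ] ℝ, ∀ F : M × M →ᵇ ℝ, ∀ r ∈ planSet A ν μ K F, Λ F ≤ r := by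
  -- p is the least cost of dominating F by φ(x) + ψ(y) + t d²/2. The duality hypothesis keeps it
  -- finite, constants make the infimum nonempty, and it is sublinear since the admissible triples
  -- form a cone.
  set p : (M × M →ᵇ ℝ) → ℝ := fun F => sInf (planSet A ν μ K F) with hp
  have hbb : ∀ F : M × M →ᵇ ℝ, BddBelow (planSet A ν μ K F) := by
    intro F
    refine ⟨-‖F‖, ?_⟩
    rintro r ⟨φ, hφ, ψ, hψ, t, ht, h, rfl⟩
    exact hA.dual_homogeneous hK hφ hψ ht fun x y =>
      (neg_le_of_abs_le (F.norm_coe_le_norm (x, y))).trans (h x y)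
  have hne : ∀ F : M × M →ᵇ ℝ, (planSet A ν μ K F).Nonempty := by
    intro F
    refine ⟨_, fun _ => ‖F‖, A.algebraMap_mem _, 0, A.zero_mem, 0, le_rfl, fun x y => ?_, rfl⟩
    simpa using (le_abs_self _).trans (F.norm_coe_le_norm (x, y))
  have hscale : ∀ (c : ℝ), 0 < c → ∀ F : M × M →ᵇ ℝ, p (c • F) ≤ c * p F := by
    intro c hc F
    rw [← div_le_iff₀' hc]
    refine le_csInf (hne F) ?_
    rintro r ⟨φ, hφ, ψ, hψ, t, ht, h, rfl⟩
    rw [div_le_iff₀' hc]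
    refine csInf_le (hbb _) ⟨c • φ, A.smul_mem hφ _, c • ψ, A.smul_mem hψ _, c * t,
      by positivity, fun x y => ?_, ?_⟩
    · have := mul_le_mul_of_nonneg_left (h x y) hc.le
      simp only [BoundedContinuousFunction.coe_smul, Pi.smul_apply, smul_eq_mul]
      linarith
    · simp only [Pi.smul_apply, smul_eq_mul, integral_const_mul]
      ring
  -- Hahn-Banach from the zero subspace: only p(0) ≥ 0 has to be checked, which is the homogeneous
  -- duality hypothesis. Testing F and −F then fixes the marginals of Λ.
  obtain ⟨Λ, -, hΛ⟩ := exists_extension_of_le_sublinear (⊥ : (M × M →ᵇ ℝ) →ₗ.[ℝ] ℝ) p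
    (fun c hc F => le_antisymm (hscale c hc F) (by
      have := hscale c⁻¹ (inv_pos.2 hc) (c • F)
      rw [inv_smul_smul₀ hc.ne', ← div_eq_inv_mul, le_div_iff₀ hc] at this
      linarith))
    (fun F G => by
      rw [← sub_le_iff_le_add]
      refine le_csInf (hne F) ?_
      rintro r ⟨φ, hφ, ψ, hψ, t, ht, h, rfl⟩
      rw [sub_le_comm]
      refine le_csInf (hne G) ?_
      rintro r' ⟨φ', hφ', ψ', hψ', t', ht', h', rfl⟩
      rw [sub_le_iff_le_add]
      refine csInf_le (hbb _) ⟨φ + φ', A.add_mem hφ hφ', ψ + ψ', A.add_mem hψ hψ', t + t',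
        by positivity, fun x y => ?_, ?_⟩
      · have h1 := h x y
        have h2 := h' x y
        simp only [BoundedContinuousFunction.coe_add, Pi.add_apply]
        linarith
      · simp only [Pi.add_apply]
        rw [integral_add (hA.integrable hφ ν) (hA.integrable hφ' ν),
          integral_add (hA.integrable hψ μ) (hA.integrable hψ' μ)]
        ring)
    (fun F => by
      have hF : (F : M × M →ᵇ ℝ) = 0 := by
        exact (Submodule.mem_bot ℝ).1 F.2
      rw [show (⊥ : (M × M →ᵇ ℝ) →ₗ.[ℝ] ℝ) F = 0 by
        rw [show F = 0 from Subtype.ext hF]; exact LinearPMap.map_zero _]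
      rw [hF]
      refine le_csInf (hne 0) ?_
      rintro r ⟨φ, hφ, ψ, hψ, t, ht, h, rfl⟩
      exact hA.dual_homogeneous hK hφ hψ ht fun x y => by simpa using h x y)
  exact ⟨Λ, fun F r hr => (hΛ F).trans (csInf_le (hbb F) hr)⟩

/-- Kantorovich duality: the existence of a transport plan. -/
theorem IsTestAlgebra.exists_coupling [SecondCountableTopology M] [LocallyCompactSpace M]
    (hA : IsTestAlgebra A) {ν μ : Measure M}
    [IsProbabilityMeasure ν] [IsProbabilityMeasure μ] {K : ℝ}
    (hK : ∀ φ ∈ A, ∀ ψ ∈ A, (∀ x y, φ x - ψ y ≤ dist x y ^ 2 / 2) →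
      ∫ x, φ x ∂ν - ∫ x, ψ x ∂μ ≤ K) :
    ∃ κ : Measure (M × M), IsCoupling κ ν μ ∧
      ∫⁻ z, edist z.1 z.2 ^ 2 / 2 ∂κ ≤ ENNReal.ofReal K := by
  obtain ⟨Λ, hΛ⟩ := hA.exists_linear_plan hK
  have hΛmono : ∀ F G : M × M →ᵇ ℝ, (∀ z, F z ≤ G z) → Λ F ≤ Λ G := by
    intro F G h
    have : Λ (F - G) ≤ 0 := hΛ _ _ ⟨0, A.zero_mem, 0, A.zero_mem, 0, le_rfl,
      fun x y => by simpa using h (x, y), by simp⟩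
    rw [map_sub] at this
    linarith
  have hfst : ∀ φ ∈ A, ∀ F : M × M →ᵇ ℝ, (∀ z, F z = φ z.1) → Λ F = ∫ x, φ x ∂ν := by
    intro φ hφ F hF
    refine le_antisymm ?_ ?_
    · exact hΛ _ _ ⟨φ, hφ, 0, A.zero_mem, 0, le_rfl, fun x y => by simp [hF], by simp⟩
    · have : Λ (-F) ≤ -∫ x, φ x ∂ν :=
        hΛ _ _ ⟨-φ, A.neg_mem hφ, 0, A.zero_mem, 0, le_rfl, fun x y => by simp [hF],
          by simp [integral_neg]⟩
      rw [map_neg] at this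
      linarith
  have hsnd : ∀ φ ∈ A, ∀ F : M × M →ᵇ ℝ, (∀ z, F z = φ z.2) → Λ F = ∫ x, φ x ∂μ := by
    intro φ hφ F hF
    refine le_antisymm ?_ ?_
    · exact hΛ _ _ ⟨0, A.zero_mem, φ, hφ, 0, le_rfl, fun x y => by simp [hF], by simp⟩
    · have : Λ (-F) ≤ -∫ x, φ x ∂μ :=
        hΛ _ _ ⟨0, A.zero_mem, -φ, A.neg_mem hφ, 0, le_rfl, fun x y => by simp [hF],
          by simp [integral_neg]⟩
      rw [map_neg] at this
      linarith
  -- the functions on the product attached to elements of the algebra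
  have hbcf : ∀ φ ∈ A, ∀ ψ ∈ A, ∃ F : M × M →ᵇ ℝ, ∀ z, F z = φ z.1 * ψ z.2 := by
    intro φ hφ ψ hψ
    obtain ⟨C, hC⟩ := hA.bounded φ hφ
    obtain ⟨D, hD⟩ := hA.bounded ψ hψ
    refine ⟨BoundedContinuousFunction.ofNormedAddCommGroup (fun z : M × M => φ z.1 * ψ z.2)
      (((hA.continuous φ hφ).comp continuous_fst).mul ((hA.continuous ψ hψ).comp continuous_snd))
      (C * D) (fun z => ?_), fun z => rfl⟩
    rw [norm_mul]
    exact mul_le_mul (hC _) (hD _) (norm_nonneg _) ((abs_nonneg _).trans (hC z.1))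
  have hone : (1 : M → ℝ) ∈ A := A.one_mem
  set ι : C_c(M × M, ℝ) →ₗ[ℝ] (M × M →ᵇ ℝ) :=
    { toFun := fun f => f.toBoundedContinuousFunction
      map_add' := fun f g => by ext; rfl
      map_smul' := fun c f => by ext; rfl } with hι
  have hιa : ∀ f z, ι f z = f z := fun f z => rfl
  set Λc : C_c(M × M, ℝ) →ₚ[ℝ] ℝ := PositiveLinearMap.mk₀ (Λ ∘ₗ ι) (fun f hf => by
    have := hΛmono 0 (ι f) (fun z => hf z)
    simpa using this) with hΛc
  have hΛca : ∀ f, Λc f = Λ (ι f) := fun f => rfl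
  -- Riesz represents Λ only on compactly supported functions. Absence of mass loss at infinity is
  -- proved below from the marginals.
  set κ := RealRMK.rieszMeasure Λc with hκ
  have hint : ∀ f : C_c(M × M, ℝ), ∫ z, f z ∂κ = Λ (ι f) := fun f => by
    rw [hκ, RealRMK.integral_rieszMeasure, hΛca]
  obtain ⟨χ, hχA, hχc, hχ01, hχ1⟩ := hA.exists_exhaustion
  set T : ℕ → M × M → ℝ := fun k z => χ k z.1 * χ k z.2 with hT
  have hT01 : ∀ k z, T k z ∈ Icc (0 : ℝ) 1 := fun k z =>
    ⟨mul_nonneg (hχ01 k _).1 (hχ01 k _).1, mul_le_one₀ (hχ01 k _).2 (hχ01 k _).1 (hχ01 k _).2⟩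
  have hT1 : ∀ z, ∀ᶠ k in atTop, T k z = 1 := fun z => by
    filter_upwards [hχ1 z.1, hχ1 z.2] with k h1 h2
    simp [hT, h1, h2]
  have hTcont : ∀ k, Continuous (T k) := fun k =>
    ((hA.continuous _ (hχA k)).comp continuous_fst).mul
      ((hA.continuous _ (hχA k)).comp continuous_snd)
  have hTsupp : ∀ k (f : M × M → ℝ), HasCompactSupport fun z => f z * T k z := by
    intro k f
    refine HasCompactSupport.intro ((hχc k).prod (hχc k)) fun z hz => ?_
    rw [mem_prod, not_and_or] at hz
    rcases hz with hz | hz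
    · simp [hT, image_eq_zero_of_notMem_tsupport hz]
    · simp [hT, image_eq_zero_of_notMem_tsupport hz]
  have hcut : ∀ (f : M × M → ℝ), Continuous f → ∀ k, ∃ g : C_c(M × M, ℝ), ∀ z, g z = f z * T k z :=
    fun f hf k => ⟨⟨⟨fun z => f z * T k z, hf.mul (hTcont k)⟩, hTsupp k f⟩, fun z => rfl⟩
  have lint : ∀ (f : M × M → ℝ), Continuous f → (∀ z, 0 ≤ f z) → ∀ k (C : ℝ),
      (∀ g : C_c(M × M, ℝ), (∀ z, g z = f z * T k z) → Λ (ι g) ≤ C) →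
      ∫⁻ z, ENNReal.ofReal (f z * T k z) ∂κ ≤ ENNReal.ofReal C := by
    intro f hf hf0 k C h
    obtain ⟨g, hg⟩ := hcut f hf k
    have hgi : Integrable g κ := g.continuous.integrable_of_hasCompactSupport g.hasCompactSupport
    have h1 := hint g
    have h2 := ofReal_integral_eq_lintegral_ofReal hgi
      (Eventually.of_forall fun z => by rw [hg]; exact mul_nonneg (hf0 z) (hT01 k z).1)
    simp only [hg] at h1 h2
    rw [← h2, h1]
    exact ENNReal.ofReal_le_ofReal (h g hg)
  have hΛ1 : ∀ F : M × M →ᵇ ℝ, (∀ z, F z = 1) → Λ F = 1 := fun F hF => by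
    rw [hfst 1 hone F hF]; simp
  obtain ⟨F1, hF1⟩ := hbcf 1 hone 1 hone
  simp only [Pi.one_apply, mul_one] at hF1
  have hfin : IsFiniteMeasure κ := by
    refine ⟨lt_of_le_of_lt ?_ ENNReal.one_lt_top⟩
    rw [← lintegral_one]
    refine lintegral_le_of_eventually_eq (f := fun k z => ENNReal.ofReal (1 * T k z))
      (fun k => ((hTcont k).measurable.const_mul 1).ennreal_ofReal)
      (fun z => by filter_upwards [hT1 z] with k hk; simp [hk]) (fun k => ?_)
    have := lint (fun _ => 1) continuous_const (fun _ => zero_le_one) k 1 (fun g hg => by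
      rw [← hΛ1 F1 hF1]
      exact hΛmono _ _ fun z => by rw [hιa, hg, hF1, one_mul]; exact (hT01 k z).2)
    simpa using this
  have hcost : ∫⁻ z, edist z.1 z.2 ^ 2 / 2 ∂κ ≤ ENNReal.ofReal K := by
    have hc : ∀ z : M × M, ENNReal.ofReal (dist z.1 z.2 ^ 2 / 2) = edist z.1 z.2 ^ 2 / 2 := by
      intro z
      rw [ENNReal.ofReal_div_of_pos two_pos, ENNReal.ofReal_pow dist_nonneg, ← edist_dist]
      simp
    have hdc : Continuous fun z : M × M => dist z.1 z.2 ^ 2 / 2 := by fun_prop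
    refine lintegral_le_of_eventually_eq
      (f := fun k z => ENNReal.ofReal (dist z.1 z.2 ^ 2 / 2 * T k z))
      (fun k => (hdc.mul (hTcont k)).measurable.ennreal_ofReal)
      (fun z => by filter_upwards [hT1 z] with k hk; rw [hk, mul_one, hc]) (fun k => ?_)
    refine lint _ hdc (fun z => by positivity) k K fun g hg => ?_
    -- The cut-off cost lies below d²/2 itself: zero potentials with t = 1 give the bound K.
    refine hΛ _ _ ⟨0, A.zero_mem, 0, A.zero_mem, 1, zero_le_one, fun x y => ?_, by simp⟩
    rw [hιa, hg]
    have : 0 ≤ dist x y ^ 2 / 2 := by positivity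
    simpa using mul_le_of_le_one_right this (hT01 k (x, y)).2
  have hlim : ∀ (ν : Measure M) [IsProbabilityMeasure ν],
      Tendsto (fun k => ∫ x, χ k x ∂ν) atTop (𝓝 1) := by
    intro ν _
    have := tendsto_integral_of_dominated_convergence (μ := ν) (F := χ) (f := fun _ => (1 : ℝ))
      (fun _ => (1 : ℝ)) (fun k => (hA.continuous _ (hχA k)).measurable.aestronglyMeasurable)
      (integrable_const 1)
      (fun k => Eventually.of_forall fun x => by
        rw [Real.norm_eq_abs, abs_of_nonneg (hχ01 k x).1]; exact (hχ01 k x).2)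
      (Eventually.of_forall fun x => tendsto_const_nhds.congr' (by
        filter_upwards [hχ1 x] with k hk using hk.symm))
    simpa using this
  -- integrals of functions of one variable
  have hmarg : ∀ (f : M × M → ℝ) (F : M × M →ᵇ ℝ), (∀ z, F z = f z) → ∫ z, f z ∂κ = Λ F := by
    intro f F hF
    have hfc : Continuous f := by
      rw [show f = F from funext fun z => (hF z).symm]; exact F.continuous
    have hfb : ∀ z, |f z| ≤ ‖F‖ := fun z => by rw [← hF]; exact F.norm_coe_le_norm z
    choose g hg using hcut f hfc
    have t1 : Tendsto (fun k => ∫ z, g k z ∂κ) atTop (𝓝 (∫ z, f z ∂κ)) := by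
      refine tendsto_integral_of_dominated_convergence (fun _ => ‖F‖)
        (fun k => (g k).continuous.measurable.aestronglyMeasurable) (integrable_const _)
        (fun k => Eventually.of_forall fun z => ?_)
        (Eventually.of_forall fun z => tendsto_const_nhds.congr' ?_)
      · rw [hg, norm_mul, Real.norm_eq_abs (T k z), abs_of_nonneg (hT01 k z).1]
        exact (mul_le_of_le_one_right (norm_nonneg _) (hT01 k z).2).trans (hfb z)
      · filter_upwards [hT1 z] with k hk
        rw [hg, hk, mul_one]
    -- Tightness: 1 − χ_k(x)χ_k(y) ≤ (1 − χ_k(x)) + (1 − χ_k(y)), and Λ evaluates the right side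
    -- through the marginals, where it tends to 0.
    have t2 : Tendsto (fun k => Λ (ι (g k))) atTop (𝓝 (Λ F)) := by
      have hb : ∀ k, |Λ (ι (g k)) - Λ F|
          ≤ ‖F‖ * ((1 - ∫ x, χ k x ∂ν) + (1 - ∫ x, χ k x ∂μ)) := by
        intro k
        obtain ⟨X, hX⟩ := hbcf _ (hχA k) 1 hone
        obtain ⟨Y, hY⟩ := hbcf 1 hone _ (hχA k)
        simp only [Pi.one_apply, mul_one, one_mul] at hX hY
        have hval : Λ (‖F‖ • ((F1 - X) + (F1 - Y)))
            = ‖F‖ * ((1 - ∫ x, χ k x ∂ν) + (1 - ∫ x, χ k x ∂μ)) := by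
          rw [map_smul, map_add, map_sub, map_sub, hΛ1 F1 hF1, hfst _ (hχA k) X hX,
            hsnd _ (hχA k) Y hY, smul_eq_mul]
        have hpt : ∀ z, |f z * T k z - f z| ≤ ‖F‖ * ((1 - χ k z.1) + (1 - χ k z.2)) := by
          intro z
          have e1 : f z * T k z - f z = -(f z * (1 - T k z)) := by ring
          rw [e1, abs_neg, abs_mul, abs_of_nonneg (sub_nonneg.2 (hT01 k z).2)]
          refine mul_le_mul (hfb z) ?_ (sub_nonneg.2 (hT01 k z).2) (norm_nonneg _)
          have h1 := (hχ01 k z.1).2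
          have h2 := (hχ01 k z.2).2
          simp only [hT]
          nlinarith
        rw [← map_sub, abs_le, ← hval]
        constructor
        · rw [← map_neg]
          refine hΛmono _ _ fun z => ?_
          have := (abs_le.1 (hpt z)).1
          simp only [BoundedContinuousFunction.coe_neg, BoundedContinuousFunction.coe_smul,
            BoundedContinuousFunction.coe_add, BoundedContinuousFunction.coe_sub, Pi.neg_apply,
            Pi.add_apply, Pi.sub_apply, smul_eq_mul, hιa, hg, hF, hX, hY, hF1]
          exact this
        · refine hΛmono _ _ fun z => ?_
          have := (abs_le.1 (hpt z)).2
          simp only [BoundedContinuousFunction.coe_smul,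
            BoundedContinuousFunction.coe_add, BoundedContinuousFunction.coe_sub,
            Pi.add_apply, Pi.sub_apply, smul_eq_mul, hιa, hg, hF, hX, hY, hF1]
          exact this
      have hz : Tendsto (fun k => ‖F‖ * ((1 - ∫ x, χ k x ∂ν) + (1 - ∫ x, χ k x ∂μ))) atTop
          (𝓝 0) := by
        have := (((hlim ν).const_sub 1).add ((hlim μ).const_sub 1)).const_mul ‖F‖
        simpa using this
      rw [tendsto_iff_norm_sub_tendsto_zero]
      exact squeeze_zero (fun _ => norm_nonneg _) hb hz
    simp only [hint] at t1
    exact tendsto_nhds_unique t1 t2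
  have hprob : IsProbabilityMeasure κ := by
    have h1 := hmarg (fun _ => 1) F1 hF1
    rw [hΛ1 F1 hF1] at h1
    simp only [integral_const, smul_eq_mul, mul_one] at h1
    exact ⟨by rw [← ENNReal.toReal_eq_one_iff]; exact h1⟩
  refine ⟨κ, ⟨hprob, ?_, ?_⟩, hcost⟩
  · refine hA.measure_ext fun φ hφ => ?_
    obtain ⟨F, hF⟩ := hbcf φ hφ 1 hone
    simp only [Pi.one_apply, mul_one] at hF
    rw [integral_map measurable_fst.aemeasurable
      (hA.continuous φ hφ).measurable.aestronglyMeasurable, hmarg _ F hF, hfst φ hφ F hF]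
  · refine hA.measure_ext fun φ hφ => ?_
    obtain ⟨F, hF⟩ := hbcf 1 hone φ hφ
    simp only [Pi.one_apply, one_mul] at hF
    rw [integral_map measurable_snd.aemeasurable
      (hA.continuous φ hφ).measurable.aestronglyMeasurable, hmarg _ F hF, hsnd φ hφ F hF]

theorem IsTestAlgebra.W₂_sq_le [SecondCountableTopology M] [LocallyCompactSpace M]
    (hA : IsTestAlgebra A) {ν μ : Measure M}
    [IsProbabilityMeasure ν] [IsProbabilityMeasure μ] {K : ℝ}
    (hK : ∀ φ ∈ A, ∀ ψ ∈ A, (∀ x y, φ x - ψ y ≤ dist x y ^ 2 / 2) →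
      ∫ x, φ x ∂ν - ∫ x, ψ x ∂μ ≤ K) :
    W₂ ν μ ^ 2 ≤ ENNReal.ofReal K := by
  obtain ⟨κ, hκ, hc⟩ := hA.exists_coupling hK
  calc W₂ ν μ ^ 2 ≤ ((∫⁻ z, edist z.1 z.2 ^ 2 / 2 ∂κ) ^ (1 / 2 : ℝ)) ^ 2 :=
        pow_le_pow_left' (iInf₂_le κ hκ) 2
    _ = ∫⁻ z, edist z.1 z.2 ^ 2 / 2 ∂κ := by
        rw [← ENNReal.rpow_natCast, ← ENNReal.rpow_mul]; norm_num
    _ ≤ ENNReal.ofReal K := hc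

end Kantorovich

end LocalTransport

end

/-! ### Riemannian distance, Lipschitz bounds and compact balls -/

noncomputable section

namespace LocalTransport

open Filter Topology Set

section Riemannian

variable {m : ℕ} {M : Type*} [MetricSpace M]
    [ChartedSpace (EuclideanSpace ℝ (Fin m)) M]
    [RiemannianBundle (fun x : M => TangentSpace (𝓡 m) x)]

theorem norm_riemGradient (f : M → ℝ) (x : M) :
    ‖riemGradient (m := m) f x‖ = ‖differential (m := m) f x‖ :=
  LinearIsometryEquiv.norm_map _ _

variable [IsRiemannianManifold (𝓡 m) M]

theorem exists_path_lt {x y : M} {r : ℝ} (h : dist x y < r) :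
    ∃ γ : ℝ → M, γ 0 = x ∧ γ 1 = y ∧ ContMDiff 𝓘(ℝ, ℝ) (𝓡 m) 1 γ ∧
      Manifold.pathELength (𝓡 m) γ 0 1 < ENNReal.ofReal r := by
  have h1 : Manifold.riemannianEDist (𝓡 m) x y < ENNReal.ofReal r := by
    rw [← IsRiemannianManifold.out (I := 𝓡 m) x y, edist_dist]
    exact (ENNReal.ofReal_lt_ofReal_iff (dist_nonneg.trans_lt h)).2 h
  obtain ⟨γ, h0, h1, hγ, hl, -⟩ :=
    Manifold.exists_lt_locally_constant_of_riemannianEDist_lt h1 zero_lt_one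
  exact ⟨γ, h0, h1, hγ, hl⟩

theorem edist_le_pathELength {γ : ℝ → M} (hγ : ContMDiff 𝓘(ℝ, ℝ) (𝓡 m) 1 γ) {a b : ℝ}
    (hab : a ≤ b) : edist (γ a) (γ b) ≤ Manifold.pathELength (𝓡 m) γ a b := by
  rw [IsRiemannianManifold.out (I := 𝓡 m)]
  exact Manifold.riemannianEDist_le_pathELength hγ.contMDiffOn rfl rfl hab

omit [MetricSpace M] [IsRiemannianManifold (𝓡 m) M] in
theorem pathELength_comp_le [TopologicalSpace M] [ChartedSpace (EuclideanSpace ℝ (Fin m)) M]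
    [RiemannianBundle (fun x : M => TangentSpace (𝓡 m) x)] {γ : ℝ → M}
    (hγ : ContMDiff 𝓘(ℝ, ℝ) (𝓡 m) 1 γ) {f : M → ℝ} (hf : ContMDiff (𝓡 m) 𝓘(ℝ, ℝ) 1 f)
    {L : ℝ} {a b : ℝ}
    (hL : ∀ t ∈ Icc a b, ‖differential (m := m) f (γ t)‖ ≤ L) :
    Manifold.pathELength 𝓘(ℝ, ℝ) (f ∘ γ) a b
      ≤ ENNReal.ofReal L * Manifold.pathELength (𝓡 m) γ a b := by
  rw [Manifold.pathELength_eq_lintegral_mfderiv_Icc, Manifold.pathELength_eq_lintegral_mfderiv_Icc,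
    ← lintegral_const_mul' _ _ ENNReal.ofReal_ne_top]
  refine setLIntegral_mono' measurableSet_Icc fun t ht => ?_
  have h1 : mfderiv 𝓘(ℝ, ℝ) 𝓘(ℝ, ℝ) (f ∘ γ) t
      = (mfderiv (𝓡 m) 𝓘(ℝ, ℝ) f (γ t)).comp (mfderiv 𝓘(ℝ, ℝ) (𝓡 m) γ t) :=
    mfderiv_comp t ((hf.mdifferentiable one_ne_zero) _) ((hγ.mdifferentiable one_ne_zero) _)
  have h2 : mfderiv 𝓘(ℝ, ℝ) 𝓘(ℝ, ℝ) (f ∘ γ) t 1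
      = differential (m := m) f (γ t) (mfderiv 𝓘(ℝ, ℝ) (𝓡 m) γ t 1) := by rw [h1]; rfl
  have h3 : ‖mfderiv 𝓘(ℝ, ℝ) 𝓘(ℝ, ℝ) (f ∘ γ) t 1‖ₑ
      = ‖differential (m := m) f (γ t) (mfderiv 𝓘(ℝ, ℝ) (𝓡 m) γ t 1)‖ₑ := by
    rw [enorm_tangentSpace_vectorSpace]
    exact congrArg (fun z : ℝ => ‖z‖ₑ) h2
  rw [h3, ← ofReal_norm, ← ofReal_norm,
    ← ENNReal.ofReal_mul ((ContinuousLinearMap.opNorm_nonneg _).trans (hL t ht))]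
  refine ENNReal.ofReal_le_ofReal ?_
  exact (ContinuousLinearMap.le_opNorm _ _).trans
    (mul_le_mul_of_nonneg_right (hL t ht) (norm_nonneg _))

/-- A bound on the gradient in a ball controls the variation of a function. -/
theorem abs_sub_le_of_norm_differential_le {f : M → ℝ} (hf : ContMDiff (𝓡 m) 𝓘(ℝ, ℝ) 1 f) {L : ℝ}
    {x y : M} {R : ℝ} (hR : dist x y < R)
    (hL : ∀ z ∈ Metric.ball x R, ‖differential (m := m) f z‖ ≤ L) :
    |f y - f x| ≤ L * dist x y := by
  have hL0 : 0 ≤ L := (ContinuousLinearMap.opNorm_nonneg _).trans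
    (hL x (Metric.mem_ball_self (dist_nonneg.trans_lt hR)))
  have key : ∀ r ∈ Ioo (dist x y) R, |f y - f x| ≤ L * r := by
    intro r hr
    obtain ⟨γ, h0, h1, hγ, hl⟩ := exists_path_lt (m := m) hr.1
    -- A path from x of length less than r < R cannot leave the ball, so the gradient bound applies
    -- along it.
    have hball : ∀ t ∈ Icc (0 : ℝ) 1, γ t ∈ Metric.ball x R := by
      intro t ht
      have h2 := (edist_le_pathELength (m := m) hγ ht.1).trans
        (Manifold.pathELength_mono le_rfl ht.2)
      have h3 := h2.trans_lt hl
      rw [h0, edist_dist, ENNReal.ofReal_lt_ofReal_iff (dist_nonneg.trans_lt hr.1)] at h3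
      rw [Metric.mem_ball, dist_comm]
      exact h3.trans hr.2
    have h2 := pathELength_comp_le hγ hf (fun t ht => hL _ (hball t ht))
    have h3 : edist (f x) (f y) ≤ Manifold.pathELength 𝓘(ℝ, ℝ) (f ∘ γ) 0 1 := by
      rw [IsRiemannianManifold.out (I := 𝓘(ℝ, ℝ))]
      exact Manifold.riemannianEDist_le_pathELength (hf.comp hγ).contMDiffOn (by simp [h0])
        (by simp [h1]) zero_le_one
    have h4 : edist (f x) (f y) ≤ ENNReal.ofReal (L * r) := by
      rw [ENNReal.ofReal_mul hL0]
      exact (h3.trans h2).trans (mul_le_mul_right hl.le _)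
    rw [edist_dist, ENNReal.ofReal_le_ofReal_iff
      (mul_nonneg hL0 (dist_nonneg.trans hr.1.le))] at h4
    rwa [dist_comm, Real.dist_eq] at h4
  have h1 : Tendsto (fun r => L * r) (𝓝[>] (dist x y)) (𝓝 (L * dist x y)) :=
    ((continuous_const.mul continuous_id).tendsto _).mono_left nhdsWithin_le_nhds
  refine ge_of_tendsto h1 ?_
  filter_upwards [Ioo_mem_nhdsGT hR] with r hr using key r hr

variable (m) in
include m in
/-- Approximate midpoints. -/
theorem exists_dist_le_dist_lt {x y : M} {a b : ℝ} (ha : 0 ≤ a) (hb : 0 < b)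
    (h : dist x y < a + b) : ∃ z, dist x z ≤ a ∧ dist z y < b := by
  rcases le_or_gt (dist x y) a with h' | h'
  · exact ⟨y, h', by simpa using hb⟩
  obtain ⟨γ, h0, h1, hγ, hl⟩ := exists_path_lt (m := m) h
  have hc : ContinuousOn (fun t => dist x (γ t)) (Icc 0 1) :=
    (continuous_const.dist hγ.continuous).continuousOn
  -- The distance from x takes the value a along an almost minimizing path; the length left after
  -- that time is less than b.
  obtain ⟨t, ht, hta⟩ := intermediate_value_Icc zero_le_one hc
    (show a ∈ Icc (dist x (γ 0)) (dist x (γ 1)) by simp [h0, h1, ha, h'.le])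
  refine ⟨γ t, hta.le, ?_⟩
  have e1 := edist_le_pathELength (m := m) hγ ht.1
  have e2 := edist_le_pathELength (m := m) hγ ht.2
  have e3 := Manifold.pathELength_add (I := 𝓡 m) (γ := γ) ht.1 ht.2
  have e4 : ENNReal.ofReal a + ENNReal.ofReal (dist (γ t) y) < ENNReal.ofReal (a + b) := by
    refine lt_of_le_of_lt ?_ hl
    rw [← e3]
    simp only [h0, h1, edist_dist] at e1 e2
    simp only at hta
    rw [hta] at e1
    exact add_le_add e1 e2
  rw [← ENNReal.ofReal_add ha dist_nonneg, ENNReal.ofReal_lt_ofReal_iff (by linarith)] at e4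
  linarith

variable (m) in
include m in
/-- Closed balls of a complete Riemannian manifold are compact. -/
theorem isCompact_closedBall_of_complete [CompleteSpace M] (x : M) (R : ℝ) :
    IsCompact (Metric.closedBall x R) := by
  have : LocallyCompactSpace M := ChartedSpace.locallyCompactSpace (EuclideanSpace ℝ (Fin m)) M
  set S : Set ℝ := {r | IsCompact (Metric.closedBall x r)}
  have hdown : ∀ r ∈ S, ∀ r' ≤ r, r' ∈ S := fun r hr r' hr' =>
    IsCompact.of_isClosed_subset hr Metric.isClosed_closedBall
      (Metric.closedBall_subset_closedBall hr')
  have h0 : (0 : ℝ) ∈ S := by simp [S]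
  -- By approximate midpoints, a slightly larger ball lies in a compact thickening of the compact
  -- ball.
  have hopen : ∀ r ∈ S, 0 ≤ r → ∃ δ > 0, r + δ ∈ S := by
    intro r hr hr0
    obtain ⟨δ, hδ, hc⟩ := IsCompact.exists_isCompact_cthickening (s := Metric.closedBall x r) hr
    refine ⟨δ / 2, by positivity, hc.of_isClosed_subset Metric.isClosed_closedBall fun y hy => ?_⟩
    rw [Metric.mem_closedBall, dist_comm] at hy
    obtain ⟨z, hz, hzy⟩ := exists_dist_le_dist_lt m (x := x) (y := y) hr0 hδ (by linarith)
    exact Metric.mem_cthickening_of_dist_le y z δ _ (by rwa [Metric.mem_closedBall, dist_comm])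
      (by rw [dist_comm]; exact hzy.le)
  -- Each point of the ball of radius r is within 2δ of the compact ball of radius r − δ, so the
  -- closed ball is totally bounded; completeness of M gives compactness. The supremum of the
  -- compact radii would thus both belong to S and be exceeded.
  have hclosed : ∀ r, 0 < r → (∀ r' < r, r' ∈ S) → r ∈ S := by
    intro r hr h
    refine isCompact_iff_totallyBounded_isComplete.2 ⟨?_, Metric.isClosed_closedBall.isComplete⟩
    rw [Metric.totallyBounded_iff]
    intro ε hε
    set δ := min (ε / 4) (r / 2) with hδ
    have hδ0 : 0 < δ := by positivity
    have hc : IsCompact (Metric.closedBall x (r - δ)) := h _ (by linarith)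
    obtain ⟨t, ht, hcov⟩ := Metric.totallyBounded_iff.1 hc.totallyBounded (ε / 2) (by positivity)
    refine ⟨t, ht, fun y hy => ?_⟩
    rw [Metric.mem_closedBall, dist_comm] at hy
    obtain ⟨z, hz, hzy⟩ := exists_dist_le_dist_lt m (x := x) (y := y) (a := r - δ)
      (b := 2 * δ) (by linarith [min_le_right (ε / 4) (r / 2)]) (by positivity) (by linarith)
    have hz' := hcov (show z ∈ Metric.closedBall x (r - δ) by
      rwa [Metric.mem_closedBall, dist_comm])
    simp only [mem_iUnion, Metric.mem_ball, exists_prop] at hz' ⊢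
    obtain ⟨w, hw, hzw⟩ := hz'
    refine ⟨w, hw, ?_⟩
    have h1 := dist_triangle y z w
    rw [dist_comm y z] at h1
    linarith [min_le_left (ε / 4) (r / 2)]
  by_contra hR
  have hR0 : 0 < R := by
    by_contra! h
    exact hR (hdown 0 h0 R h)
  have hbdd : BddAbove S := ⟨R, fun r hr => by
    by_contra! h
    exact hR (hdown r hr R h.le)⟩
  set s := sSup S
  have hs0 : 0 ≤ s := le_csSup hbdd h0
  have hlt : ∀ r' < s, r' ∈ S := fun r' hr' => by
    obtain ⟨r, hr, hr2⟩ := exists_lt_of_lt_csSup ⟨0, h0⟩ hr'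
    exact hdown r hr r' hr2.le
  have hsS : s ∈ S := by
    rcases hs0.eq_or_lt with h | h
    · rw [← h]; exact h0
    · exact hclosed s h hlt
  obtain ⟨δ, hδ, hδS⟩ := hopen s hsS hs0
  have := le_csSup hbdd hδS
  linarith

end Riemannian

end LocalTransport

end

/-! ### Comparison of the metric with a constant norm in a chart -/

noncomputable section

namespace LocalTransport

open Filter Topology Set

section ChartComparison

variable {m : ℕ} {M : Type*} [MetricSpace M]
    [ChartedSpace (EuclideanSpace ℝ (Fin m)) M] [IsManifold (𝓡 m) ∞ M]
    [RiemannianBundle (fun x : M => TangentSpace (𝓡 m) x)]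

/-- The differential at `y` of the preferred chart at `p`. -/
def chartDifferential (p y : M) : TangentSpace (𝓡 m) y →L[ℝ] EuclideanSpace ℝ (Fin m) :=
  (trivializationAt (EuclideanSpace ℝ (Fin m)) (TangentSpace (𝓡 m)) p).continuousLinearMapAt ℝ y

/-- The Riemannian length at `p` of a vector, read in the preferred chart at `p`. -/
def chartNorm (p : M) (w : EuclideanSpace ℝ (Fin m)) : ℝ :=
  ‖(trivializationAt (EuclideanSpace ℝ (Fin m)) (TangentSpace (𝓡 m)) p).symmL ℝ p w‖

theorem chartNorm_smul (p : M) (t : ℝ) (w : EuclideanSpace ℝ (Fin m)) :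
    chartNorm p (t • w) = |t| * chartNorm p w := by
  rw [chartNorm, map_smul, norm_smul, Real.norm_eq_abs, chartNorm]

theorem chartNorm_nonneg (p : M) (w : EuclideanSpace ℝ (Fin m)) : 0 ≤ chartNorm p w :=
  norm_nonneg _

theorem exists_chartNorm_le (p : M) :
    ∃ C : ℝ≥0, ∀ w : EuclideanSpace ℝ (Fin m), chartNorm p w ≤ C * ‖w‖ :=
  ⟨‖(trivializationAt (EuclideanSpace ℝ (Fin m)) (TangentSpace (𝓡 m)) p).symmL ℝ p‖₊,
    fun w => ContinuousLinearMap.le_opNorm _ w⟩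

omit [RiemannianBundle (fun x : M => TangentSpace (𝓡 m) x)] in
theorem chartDifferential_mfderiv {p : M} {γ : ℝ → M} {t : ℝ}
    (hγ : MDifferentiableAt 𝓘(ℝ, ℝ) (𝓡 m) γ t)
    (ht : γ t ∈ (chartAt (EuclideanSpace ℝ (Fin m)) p).source) :
    chartDifferential p (γ t) (mfderiv 𝓘(ℝ, ℝ) (𝓡 m) γ t 1)
      = deriv (fun s => extChartAt (𝓡 m) p (γ s)) t := by
  have h1 := mfderiv_comp t (mdifferentiableAt_extChartAt (I := 𝓡 m) ht) hγ
  have h2 := TangentBundle.continuousLinearMapAt_trivializationAt (I := 𝓡 m) (𝕜 := ℝ) ht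
  rw [chartDifferential, h2, ← fderiv_apply_one_eq_deriv, ← mfderiv_eq_fderiv]
  exact congrArg (fun L => L 1) h1.symm

omit [RiemannianBundle (fun x : M => TangentSpace (𝓡 m) x)] in
theorem differential_comp_extChartAt {p y : M} {G : EuclideanSpace ℝ (Fin m) → ℝ}
    (hG : ContDiff ℝ ∞ G) (hy : y ∈ (chartAt (EuclideanSpace ℝ (Fin m)) p).source)
    (v : TangentSpace (𝓡 m) y) :
    differential (m := m) (fun z => G (extChartAt (𝓡 m) p z)) y v
      = fderiv ℝ G (extChartAt (𝓡 m) p y) (chartDifferential p y v) := by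
  have hG' : MDifferentiableAt 𝓘(ℝ, EuclideanSpace ℝ (Fin m)) 𝓘(ℝ, ℝ) G (extChartAt (𝓡 m) p y) :=
    (hG.differentiable (by simp)).mdifferentiable _
  have h1 := mfderiv_comp y hG' (mdifferentiableAt_extChartAt (I := 𝓡 m) hy)
  have h2 := TangentBundle.continuousLinearMapAt_trivializationAt (I := 𝓡 m) (𝕜 := ℝ) hy
  rw [chartDifferential, h2, ← mfderiv_eq_fderiv]
  exact congrArg (fun L => L v) h1

variable [IsContMDiffRiemannianBundle (𝓡 m) ∞ (EuclideanSpace ℝ (Fin m))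
      (fun x : M => TangentSpace (𝓡 m) x)]

/-- Continuity of the metric: near p the Riemannian norm differs by a factor at most c from the norm
frozen at p. The latter is translation invariant in the chart, as mollification requires. -/
theorem eventually_chartNorm_comparison (p : M) {c : ℝ} (hc : 1 < c) :
    ∀ᶠ y in 𝓝 p, ∀ v : TangentSpace (𝓡 m) y,
      ‖v‖ ≤ c * chartNorm p (chartDifferential p y v) ∧
      chartNorm p (chartDifferential p y v) ≤ c * ‖v‖ := by
  have : IsContinuousRiemannianBundle (EuclideanSpace ℝ (Fin m))
      (fun x : M => TangentSpace (𝓡 m) x) := by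
    obtain ⟨g, hg, h⟩ := IsContMDiffRiemannianBundle.exists_contMDiff (IB := 𝓡 m) (n := ∞)
      (F := EuclideanSpace ℝ (Fin m)) (E := fun x : M => TangentSpace (𝓡 m) x)
    exact ⟨g, hg.continuous, h⟩
  set e := trivializationAt (EuclideanSpace ℝ (Fin m)) (TangentSpace (𝓡 m)) p
  have hp : p ∈ e.baseSet := FiberBundle.mem_baseSet_trivializationAt' p
  filter_upwards [eventually_norm_symmL_trivializationAt_self_comp_lt (EuclideanSpace ℝ (Fin m))
      (fun x : M => TangentSpace (𝓡 m) x) p hc,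
    eventually_norm_symmL_trivializationAt_comp_self_lt (EuclideanSpace ℝ (Fin m))
      (fun x : M => TangentSpace (𝓡 m) x) p hc, e.open_baseSet.mem_nhds hp] with y h1 h2 hy v
  constructor
  · have e1 : v = ((e.symmL ℝ y) ∘L (e.continuousLinearMapAt ℝ p))
        (e.symmL ℝ p (chartDifferential p y v)) := by
      rw [ContinuousLinearMap.comp_apply, e.continuousLinearMapAt_symmL hp]
      exact (e.symmL_continuousLinearMapAt hy v).symm
    set T := (e.symmL ℝ y) ∘L (e.continuousLinearMapAt ℝ p)
    have h3 := T.le_opNorm (e.symmL ℝ p (chartDifferential p y v))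
    rw [← e1] at h3
    exact h3.trans (mul_le_mul_of_nonneg_right h2.le (norm_nonneg _))
  · set T := (e.symmL ℝ p) ∘L (e.continuousLinearMapAt ℝ y)
    exact (T.le_opNorm v).trans (mul_le_mul_of_nonneg_right h1.le (norm_nonneg _))

/-- A ball in a chart in which the Riemannian metric is almost constant. -/
theorem exists_chart_ball (p : M) {c : ℝ} (hc : 1 < c) :
    ∃ r > 0, Metric.ball (extChartAt (𝓡 m) p p) r ⊆ (extChartAt (𝓡 m) p).target ∧
      ∀ a ∈ Metric.ball (extChartAt (𝓡 m) p p) r,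
        ∀ v : TangentSpace (𝓡 m) ((extChartAt (𝓡 m) p).symm a),
        ‖v‖ ≤ c * chartNorm p (chartDifferential p ((extChartAt (𝓡 m) p).symm a) v) ∧
        chartNorm p (chartDifferential p ((extChartAt (𝓡 m) p).symm a) v) ≤ c * ‖v‖ := by
  have h1 : ∀ᶠ a in 𝓝 (extChartAt (𝓡 m) p p), a ∈ (extChartAt (𝓡 m) p).target :=
    extChartAt_target_mem_nhds p
  have h2 : Tendsto (extChartAt (𝓡 m) p).symm (𝓝 (extChartAt (𝓡 m) p p)) (𝓝 p) := by
    have := continuousAt_extChartAt_symm (I := 𝓡 m) p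
    rw [ContinuousAt, extChartAt_to_inv] at this
    exact this
  obtain ⟨r, hr, h⟩ := Metric.eventually_nhds_iff_ball.1
    (h1.and (h2.eventually (eventually_chartNorm_comparison (m := m) p hc)))
  exact ⟨r, hr, fun a ha => (h a ha).1, fun a ha => (h a ha).2⟩

variable [IsRiemannianManifold (𝓡 m) M]

omit [IsContMDiffRiemannianBundle (𝓡 m) ∞ (EuclideanSpace ℝ (Fin m))
      (fun x : M => TangentSpace (𝓡 m) x)] in
/-- In such a ball, the distance is controlled by the norm. -/
theorem dist_extChartAt_symm_le {p : M} {c r : ℝ} (hc : 0 ≤ c)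
    (htarget : Metric.ball (extChartAt (𝓡 m) p p) r ⊆ (extChartAt (𝓡 m) p).target)
    (hcomp : ∀ a ∈ Metric.ball (extChartAt (𝓡 m) p p) r,
      ∀ v : TangentSpace (𝓡 m) ((extChartAt (𝓡 m) p).symm a),
      ‖v‖ ≤ c * chartNorm p (chartDifferential p ((extChartAt (𝓡 m) p).symm a) v))
    {a b : EuclideanSpace ℝ (Fin m)} (ha : a ∈ Metric.ball (extChartAt (𝓡 m) p p) r)
    (hb : b ∈ Metric.ball (extChartAt (𝓡 m) p p) r) :
    dist ((extChartAt (𝓡 m) p).symm a) ((extChartAt (𝓡 m) p).symm b)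
      ≤ c * chartNorm p (b - a) := by
  -- The straight segment from a to b stays in the ball by convexity; its image has length at most c
  -- times the frozen norm of b − a.
  set η : ℝ → EuclideanSpace ℝ (Fin m) := fun t => a + t • (b - a) with hη
  set γ : ℝ → M := fun t => (extChartAt (𝓡 m) p).symm (η t) with hγ
  have hηd : ContDiff ℝ ∞ η := contDiff_const.add (contDiff_id.smul contDiff_const)
  have hηball : ∀ t ∈ Icc (0 : ℝ) 1, η t ∈ Metric.ball (extChartAt (𝓡 m) p p) r := by
    intro t ht
    exact (convex_ball _ _).add_smul_sub_mem ha hb ht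
  have hγC : ContMDiffOn 𝓘(ℝ, ℝ) (𝓡 m) ∞ γ (η ⁻¹' (extChartAt (𝓡 m) p).target) :=
    (contMDiffOn_extChartAt_symm p).comp hηd.contMDiff.contMDiffOn (fun t ht => ht)
  have hopen : IsOpen (η ⁻¹' (extChartAt (𝓡 m) p).target) :=
    (isOpen_extChartAt_target p).preimage hηd.continuous
  have hsub : Icc (0 : ℝ) 1 ⊆ η ⁻¹' (extChartAt (𝓡 m) p).target :=
    fun t ht => htarget (hηball t ht)
  have h0 : η 0 = a := by simp [hη]
  have h1 : η 1 = b := by simp [hη]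
  have hle : edist ((extChartAt (𝓡 m) p).symm a) ((extChartAt (𝓡 m) p).symm b)
      ≤ Manifold.pathELength (𝓡 m) γ 0 1 := by
    rw [IsRiemannianManifold.out (I := 𝓡 m)]
    refine Manifold.riemannianEDist_le_pathELength ((hγC.mono hsub).of_le (by simp)) ?_ ?_
      zero_le_one
    · simp only [hγ, h0]
    · simp only [hγ, h1]
  have hlen : Manifold.pathELength (𝓡 m) γ 0 1 ≤ ENNReal.ofReal (c * chartNorm p (b - a)) := by
    rw [Manifold.pathELength_eq_lintegral_mfderiv_Icc]
    calc ∫⁻ t in Icc (0 : ℝ) 1, ‖mfderiv 𝓘(ℝ, ℝ) (𝓡 m) γ t 1‖ₑ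
        ≤ ∫⁻ _ in Icc (0 : ℝ) 1, ENNReal.ofReal (c * chartNorm p (b - a)) := by
          refine setLIntegral_mono' measurableSet_Icc fun t ht => ?_
          have hmd : MDifferentiableAt 𝓘(ℝ, ℝ) (𝓡 m) γ t :=
            (hγC.contMDiffAt (hopen.mem_nhds (hsub ht))).mdifferentiableAt (by simp)
          have hsrc : γ t ∈ (chartAt (EuclideanSpace ℝ (Fin m)) p).source := by
            have := (extChartAt (𝓡 m) p).map_target (hsub ht)
            rwa [extChartAt_source] at this
          have hd := chartDifferential_mfderiv hmd hsrc
          have hev : (fun s => extChartAt (𝓡 m) p (γ s)) =ᶠ[𝓝 t] η := by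
            filter_upwards [hopen.mem_nhds (hsub ht)] with s hs
            exact (extChartAt (𝓡 m) p).right_inv hs
          have hdη : deriv η t = b - a := by
            have : HasDerivAt η ((1 : ℝ) • (b - a)) t :=
              ((hasDerivAt_id t).smul_const (b - a)).const_add a
            simpa using this.deriv
          rw [hev.deriv_eq, hdη] at hd
          have := hcomp (η t) (hηball t ht) (mfderiv 𝓘(ℝ, ℝ) (𝓡 m) γ t 1)
          rw [← ofReal_norm]
          refine ENNReal.ofReal_le_ofReal ?_
          rw [← hd]
          exact this
      _ = ENNReal.ofReal (c * chartNorm p (b - a)) := by simp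
  have := hle.trans hlen
  rwa [edist_dist, ENNReal.ofReal_le_ofReal_iff (mul_nonneg hc (chartNorm_nonneg _ _))] at this

end ChartComparison

end LocalTransport

end

/-! ### Local smoothing of Lipschitz functions -/

noncomputable section

namespace LocalTransport

open Filter Topology Set

section Smoothing

open scoped Convolution

variable {E : Type*} [NormedAddCommGroup E] [InnerProductSpace ℝ E] [FiniteDimensional ℝ E]

/-- Mollification of a Lipschitz function keeps a translation invariant Lipschitz bound. -/
theorem exists_contDiff_approx {F : E → ℝ} {K : ℝ≥0} (hF : LipschitzWith K F) {N : E → ℝ}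
    {x₀ : E} {r : ℝ} (hr : 0 < r)
    (hN : ∀ a ∈ Metric.ball x₀ r, ∀ b ∈ Metric.ball x₀ r, |F a - F b| ≤ N (a - b))
    (hsmul : ∀ (t : ℝ) w, N (t • w) = |t| * N w) {ε : ℝ} (hε : 0 < ε) :
    ∃ G : E → ℝ, ContDiff ℝ ∞ G ∧ (∀ a, |G a - F a| ≤ ε) ∧
      ∀ a ∈ Metric.ball x₀ (r / 2), ∀ w, |fderiv ℝ G a w| ≤ N w := by
  let _ : MeasurableSpace E := borel E
  have : BorelSpace E := ⟨rfl⟩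
  -- The bound r/2 keeps translates of the half ball inside the ball; ε/(K+1) makes the error Kδ at
  -- most ε.
  set δ : ℝ := min (r / 2) (ε / (K + 1)) with hδ
  have hδ0 : 0 < δ := lt_min (by positivity) (by positivity)
  let φ : ContDiffBump (0 : E) := ⟨δ / 2, δ, by positivity, by linarith⟩
  have hφr : φ.rOut = δ := rfl
  set G : E → ℝ := (φ.normed volume ⋆[ContinuousLinearMap.lsmul ℝ ℝ, volume] F) with hG
  have hGd : ContDiff ℝ ∞ G := φ.hasCompactSupport_normed.contDiff_convolution_left
    (ContinuousLinearMap.lsmul ℝ ℝ) φ.contDiff_normed hF.continuous.locallyIntegrable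
  have hint : ∀ a, Integrable (fun t => φ.normed volume t * F (a - t)) := fun a =>
    (φ.contDiff_normed (n := 0).continuous.mul
      (hF.continuous.comp (continuous_const.sub continuous_id))).integrable_of_hasCompactSupport
      φ.hasCompactSupport_normed.mul_right
  have hGval : ∀ a, G a = ∫ t, φ.normed volume t * F (a - t) := fun a => rfl
  have hlip : ∀ a ∈ Metric.ball x₀ (r / 2), ∀ b ∈ Metric.ball x₀ (r / 2),
      |G a - G b| ≤ N (a - b) := by
    intro a ha b hb
    rw [hGval, hGval, ← integral_sub (hint a) (hint b)]
    calc |∫ t, (φ.normed volume t * F (a - t) - φ.normed volume t * F (b - t))|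
        ≤ ∫ t, φ.normed volume t * N (a - b) := by
          rw [← Real.norm_eq_abs]
          refine norm_integral_le_of_norm_le ((φ.integrable_normed (μ := volume)).mul_const _)
            (Eventually.of_forall fun t => ?_)
          rw [← mul_sub, norm_mul, Real.norm_of_nonneg (φ.nonneg_normed t), Real.norm_eq_abs]
          by_cases ht : t ∈ Metric.ball (0 : E) δ
          · refine mul_le_mul_of_nonneg_left ?_ (φ.nonneg_normed t)
            have hmem : ∀ c ∈ Metric.ball x₀ (r / 2), c - t ∈ Metric.ball x₀ r := by
              intro c hc
              rw [mem_ball_iff_norm] at hc ht ⊢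
              have e1 : c - t - x₀ = (c - x₀) - (t - 0) := by abel
              rw [e1]
              have := norm_sub_le (c - x₀) (t - 0)
              have h2 : δ ≤ r / 2 := min_le_left _ _
              linarith
            have := hN _ (hmem a ha) _ (hmem b hb)
            rwa [sub_sub_sub_cancel_right] at this
          · have : φ.normed volume t = 0 := by
              by_contra h
              have h1 : t ∈ Function.support (φ.normed volume) := h
              rw [φ.support_normed_eq, hφr] at h1
              exact ht h1
            simp [this]
      _ = N (a - b) := by rw [integral_mul_const, φ.integral_normed, one_mul]
  refine ⟨G, hGd, fun a => ?_, fun a ha w => ?_⟩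
  · rw [← Real.dist_eq]
    refine φ.dist_normed_convolution_le hF.continuous.aestronglyMeasurable fun x hx => ?_
    rw [hφr, Metric.mem_ball] at hx
    calc dist (F x) (F a) ≤ K * dist x a := hF.dist_le_mul x a
      _ ≤ K * δ := by gcongr
      _ ≤ K * (ε / (K + 1)) := by gcongr; exact min_le_right _ _
      _ ≤ ε := by
        rw [mul_div_assoc', div_le_iff₀ (by positivity)]
        nlinarith [K.2]
  · have hd : HasDerivAt (fun t : ℝ => G (a + t • w)) (fderiv ℝ G a w) 0 := by
      have h1 : HasFDerivAt G (fderiv ℝ G a) (a + (0 : ℝ) • w) := by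
        rw [zero_smul, add_zero]
        exact (hGd.differentiable (by simp) a).hasFDerivAt
      have h2 : HasDerivAt (fun t : ℝ => a + t • w) ((1 : ℝ) • w) 0 :=
        ((hasDerivAt_id (0 : ℝ)).smul_const w).const_add a
      have h3 := h1.comp_hasDerivAt 0 h2
      rw [one_smul] at h3
      exact h3
    have hcont : ContinuousAt (fun t : ℝ => a + t • w) 0 := by fun_prop
    have hev : ∀ᶠ t : ℝ in 𝓝 0, a + t • w ∈ Metric.ball x₀ (r / 2) :=
      hcont.eventually_mem (by simpa using Metric.isOpen_ball.mem_nhds ha)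
    -- N is only assumed homogeneous, so its sign is read off from the increment bound for small t.
    have hNw : 0 ≤ N w := by
      have h1 := hN a (Metric.ball_subset_ball (by linarith) ha)
      have h2 : ∀ᶠ t : ℝ in 𝓝[>] 0, 0 ≤ |t| * N w := by
        filter_upwards [hev.filter_mono nhdsWithin_le_nhds] with t ht
        rw [← hsmul]
        have := hlip _ ht a ha
        rw [add_sub_cancel_left] at this
        exact (abs_nonneg _).trans this
      obtain ⟨t, ht, ht0⟩ := (h2.and self_mem_nhdsWithin).exists
      exact nonneg_of_mul_nonneg_right ht (abs_pos.2 (ne_of_gt ht0))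
    have := hd.le_of_lip' hNw (by
      filter_upwards [hev] with t ht
      have h3 := hlip _ ht a ha
      rw [add_sub_cancel_left, hsmul] at h3
      simpa [mul_comm] using h3)
    simpa using this

end Smoothing

section LocalSmoothing

variable {m : ℕ} {M : Type*} [MetricSpace M]
    [ChartedSpace (EuclideanSpace ℝ (Fin m)) M] [IsManifold (𝓡 m) ∞ M]
    [RiemannianBundle (fun x : M => TangentSpace (𝓡 m) x)]
    [IsContMDiffRiemannianBundle (𝓡 m) ∞ (EuclideanSpace ℝ (Fin m))
      (fun x : M => TangentSpace (𝓡 m) x)]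
    [IsRiemannianManifold (𝓡 m) M]

/-- One factor c bounds f in the chart by the frozen norm, the other returns from that norm to the
Riemannian one. U depends neither on f nor on ε, so a partition of unity can be fixed before the
precision. -/
theorem exists_local_smoothing (p : M) {c : ℝ} (hc : 1 < c) :
    ∃ U : Set M, IsOpen U ∧ p ∈ U ∧ ∀ f : M → ℝ, LipschitzWith 1 f → ∀ ε > 0,
      ∃ g : M → ℝ, ContMDiffOn (𝓡 m) 𝓘(ℝ, ℝ) ∞ g U ∧
        ∀ y ∈ U, |g y - f y| ≤ ε ∧ ‖differential (m := m) g y‖ ≤ c ^ 2 := by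
  obtain ⟨r, hr, htarget, hcomp⟩ := exists_chart_ball (m := m) p hc
  set e := extChartAt (𝓡 m) p with he
  have hc0 : 0 ≤ c := by linarith
  refine ⟨e.source ∩ e ⁻¹' Metric.ball (e p) (r / 2),
    (continuousOn_extChartAt p).isOpen_inter_preimage (isOpen_extChartAt_source p)
      Metric.isOpen_ball, ⟨mem_extChartAt_source p, Metric.mem_ball_self (by positivity)⟩, ?_⟩
  intro f hf ε hε
  obtain ⟨C, hC⟩ := exists_chartNorm_le (m := m) p
  have hFN : ∀ a ∈ Metric.ball (e p) r, ∀ b ∈ Metric.ball (e p) r,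
      |f (e.symm a) - f (e.symm b)| ≤ c * chartNorm (m := m) p (a - b) := by
    intro a ha b hb
    have h1 := dist_extChartAt_symm_le hc0 htarget (fun a ha v => (hcomp a ha v).1) hb ha
    have h2 := hf.dist_le_mul (e.symm a) (e.symm b)
    rw [NNReal.coe_one, one_mul, Real.dist_eq, dist_comm] at h2
    exact h2.trans h1
  have hLip : LipschitzOnWith (c.toNNReal * C) (fun a => f (e.symm a)) (Metric.ball (e p) r) := by
    refine LipschitzOnWith.of_dist_le_mul fun a ha b hb => ?_
    rw [Real.dist_eq, NNReal.coe_mul, Real.coe_toNNReal c hc0, mul_assoc, dist_eq_norm]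
    exact (hFN a ha b hb).trans (mul_le_mul_of_nonneg_left (hC _) hc0)
  -- Mollification needs a function on the whole vector space; F agrees with f in the ball that
  -- matters.
  obtain ⟨F, hF, hFeq⟩ := hLip.extend_real
  obtain ⟨G, hG, hGF, hGd⟩ := exists_contDiff_approx hF (N := fun w => c * chartNorm (m := m) p w)
    hr (fun a ha b hb => by rw [← hFeq ha, ← hFeq hb]; exact hFN a ha b hb)
    (fun t w => by rw [chartNorm_smul]; ring) hε
  refine ⟨fun y => G (e y), ?_, ?_⟩
  · refine (hG.contMDiff.comp_contMDiffOn (contMDiffOn_extChartAt (I := 𝓡 m) (x := p))).mono ?_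
    rw [← extChartAt_source (𝓡 m)]
    exact inter_subset_left
  · rintro y ⟨hy, hyb⟩
    have hyb' : e y ∈ Metric.ball (e p) r := Metric.ball_subset_ball (by linarith) hyb
    have hinv : e.symm (e y) = y := e.left_inv hy
    refine ⟨?_, ?_⟩
    · have := hGF (e y)
      rw [← hFeq hyb'] at this
      simpa only [hinv] using this
    · refine ContinuousLinearMap.opNorm_le_bound _ (by positivity) fun v => ?_
      rw [differential_comp_extChartAt hG (by rwa [← extChartAt_source (𝓡 m)]), Real.norm_eq_abs]
      have h1 := hcomp (e y) hyb'
      rw [hinv] at h1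
      calc _ ≤ c * chartNorm (m := m) p (chartDifferential p y v) := hGd _ hyb _
        _ ≤ c * (c * ‖v‖) := mul_le_mul_of_nonneg_left (h1 v).2 hc0
        _ = _ := by ring

end LocalSmoothing

end LocalTransport

end

/-! ### Differentials of functions on M -/

noncomputable section

namespace LocalTransport

open Filter Topology Set

section Differential

variable {m : ℕ} {M : Type*} [TopologicalSpace M]
    [ChartedSpace (EuclideanSpace ℝ (Fin m)) M] {f g : M → ℝ} {x : M}

theorem differential_add (hf : MDifferentiableAt (𝓡 m) 𝓘(ℝ, ℝ) f x)
    (hg : MDifferentiableAt (𝓡 m) 𝓘(ℝ, ℝ) g x) :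
    differential (m := m) (f + g) x = differential f x + differential g x :=
  mvfderiv_add hf hg

theorem differential_mul (hf : MDifferentiableAt (𝓡 m) 𝓘(ℝ, ℝ) f x)
    (hg : MDifferentiableAt (𝓡 m) 𝓘(ℝ, ℝ) g x) :
    differential (m := m) (f * g) x = f x • differential g x + g x • differential f x :=
  mvfderiv_mul hf hg

theorem differential_const (c : ℝ) : differential (m := m) (fun _ : M => c) x = 0 :=
  mfderiv_const

theorem differential_comp {φ : ℝ → ℝ} (hφ : DifferentiableAt ℝ φ (f x))
    (hf : MDifferentiableAt (𝓡 m) 𝓘(ℝ, ℝ) f x) :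
    differential (m := m) (φ ∘ f) x = deriv φ (f x) • differential f x := by
  have h := mfderiv_comp x hφ.mdifferentiableAt hf
  refine ContinuousLinearMap.ext fun v => ?_
  have h1 : differential (m := m) (φ ∘ f) x v
      = mfderiv 𝓘(ℝ, ℝ) 𝓘(ℝ, ℝ) φ (f x) (mfderiv (𝓡 m) 𝓘(ℝ, ℝ) f x v) :=
    congrArg (fun L => L v) h
  rw [h1, mfderiv_eq_fderiv]
  have h2 : ∀ w : ℝ, fderiv ℝ φ (f x) w = deriv φ (f x) * w := fun w => by
    rw [fderiv_eq_smul_deriv, smul_eq_mul, mul_comm]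
  exact h2 _

theorem differential_sum {ι : Type*} (s : Finset ι) {F : ι → M → ℝ}
    (hF : ∀ i ∈ s, MDifferentiableAt (𝓡 m) 𝓘(ℝ, ℝ) (F i) x) :
    differential (m := m) (fun y => ∑ i ∈ s, F i y) x = ∑ i ∈ s, differential (F i) x := by
  classical
  have key : MDifferentiableAt (𝓡 m) 𝓘(ℝ, ℝ) (fun y => ∑ i ∈ s, F i y) x ∧
      differential (m := m) (fun y => ∑ i ∈ s, F i y) x = ∑ i ∈ s, differential (F i) x := by
    induction s using Finset.induction_on with
    | empty => exact ⟨by simpa using mdifferentiableAt_const, by simpa using differential_const 0⟩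
    | insert a s ha ih =>
      obtain ⟨h1, h2⟩ := ih fun i hi => hF i (Finset.mem_insert_of_mem hi)
      have h3 := hF a (Finset.mem_insert_self a s)
      have e : (fun y => ∑ i ∈ insert a s, F i y) = F a + fun y => ∑ i ∈ s, F i y := by
        ext y; simp [Finset.sum_insert ha]
      rw [e, differential_add h3 h1, h2, Finset.sum_insert ha]
      exact ⟨h3.add h1, rfl⟩
  exact key.2

theorem differential_congr (h : f =ᶠ[𝓝 x] g) :
    differential (m := m) f x = differential g x := by
  unfold differential
  exact h.mfderiv_eq

end Differential

/-! ### Global smoothing and smooth truncated distances -/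

section Gluing

variable {m : ℕ} {M : Type*} [MetricSpace M] [CompleteSpace M] [SecondCountableTopology M]
    [ChartedSpace (EuclideanSpace ℝ (Fin m)) M] [IsManifold (𝓡 m) ∞ M]
    [RiemannianBundle (fun x : M => TangentSpace (𝓡 m) x)]
    [IsContMDiffRiemannianBundle (𝓡 m) ∞ (EuclideanSpace ℝ (Fin m))
      (fun x : M => TangentSpace (𝓡 m) x)]
    [IsRiemannianManifold (𝓡 m) M]

/-- Compactly supported Lipschitz functions can be smoothed with almost no loss in the Lipschitz
constant. -/
theorem exists_smooth_approx
    (hbd : ∀ χ : M → ℝ, ContMDiff (𝓡 m) 𝓘(ℝ, ℝ) ∞ χ → HasCompactSupport χ →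
      ∃ C : ℝ, ∀ y, ‖differential (m := m) χ y‖ ≤ C)
    {f : M → ℝ} (hf : LipschitzWith 1 f) (hfs : HasCompactSupport f) {ε : ℝ} (hε : 0 < ε) :
    ∃ g : M → ℝ, ContMDiff (𝓡 m) 𝓘(ℝ, ℝ) ∞ g ∧ HasCompactSupport g ∧ (∀ y, |g y - f y| ≤ ε) ∧
      ∀ y, ‖differential (m := m) g y‖ ≤ 1 + ε := by
  have : LocallyCompactSpace M := ChartedSpace.locallyCompactSpace (EuclideanSpace ℝ (Fin m)) M
  set c := √(1 + ε / 2) with hcdef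
  have hc2 : c ^ 2 = 1 + ε / 2 := Real.sq_sqrt (by positivity)
  have hc : 1 < c := by rw [hcdef]; exact Real.lt_sqrt_of_sq_lt (by linarith)
  choose U hUo hUp hU using fun p : M => exists_local_smoothing (m := m) p hc
  -- Unit balls make the partition functions compactly supported, so their gradients are bounded by
  -- `hbd`.
  obtain ⟨t, ht⟩ := hfs.isCompact.elim_finite_subcover (fun p => U p ∩ Metric.ball p 1)
    (fun p => (hUo p).inter Metric.isOpen_ball)
    (fun p _ => mem_iUnion.2 ⟨p, hUp p, Metric.mem_ball_self one_pos⟩)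
  obtain ⟨χ, hχ⟩ := SmoothPartitionOfUnity.exists_isSubordinate (𝓡 m) hfs.isCompact.isClosed
    (fun p : t => U p ∩ Metric.ball (p : M) 1) (fun p => (hUo p).inter Metric.isOpen_ball)
    (fun y hy => by simpa using ht hy)
  have hχc : ∀ i, HasCompactSupport (χ i) := fun i =>
    (isCompact_closedBall_of_complete m (i : M) 1).of_isClosed_subset (isClosed_tsupport _)
      ((hχ i).trans (inter_subset_right.trans Metric.ball_subset_closedBall))
  choose C hC using fun i => hbd (χ i) (χ i).contMDiff (hχc i)
  have hC0 : ∀ i, 0 ≤ C i := fun i => (ContinuousLinearMap.opNorm_nonneg _).trans (hC i i)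
  set S := ∑ i, C i with hS
  have hS0 : 0 ≤ S := Finset.sum_nonneg fun i _ => hC0 i
  -- The local precision is chosen after the partition, to beat the total gradient S of the χ_i.
  set δ := ε / (2 * (S + 1)) with hδ
  have hδ0 : 0 < δ := by positivity
  have hδS : δ * S ≤ ε / 2 := by
    rw [hδ, div_mul_eq_mul_div, div_le_iff₀ (by positivity)]
    nlinarith
  have hδε : δ ≤ ε := by
    rw [hδ, div_le_iff₀ (by positivity)]
    nlinarith
  choose g hgC hg using fun i : t => hU (i : M) f hf δ hδ0
  have hsum1 : ∀ y ∈ tsupport f, ∑ i, χ i y = 1 := fun y hy => by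
    rw [← finsum_eq_sum_of_fintype]; exact χ.sum_eq_one hy
  have hsumle : ∀ y, ∑ i, χ i y ≤ 1 := fun y => by
    rw [← finsum_eq_sum_of_fintype]; exact χ.sum_le_one y
  have hGi : ∀ i, ContMDiff (𝓡 m) 𝓘(ℝ, ℝ) ∞ (⇑(χ i) * g i) := fun i =>
    χ.contMDiff_smul fun y hy => (hgC i).contMDiffAt ((hUo i).mem_nhds (hχ i hy).1)
  have hterm : ∀ i y, |χ i y * g i y - f y * χ i y| ≤ χ i y * δ := by
    intro i y
    by_cases hy : y ∈ tsupport (χ i)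
    · rw [show χ i y * g i y - f y * χ i y = χ i y * (g i y - f y) by ring, abs_mul,
        abs_of_nonneg (χ.nonneg i y)]
      exact mul_le_mul_of_nonneg_left (hg i y (hχ i hy).1).1 (χ.nonneg i y)
    · simp [image_eq_zero_of_notMem_tsupport hy]
  -- Subtracting f dχ_i leaves χ_i dg_i + (g_i − f)dχ_i, which is small in its second part. The
  -- subtraction is free because Σ f dχ_i = 0: near a point where f ≠ 0 the χ_i sum to 1.
  have hdterm : ∀ i y,
      ‖differential (m := m) (⇑(χ i) * g i) y - f y • differential (m := m) (χ i) y‖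
      ≤ χ i y * c ^ 2 + δ * C i := by
    intro i y
    by_cases hy : y ∈ tsupport (χ i)
    · have hyU : y ∈ U i := (hχ i hy).1
      have hd : MDifferentiableAt (𝓡 m) 𝓘(ℝ, ℝ) (g i) y :=
        ((hgC i).contMDiffAt ((hUo i).mem_nhds hyU)).mdifferentiableAt (by simp)
      have hd' : MDifferentiableAt (𝓡 m) 𝓘(ℝ, ℝ) (χ i) y :=
        ((χ i).contMDiff.contMDiffAt).mdifferentiableAt (by simp)
      refine ContinuousLinearMap.opNorm_le_bound _
        (add_nonneg (mul_nonneg (χ.nonneg i y) (sq_nonneg _)) (mul_nonneg hδ0.le (hC0 i)))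
        fun v => ?_
      have e1 : (differential (m := m) (⇑(χ i) * g i) y - f y • differential (m := m) (χ i) y) v
          = χ i y * differential (m := m) (g i) y v
            + (g i y - f y) * differential (m := m) (χ i) y v := by
        rw [differential_mul hd' hd]
        simp only [sub_apply, add_apply,
          smul_apply, smul_eq_mul]
        ring
      have e2 := ContinuousLinearMap.le_opNorm (differential (m := m) (g i) y) v
      have e3 := ContinuousLinearMap.le_opNorm (differential (m := m) (χ i) y) v
      have e4 := e2.trans (mul_le_mul_of_nonneg_right (hg i y hyU).2 (norm_nonneg v))
      have e5 := e3.trans (mul_le_mul_of_nonneg_right (hC i y) (norm_nonneg v))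
      rw [e1]
      calc _ ≤ χ i y * (c ^ 2 * ‖v‖) + δ * (C i * ‖v‖) := by
            refine (norm_add_le _ _).trans (add_le_add ?_ ?_)
            · rw [norm_mul, Real.norm_of_nonneg (χ.nonneg i y)]
              exact mul_le_mul_of_nonneg_left e4 (χ.nonneg i y)
            · rw [norm_mul]
              exact mul_le_mul (hg i y hyU).1 e5 (norm_nonneg _) hδ0.le
        _ = _ := by ring
    · have h0 : (χ i : M → ℝ) =ᶠ[𝓝 y] fun _ => (0 : ℝ) := notMem_tsupport_iff_eventuallyEq.1 hy
      have h1 : (⇑(χ i) * g i) =ᶠ[𝓝 y] fun _ => (0 : ℝ) := by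
        filter_upwards [h0] with z hz
        simp [hz]
      rw [differential_congr h0, differential_congr h1, differential_const, smul_zero, sub_zero]
      refine (ContinuousLinearMap.opNorm_zero).le.trans ?_
      exact add_nonneg (mul_nonneg (χ.nonneg i y) (sq_nonneg _)) (mul_nonneg hδ0.le (hC0 i))
  have hzero : ∀ y, f y • ∑ i, differential (m := m) (χ i) y = 0 := by
    intro y
    by_cases hy : f y = 0
    · rw [hy, zero_smul]
    · have hne : ∀ᶠ z in 𝓝 y, f z ≠ 0 := hf.continuous.continuousAt.eventually_ne hy
      have h1 : (fun z => ∑ i, χ i z) =ᶠ[𝓝 y] fun _ => (1 : ℝ) := by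
        filter_upwards [hne] with z hz
        exact hsum1 z (subset_tsupport f hz)
      rw [← differential_sum Finset.univ
        (fun i _ => ((χ i).contMDiff.contMDiffAt).mdifferentiableAt (by simp)),
        differential_congr h1, differential_const, smul_zero]
  refine ⟨fun y => ∑ i, (⇑(χ i) * g i) y, ?_, ?_, ?_, ?_⟩
  · exact contMDiff_finsetSum fun i _ => hGi i
  · refine (isCompact_iUnion fun i => hχc i).of_isClosed_subset (isClosed_tsupport _)
      (closure_minimal ?_ (isClosed_iUnion_of_finite fun i => isClosed_tsupport _))
    intro y hy
    by_contra hcon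
    refine hy (Finset.sum_eq_zero fun i _ => ?_)
    have : y ∉ tsupport (χ i) := fun h => hcon (mem_iUnion.2 ⟨i, h⟩)
    simp [image_eq_zero_of_notMem_tsupport this]
  · intro y
    have e1 : f y = ∑ i, f y * χ i y := by
      by_cases hy : f y = 0
      · simp [hy]
      · rw [← Finset.mul_sum, hsum1 y (subset_tsupport f hy), mul_one]
    rw [show ∑ i, (⇑(χ i) * g i) y - f y = ∑ i, (χ i y * g i y - f y * χ i y) by
      rw [Finset.sum_sub_distrib, ← e1]; rfl]
    calc _ ≤ ∑ i, χ i y * δ :=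
          (Finset.abs_sum_le_sum_abs _ _).trans (Finset.sum_le_sum fun i _ => hterm i y)
      _ = (∑ i, χ i y) * δ := (Finset.sum_mul _ _ _).symm
      _ ≤ 1 * ε := mul_le_mul (hsumle y) hδε hδ0.le zero_le_one
      _ = ε := one_mul _
  · intro y
    rw [differential_sum Finset.univ
      (fun i _ => ((hGi i).contMDiffAt).mdifferentiableAt (by simp))]
    have e1 : ∑ i, differential (m := m) (⇑(χ i) * g i) y
        = ∑ i, (differential (m := m) (⇑(χ i) * g i) y - f y • differential (m := m) (χ i) y) := by
      rw [Finset.sum_sub_distrib, ← Finset.smul_sum, hzero, sub_zero]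
    refine ContinuousLinearMap.opNorm_le_bound _ (by positivity) fun v => ?_
    rw [e1]
    calc _ = ‖∑ i, (differential (m := m) (⇑(χ i) * g i) y
            - f y • differential (m := m) (χ i) y) v‖ := by
          rw [sum_apply]
      _ ≤ ∑ i, (χ i y * c ^ 2 + δ * C i) * ‖v‖ :=
          (norm_sum_le _ _).trans (Finset.sum_le_sum fun i _ =>
            (ContinuousLinearMap.le_opNorm _ v).trans
              (mul_le_mul_of_nonneg_right (hdterm i y) (norm_nonneg v)))
      _ = ((∑ i, χ i y) * c ^ 2 + δ * S) * ‖v‖ := by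
          rw [← Finset.sum_mul, Finset.sum_add_distrib, ← Finset.sum_mul, ← Finset.mul_sum]
      _ ≤ (1 + ε) * ‖v‖ := by
          refine mul_le_mul_of_nonneg_right ?_ (norm_nonneg v)
          have := mul_le_mul_of_nonneg_right (hsumle y) (sq_nonneg c)
          linarith

/-- A smooth function with gradient at most one that is close to the truncated distance from a
point; it is constant outside a compact set. -/
theorem exists_smooth_dist
    (hbd : ∀ χ : M → ℝ, ContMDiff (𝓡 m) 𝓘(ℝ, ℝ) ∞ χ → HasCompactSupport χ →
      ∃ C : ℝ, ∀ y, ‖differential (m := m) χ y‖ ≤ C)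
    (p : M) {R η : ℝ} (hR : 0 < R) (hη : 0 < η) :
    ∃ g : M → ℝ, ContMDiff (𝓡 m) 𝓘(ℝ, ℝ) ∞ g ∧ HasCompactSupport g ∧
      (∀ y, |g y + R - min (dist y p) R| ≤ η) ∧ ∀ y, ‖differential (m := m) g y‖ ≤ 1 := by
  set f : M → ℝ := fun y => min (dist y p) R - R with hf
  have hfL : LipschitzWith 1 f := by
    refine LipschitzWith.of_dist_le_mul fun a b => ?_
    have h1 : LipschitzWith 1 fun y : M => dist y p := LipschitzWith.dist_left p
    have := (h1.min_const R).dist_le_mul a b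
    simpa [hf, Real.dist_eq] using this
  have hfs : HasCompactSupport f := by
    refine HasCompactSupport.intro (isCompact_closedBall_of_complete m p R) fun y hy => ?_
    rw [Metric.mem_closedBall, not_le] at hy
    simp [hf, min_eq_right hy.le]
  have hfR : ∀ y, |f y| ≤ R := fun y => by
    rw [abs_le]
    exact ⟨by simp only [hf]; linarith [le_min (dist_nonneg (x := y) (y := p)) hR.le],
      by simp only [hf]; linarith [min_le_right (dist y p) R]⟩
  -- Dividing by 1 + ε restores gradient at most one. It costs ε|f| ≤ εR, for a total of ε(R+1) = η.
  set ε := η / (R + 1) with hε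
  have hε0 : 0 < ε := by positivity
  obtain ⟨g, hg, hgs, hgf, hgd⟩ := exists_smooth_approx hbd hfL hfs hε0
  have h1ε : 0 < 1 + ε := by linarith
  refine ⟨fun y => (1 + ε)⁻¹ * g y, contMDiff_const.mul hg, hgs.mul_left, fun y => ?_, fun y => ?_⟩
  · have e1 : (1 + ε)⁻¹ * g y + R - min (dist y p) R
        = (1 + ε)⁻¹ * ((g y - f y) - ε * f y) := by
      simp only [hf]; field_simp; ring
    rw [e1, abs_mul, abs_of_pos (inv_pos.2 h1ε), inv_mul_le_iff₀ h1ε]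
    have e2 : |g y - f y - ε * f y| ≤ ε + ε * R := by
      refine (abs_sub _ _).trans (add_le_add (hgf y) ?_)
      rw [abs_mul, abs_of_pos hε0]
      exact mul_le_mul_of_nonneg_left (hfR y) hε0.le
    have e3 : ε * (R + 1) = η := by rw [hε]; field_simp
    nlinarith
  · have hd : MDifferentiableAt (𝓡 m) 𝓘(ℝ, ℝ) g y := hg.contMDiffAt.mdifferentiableAt (by simp)
    have e1 : differential (m := m) (fun y => (1 + ε)⁻¹ * g y) y
        = (1 + ε)⁻¹ • differential (m := m) g y := by
      have := differential_comp (m := m) (φ := fun z => (1 + ε)⁻¹ * z) (f := g) (x := y)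
        (by fun_prop) hd
      rw [deriv_const_mul_field, deriv_id'', mul_one] at this
      exact this
    rw [e1]
    refine ContinuousLinearMap.opNorm_le_bound _ zero_le_one fun v => ?_
    rw [smul_apply, norm_smul, Real.norm_of_nonneg (inv_pos.2 h1ε).le,
      inv_mul_le_iff₀ h1ε]
    have := (ContinuousLinearMap.le_opNorm _ v).trans
      (mul_le_mul_of_nonneg_right (hgd y) (norm_nonneg v))
    simpa using this

end Gluing

end LocalTransport

end

/-! ### Soft-minimum subsolutions of Hamilton-Jacobi -/

noncomputable section

namespace LocalTransport

open Filter Topology Set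

theorem HasUniformDerivWithinAt.sum {M ι : Type*} (t : Finset ι) {F : ι → ℝ → M → ℝ}
    {F' : ι → M → ℝ} {S : Set ℝ} {s : ℝ}
    (h : ∀ i ∈ t, HasUniformDerivWithinAt (F i) (F' i) S s) :
    HasUniformDerivWithinAt (fun r x => ∑ i ∈ t, F i r x) (fun x => ∑ i ∈ t, F' i x) S s := by
  have := Asymptotics.IsLittleO.sum h
  refine this.congr_left fun p => ?_
  rw [Finset.sum_apply]
  simp only [Finset.sum_sub_distrib, Finset.mul_sum]

section Subsolution

variable {m : ℕ} {M : Type*} [TopologicalSpace M] [MeasurableSpace M]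
    [ChartedSpace (EuclideanSpace ℝ (Fin m)) M]
    [RiemannianBundle (fun x : M => TangentSpace (𝓡 m) x)]
    {P : ℝ≥0 → Kernel M M} {A : Subalgebra ℝ (M → ℝ)}

/-- Jensen for the square. The gradient of a soft minimum is the average of the gradients under the
Gibbs weights p_i, so averaging preserves the subsolution inequality. -/
theorem sq_norm_sum_smul_le {V ι : Type*} [SeminormedAddCommGroup V] [NormedSpace ℝ V]
    (t : Finset ι) {p a : ι → ℝ} {v : ι → V} (hp : ∀ i ∈ t, 0 ≤ p i) (hp1 : ∑ i ∈ t, p i = 1)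
    (hv : ∀ i ∈ t, ‖v i‖ ≤ 1) : ‖∑ i ∈ t, (p i * a i) • v i‖ ^ 2 ≤ ∑ i ∈ t, p i * a i ^ 2 := by
  have h1 : ‖∑ i ∈ t, (p i * a i) • v i‖ ≤ ∑ i ∈ t, p i * |a i| := by
    refine (norm_sum_le _ _).trans (Finset.sum_le_sum fun i hi => ?_)
    rw [norm_smul, norm_mul, Real.norm_of_nonneg (hp i hi), Real.norm_eq_abs]
    exact mul_le_of_le_one_right (mul_nonneg (hp i hi) (abs_nonneg _)) (hv i hi)
  have h2 := (even_two.convexOn_pow (𝕜 := ℝ)).map_sum_le (t := t) (w := p) (p := fun i => |a i|)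
    hp hp1 (fun i _ => mem_univ _)
  simp only [smul_eq_mul, sq_abs] at h2
  exact (pow_le_pow_left₀ (norm_nonneg _) h1 2).trans h2

/-- The soft minimum of the Hopf–Lax functions `b i + ρ i ^ 2 / (2 (θ + s₀))` is a smooth
subsolution of the Hamilton–Jacobi equation. -/
theorem exists_softmin_subsolution (hA : IsDiffusionAlgebra P A)
    (hsm : ∀ f ∈ A, ContMDiff (𝓡 m) 𝓘(ℝ, ℝ) ∞ f)
    (hΓ : ∀ f ∈ A, ∀ y, carreDuChamp P f f y = ‖differential (m := m) f y‖ ^ 2)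
    {ι : Type*} [Fintype ι] [Nonempty ι] {ρ : ι → M → ℝ} (hρ : ∀ i, ρ i ∈ A)
    (hρd : ∀ i y, ‖differential (m := m) (ρ i) y‖ ≤ 1) (b : ι → ℝ) {κ s₀ : ℝ} (hκ : 0 < κ)
    (hs₀ : 0 < s₀) :
    ∃ w w' : ℝ → M → ℝ, (∀ θ ∈ Icc (0 : ℝ) 1, w θ ∈ A) ∧ (∀ θ ∈ Icc (0 : ℝ) 1, w' θ ∈ A) ∧
      (∀ θ ∈ Icc (0 : ℝ) 1, HasUniformDerivWithinAt w (w' θ) (Icc 0 1) θ) ∧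
      (∀ θ ∈ Icc (0 : ℝ) 1, ∀ y, w' θ y + 1 / 2 * carreDuChamp P (w θ) (w θ) y ≤ 0) ∧
      ∀ θ ∈ Icc (0 : ℝ) 1, ∀ y,
        w θ y = -κ * Real.log (∑ i, Real.exp (-(b i + ρ i y ^ 2 / (2 * (θ + s₀))) / κ)) := by
  choose C hC using fun i => hA.bounded _ (hρ i)
  have hpos : ∀ θ ∈ Icc (0 : ℝ) 1, 0 < θ + s₀ := fun θ hθ => by linarith [hθ.1]
  obtain ⟨i₀⟩ := ‹Nonempty ι›
  -- A positive lower bound for Z from a single term, uniform in θ and y; it allows a smooth ℓ to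
  -- replace the logarithm.
  set δ := Real.exp (-(b i₀ + C i₀ ^ 2 / (2 * s₀)) / κ) with hδ
  have hδ0 : 0 < δ := Real.exp_pos _
  obtain ⟨ℓ, hℓ, hℓe⟩ := exists_contDiff_eq_log (half_pos hδ0)
  have hℓd : ∀ z, δ ≤ z → deriv ℓ z = z⁻¹ := fun z hz => by
    have : ℓ =ᶠ[𝓝 z] Real.log := by
      filter_upwards [lt_mem_nhds (show δ / 2 < z by linarith)] with r hr using hℓe r hr.le
    rw [this.deriv_eq, Real.deriv_log]
  set c : ℝ → ℝ := fun θ => (2 * (θ + s₀))⁻¹ with hc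
  set e : ℝ → ι → ℝ → ℝ := fun θ i z => Real.exp (-(b i + c θ * z ^ 2) / κ) with he
  set E : ι → ℝ → M → ℝ := fun i θ y => e θ i (ρ i y) with hE
  set Z : ℝ → M → ℝ := fun θ y => ∑ i, E i θ y with hZ
  have heC : ∀ θ i, ContDiff ℝ ∞ (e θ i) := fun θ i => by
    simp only [he]; fun_prop
  have hed : ∀ θ i z, deriv (e θ i) z = -(2 * c θ * z / κ) * e θ i z := fun θ i z => by
    have h1 : HasDerivAt (fun z : ℝ => -(b i + c θ * z ^ 2) / κ) (-(2 * c θ * z / κ)) z := by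
      have := ((((hasDerivAt_pow 2 z).const_mul (c θ)).const_add (b i)).neg).div_const κ
      exact this.congr_deriv (by push_cast; ring)
    rw [he, h1.exp.deriv]; ring
  have hEA : ∀ θ i, E i θ ∈ A := fun θ i => hA.comp_mem _ (heC θ i) _ (hρ i)
  have hZA : ∀ θ, Z θ ∈ A := fun θ => by
    have : Z θ = ∑ i, E i θ := by ext y; simp [hZ]
    rw [this]; exact A.sum_mem fun i _ => hEA θ i
  have hEpos : ∀ i θ y, 0 < E i θ y := fun i θ y => Real.exp_pos _
  have hZδ : ∀ θ ∈ Icc (0 : ℝ) 1, ∀ y, δ ≤ Z θ y := fun θ hθ y => by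
    refine le_trans ?_ (Finset.single_le_sum (f := fun i => E i θ y)
      (fun i _ => (hEpos i θ y).le) (Finset.mem_univ i₀))
    refine Real.exp_le_exp.2 (div_le_div_of_nonneg_right (neg_le_neg (add_le_add_right ?_ _)) hκ.le)
    rw [div_eq_inv_mul]
    have h1 : c θ ≤ (2 * s₀)⁻¹ := inv_anti₀ (by positivity) (by linarith [hθ.1])
    have h2 : ρ i₀ y ^ 2 ≤ C i₀ ^ 2 := sq_le_sq' (by linarith [(abs_le.1 (hC i₀ y)).1])
      (abs_le.1 (hC i₀ y)).2
    exact mul_le_mul h1 h2 (sq_nonneg _) (by positivity)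
  -- The θ-derivative of E: c' = −2c², so the exponent −(b + cρ²)/κ has derivative 2c²ρ²/κ.
  set E' : ι → ℝ → M → ℝ := fun i θ y => (c θ ^ 2 * 2 / κ) * (E i θ y * ρ i y ^ 2) with hE'
  have hE'A : ∀ θ i, E' i θ ∈ A := fun θ i =>
    A.smul_mem (A.mul_mem (hEA θ i) (A.pow_mem (hρ i) 2)) (c θ ^ 2 * 2 / κ)
  have hZ'A : ∀ θ, (fun y => ∑ i, E' i θ y) ∈ A := fun θ => by
    have : (fun y => ∑ i, E' i θ y) = ∑ i, E' i θ := by ext y; simp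
    rw [this]; exact A.sum_mem fun i _ => hE'A θ i
  have hcd : ∀ θ ∈ Icc (0 : ℝ) 1, HasDerivWithinAt c (-(2 * c θ ^ 2)) (Icc 0 1) θ := by
    intro θ hθ
    have h1 : HasDerivAt (fun θ : ℝ => 2 * (θ + s₀)) 2 θ := by
      simpa using ((hasDerivAt_id θ).add_const s₀).const_mul 2
    have h2 := (h1.inv (by linarith [hpos θ hθ])).hasDerivWithinAt (s := Icc 0 1)
    exact h2.congr_deriv (by simp only [hc]; rw [inv_pow]; ring)
  have hEd : ∀ θ ∈ Icc (0 : ℝ) 1, ∀ i, HasUniformDerivWithinAt (E i) (E' i θ) (Icc 0 1) θ := by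
    intro θ hθ i
    have h1 := HasUniformDerivWithinAt.smul_const (hcd θ hθ) (hA.bounded _ (A.pow_mem (hρ i) 2))
    have h2 := h1.comp_smooth (φ := fun z => Real.exp (-(b i + z) / κ)) (by fun_prop)
      (hA.bounded _ (A.smul_mem (A.pow_mem (hρ i) 2) (c θ)))
      (hA.bounded _ (A.smul_mem (A.pow_mem (hρ i) 2) (-(2 * c θ ^ 2))))
    refine h2.congr_deriv fun y => ?_
    have h3 : ∀ z, deriv (fun z : ℝ => Real.exp (-(b i + z) / κ)) z
        = -(1 / κ) * Real.exp (-(b i + z) / κ) := fun z => by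
      have h4 : HasDerivAt (fun z : ℝ => -(b i + z) / κ) (-(1 / κ)) z := by
        have := (((hasDerivAt_id z).const_add (b i)).neg).div_const κ
        exact this.congr_deriv (by ring)
      rw [h4.exp.deriv]; ring
    rw [h3]
    simp only [hE', hE, he, Pi.pow_apply]
    ring
  have hw : ∀ θ ∈ Icc (0 : ℝ) 1, HasUniformDerivWithinAt (fun r y => -κ * ℓ (Z r y))
      (fun y => -κ * deriv ℓ (Z θ y) * ∑ i, E' i θ y) (Icc 0 1) θ := by
    intro θ hθ
    have h1 := HasUniformDerivWithinAt.sum Finset.univ fun i _ => hEd θ hθ i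
    have h2 := h1.comp_smooth (φ := fun z => -κ * ℓ z) (contDiff_const.mul hℓ)
      (hA.bounded _ (hZA θ)) (hA.bounded _ (hZ'A θ))
    refine h2.congr_deriv fun y => ?_
    rw [deriv_const_mul_field]
  refine ⟨fun r y => -κ * ℓ (Z r y), fun θ y => -κ * deriv ℓ (Z θ y) * ∑ i, E' i θ y,
    fun θ _ => hA.comp_mem (fun z => -κ * ℓ z) (contDiff_const.mul hℓ) _ (hZA θ),
    fun θ _ => A.mul_mem (hA.comp_mem (fun z => -κ * deriv ℓ z)
      (contDiff_const.mul (contDiff_infty_iff_deriv.1 hℓ).2) _ (hZA θ)) (hZ'A θ),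
    hw, fun θ hθ y => ?_, fun θ hθ y => ?_⟩
  · have hZy := hZδ θ hθ y
    have hZ0 : 0 < Z θ y := hδ0.trans_le hZy
    have hmd : ∀ i, MDifferentiableAt (𝓡 m) 𝓘(ℝ, ℝ) (E i θ) y := fun i =>
      ((hsm _ (hEA θ i)).contMDiffAt).mdifferentiableAt (by simp)
    have hdw : differential (m := m) (fun y => -κ * ℓ (Z θ y)) y
        = ∑ i, ((E i θ y / Z θ y) * (2 * c θ * ρ i y)) • differential (m := m) (ρ i) y := by
      have h1 := differential_comp (m := m) (φ := fun z => -κ * ℓ z) (f := Z θ) (x := y)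
        ((contDiff_const.mul hℓ).differentiable (by simp) _)
        (((hsm _ (hZA θ)).contMDiffAt).mdifferentiableAt (by simp))
      have h0 : differential (m := m) (Z θ) y = ∑ i, differential (m := m) (E i θ) y :=
        differential_sum _ fun i _ => hmd i
      rw [deriv_const_mul_field, hℓd _ hZy, h0, Finset.smul_sum] at h1
      refine h1.trans (Finset.sum_congr rfl fun i _ => ?_)
      have h2 := differential_comp (m := m) (φ := e θ i) (f := ρ i) (x := y)
        ((heC θ i).differentiable (by simp) _)
        (((hsm _ (hρ i)).contMDiffAt).mdifferentiableAt (by simp))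
      rw [hed] at h2
      have h3 : differential (m := m) (E i θ) y = differential (m := m) (e θ i ∘ ρ i) y := rfl
      rw [h3, h2, smul_smul]
      congr 1
      have h4 : e θ i (ρ i y) = E i θ y := rfl
      rw [h4]
      field_simp
    change -κ * deriv ℓ (Z θ y) * ∑ i, E' i θ y + 1 / 2 * carreDuChamp P
      ((fun z => -κ * ℓ z) ∘ Z θ) ((fun z => -κ * ℓ z) ∘ Z θ) y ≤ 0
    rw [hΓ _ (hA.comp_mem (fun z => -κ * ℓ z) (contDiff_const.mul hℓ) _ (hZA θ))]
    -- Each term has gradient 2cρ_i dρ_i with |dρ_i| ≤ 1, and θ-derivative −2c²ρ_i² = −½(2cρ_i)².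
    -- Averaging with weights E_i/Z gives the claim.
    have h4 : ‖differential (m := m) (fun y => -κ * ℓ (Z θ y)) y‖ ^ 2
        ≤ ∑ i, (E i θ y / Z θ y) * (2 * c θ * ρ i y) ^ 2 := by
      rw [hdw]
      exact sq_norm_sum_smul_le (V := TangentSpace (𝓡 m) y →L[ℝ] ℝ) Finset.univ
        (fun i _ => div_nonneg (hEpos i θ y).le hZ0.le)
        (by rw [← Finset.sum_div]; exact div_self hZ0.ne') (fun i _ => hρd i y)
    have h5 : -κ * deriv ℓ (Z θ y) * ∑ i, E' i θ y
        = -(1 / 2) * ∑ i, (E i θ y / Z θ y) * (2 * c θ * ρ i y) ^ 2 := by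
      rw [hℓd _ hZy, Finset.mul_sum, Finset.mul_sum]
      refine Finset.sum_congr rfl fun i _ => ?_
      simp only [hE']
      field_simp
    rw [h5]
    have h6 : ‖differential (m := m) ((fun z => -κ * ℓ z) ∘ Z θ) y‖ ^ 2
        ≤ ∑ i, (E i θ y / Z θ y) * (2 * c θ * ρ i y) ^ 2 := h4
    linarith
  · have : ∀ i, E i θ y = Real.exp (-(b i + ρ i y ^ 2 / (2 * (θ + s₀))) / κ) := fun i => by
      simp only [hE, he, hc, div_eq_inv_mul]
    simp only [hZ]
    rw [hℓe _ (by linarith [hZδ θ hθ y])]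
    simp only [this]

theorem softmin_le {ι : Type*} [Fintype ι] {κ : ℝ} (hκ : 0 < κ) (u : ι → ℝ) (i : ι) :
    -κ * Real.log (∑ i, Real.exp (-u i / κ)) ≤ u i := by
  have h1 : Real.exp (-u i / κ) ≤ ∑ i, Real.exp (-u i / κ) :=
    Finset.single_le_sum (f := fun i => Real.exp (-u i / κ)) (fun _ _ => (Real.exp_pos _).le)
      (Finset.mem_univ i)
  have h2 := Real.log_le_log (Real.exp_pos _) h1
  rw [Real.log_exp, div_le_iff₀ hκ] at h2
  linarith

/-- Among N functions the soft minimum loses at most κ log N against the minimum, an error made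
small through κ. -/
theorem le_softmin {ι : Type*} [Fintype ι] [Nonempty ι] {κ : ℝ} (hκ : 0 < κ) {u : ι → ℝ} {c : ℝ}
    (h : ∀ i, c ≤ u i) :
    c - κ * Real.log (Fintype.card ι) ≤ -κ * Real.log (∑ i, Real.exp (-u i / κ)) := by
  have hcard : (0 : ℝ) < Fintype.card ι := Nat.cast_pos.2 Fintype.card_pos
  have h1 : ∑ i, Real.exp (-u i / κ) ≤ Fintype.card ι * Real.exp (-c / κ) := by
    refine (Finset.sum_le_card_nsmul _ _ (Real.exp (-c / κ)) fun i _ => ?_).trans (by simp)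
    exact Real.exp_le_exp.2 (div_le_div_of_nonneg_right (neg_le_neg (h i)) hκ.le)
  have h2 := Real.log_le_log
    (Finset.sum_pos (fun i _ => Real.exp_pos (-u i / κ)) Finset.univ_nonempty) h1
  rw [Real.log_mul hcard.ne' (Real.exp_pos _).ne', Real.log_exp] at h2
  have h3 := mul_le_mul_of_nonneg_left h2 hκ.le
  rw [mul_add, mul_div_cancel₀ _ hκ.ne'] at h3
  linarith

end Subsolution

/-! ### Joining an admissible pair by a smooth subsolution -/

section HopfLax

variable {m : ℕ} {M : Type*} [MetricSpace M] [CompleteSpace M] [SecondCountableTopology M]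
    [MeasurableSpace M] [BorelSpace M]
    [ChartedSpace (EuclideanSpace ℝ (Fin m)) M] [IsManifold (𝓡 m) ∞ M]
    [RiemannianBundle (fun x : M => TangentSpace (𝓡 m) x)]
    [IsContMDiffRiemannianBundle (𝓡 m) ∞ (EuclideanSpace ℝ (Fin m))
      (fun x : M => TangentSpace (𝓡 m) x)]
    [IsRiemannianManifold (𝓡 m) M]
    {P : ℝ≥0 → Kernel M M} {A : Subalgebra ℝ (M → ℝ)}

set_option maxHeartbeats 600000 in
/-- A pair `(φ, ψ)` that is admissible in the Kantorovich problem can be joined, up to `ε`, by a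
smooth subsolution of the Hamilton–Jacobi equation. -/
theorem exists_subsolution (hA : IsDiffusionAlgebra P A)
    (hsm : ∀ f ∈ A, ContMDiff (𝓡 m) 𝓘(ℝ, ℝ) ∞ f)
    (htest : ∀ f : M → ℝ, ContMDiff (𝓡 m) 𝓘(ℝ, ℝ) ∞ f → HasCompactSupport f → f ∈ A)
    (hΓ : ∀ f ∈ A, ∀ y, carreDuChamp P f f y = ‖differential (m := m) f y‖ ^ 2)
    {φ ψ : M → ℝ} (hφ : φ ∈ A) (hψ : ψ ∈ A) (hφψ : ∀ x y, φ x - ψ y ≤ dist x y ^ 2 / 2)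
    (μ : Measure M) [IsProbabilityMeasure μ] {ε : ℝ} (hε : 0 < ε) :
    ∃ w w' : ℝ → M → ℝ, (∀ θ ∈ Icc (0 : ℝ) 1, w θ ∈ A) ∧ (∀ θ ∈ Icc (0 : ℝ) 1, w' θ ∈ A) ∧
      (∀ θ ∈ Icc (0 : ℝ) 1, HasUniformDerivWithinAt w (w' θ) (Icc 0 1) θ) ∧
      (∀ θ ∈ Icc (0 : ℝ) 1, ∀ y, w' θ y + 1 / 2 * carreDuChamp P (w θ) (w θ) y ≤ 0) ∧
      (∀ y, φ y - ε ≤ w 1 y) ∧ ∫ y, w 0 y ∂μ ≤ ∫ y, ψ y ∂μ + ε := by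
  -- Γ(χ) lies in `A`, hence is bounded, and it is the squared gradient.
  have hbd : ∀ χ : M → ℝ, ContMDiff (𝓡 m) 𝓘(ℝ, ℝ) ∞ χ → HasCompactSupport χ →
      ∃ C : ℝ, ∀ y, ‖differential (m := m) χ y‖ ≤ C := by
    intro χ hχ hχs
    have hχA := htest χ hχ hχs
    obtain ⟨C, hC⟩ := hA.bounded _ (hA.carreDuChamp_mem hχA hχA)
    refine ⟨C + 1, fun y => ?_⟩
    have h1 := hC y
    rw [hΓ χ hχA] at h1
    have h2 := (le_abs_self _).trans h1
    nlinarith [sq_nonneg (‖differential (m := m) χ y‖ - 1)]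
  have hψc : Continuous ψ := (hsm ψ hψ).continuous
  obtain ⟨Cφ, hCφ⟩ := hA.bounded φ hφ
  obtain ⟨Cψ, hCψ⟩ := hA.bounded ψ hψ
  obtain ⟨p₀⟩ : Nonempty M := μ.nonempty_of_neZero
  have hCφ0 : 0 ≤ Cφ := (abs_nonneg _).trans (hCφ p₀)
  have hCψ0 : 0 ≤ Cψ := (abs_nonneg _).trans (hCψ p₀)
  -- Beyond distance R the constraint φ(y) ≤ ψ(p) + R²/2 holds by boundedness alone, so truncating
  -- the distance at R loses nothing.
  set R := 1 + 2 * (Cφ + Cψ) with hR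
  have hR1 : 1 ≤ R := by linarith
  have hRR : Cφ + Cψ ≤ R ^ 2 / 2 := by nlinarith
  -- The time shift that makes the kernels smooth at θ = 0; at θ = 1 it perturbs truncated squared
  -- distances by at most s₀R² = ε/2.
  set s₀ := ε / (2 * R ^ 2) with hs₀
  have hs₀0 : 0 < s₀ := by positivity
  have hs₀R : s₀ * R ^ 2 = ε / 2 := by rw [hs₀]; field_simp
  -- A bound for w_0 − ψ on all of M, read at the single centre p₀. It is used only off a compact
  -- set of small complement, which is why w_0 is controlled in mean for μ.
  set C₂ := 2 * Cψ + (R + 1) ^ 2 / (2 * s₀) with hC₂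
  have hC₂0 : 0 < C₂ := by positivity
  obtain ⟨K, hK, hμK⟩ : ∃ K : Set M, IsCompact K ∧ μ.real Kᶜ ≤ ε / (2 * C₂) := by
    have := isTightMeasureSet_iff_exists_isCompact_measure_compl_le.1
      (isTightMeasureSet_singleton (μ := μ)) (ENNReal.ofReal (ε / (2 * C₂)))
      (ENNReal.ofReal_pos.2 (by positivity))
    obtain ⟨K, hK, h⟩ := this
    exact ⟨K, hK, ENNReal.toReal_le_of_le_ofReal (by positivity) (h μ rfl)⟩
  -- Mesh of the net on K: ρ_p is at most 2δ near its centre, and (2δ)²/(2s₀) must not exceed ε/4.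
  set δ := min 1 (s₀ * ε / 16) with hδ
  have hδ0 : 0 < δ := lt_min one_pos (by positivity)
  set η := min δ (ε / (8 * R)) with hη
  have hη0 : 0 < η := lt_min hδ0 (by positivity)
  have hδ1 : δ ≤ 1 := min_le_left _ _
  have hηδ : η ≤ δ := min_le_left _ _
  have hηR : η * R ≤ ε / 8 := by
    have : η ≤ ε / (8 * R) := min_le_right _ _
    calc η * R ≤ ε / (8 * R) * R := by gcongr
      _ = ε / 8 := by field_simp
  have hδs : δ ≤ s₀ * ε / 16 := min_le_right _ _
  obtain ⟨t, ht⟩ := hK.elim_finite_subcover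
    (fun p => Metric.ball p δ ∩ {x | ψ p < ψ x + ε / 4})
    (fun p => Metric.isOpen_ball.inter
      (isOpen_lt continuous_const (hψc.add continuous_const)))
    (fun p _ => mem_iUnion.2 ⟨p, Metric.mem_ball_self hδ0, by simp; linarith⟩)
  classical
  set T : Finset M := insert p₀ t with hT
  have : Nonempty T := ⟨⟨p₀, Finset.mem_insert_self _ _⟩⟩
  choose g hg hgs hgd hgD using fun p : T =>
    exists_smooth_dist hbd (p : M) (R := R) (η := η) (by linarith) hη0
  set ρ : T → M → ℝ := fun p y => g p y + R with hρ
  have hρA : ∀ p, ρ p ∈ A := fun p =>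
    A.add_mem (htest _ (hg p) (hgs p)) (IsDiffusionAlgebra.const_mem R)
  have hρd : ∀ p y, ‖differential (m := m) (ρ p) y‖ ≤ 1 := fun p y => by
    have h1 : differential (m := m) (ρ p) y = differential (m := m) (g p) y := by
      have := differential_add (m := m) (f := g p) (g := fun _ => R) (x := y)
        ((hg p).contMDiffAt.mdifferentiableAt (by simp)) mdifferentiableAt_const
      rw [differential_const, add_zero] at this
      exact this
    rw [h1]
    exact hgD p y
  have hρb : ∀ (p : T) (y : M), min (dist y p) R - η ≤ ρ p y ∧ ρ p y ≤ min (dist y p) R + η :=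
      fun p y => by
    have := abs_le.1 (hgd p y)
    exact ⟨by simp only [hρ]; linarith, by simp only [hρ]; linarith⟩
  obtain ⟨κ, hκ, hκN⟩ : ∃ κ > 0, κ * Real.log (Fintype.card T) ≤ ε / 4 := by
    have h0 : 0 ≤ Real.log (Fintype.card T) := Real.log_natCast_nonneg _
    refine ⟨ε / (4 * (Real.log (Fintype.card T) + 1)), by positivity, ?_⟩
    rw [div_mul_eq_mul_div, div_le_iff₀ (by positivity)]
    nlinarith
  obtain ⟨w, w', hw, hw', hd, hsub, hval⟩ := exists_softmin_subsolution hA hsm hΓ hρA hρd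
    (fun p => ψ p) hκ hs₀0
  refine ⟨w, w', hw, hw', hd, hsub, fun y => ?_, ?_⟩
  · rw [hval 1 ⟨zero_le_one, le_rfl⟩]
    refine le_trans ?_ (le_softmin hκ (c := φ y - 3 * ε / 4) fun p => ?_)
    · linarith
    have hD0 : 0 ≤ min (dist y p) R := le_min dist_nonneg (by linarith)
    have hDR : min (dist y (p : M)) R ≤ R := min_le_right _ _
    -- The lower bound at θ = 1 uses admissibility with every centre; fineness of the net matters
    -- only at θ = 0.
    have h1 : φ y ≤ ψ p + min (dist y (p : M)) R ^ 2 / 2 := by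
      rcases le_total (dist y (p : M)) R with h | h
      · rw [min_eq_left h]; linarith [hφψ y p]
      · rw [min_eq_right h]
        linarith [(abs_le.1 (hCφ y)).2, (abs_le.1 (hCψ p)).1]
    set D := min (dist y (p : M)) R
    have h2 : D ^ 2 - 2 * η * D ≤ ρ p y ^ 2 := by
      rcases le_total η D with h | h
      · have := (hρb p y).1
        nlinarith
      · nlinarith [sq_nonneg (ρ p y)]
    have h3 : D ^ 2 - 2 * (ε / 8) ≤ ρ p y ^ 2 := by
      have : η * D ≤ ε / 8 := (mul_le_mul_of_nonneg_left hDR hη0.le).trans hηR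
      linarith
    have h4 : (D ^ 2 / 2 - 3 * ε / 4) * (2 * (1 + s₀)) ≤ ρ p y ^ 2 := by
      have : s₀ * D ^ 2 ≤ ε / 2 := by
        rw [← hs₀R]
        exact mul_le_mul_of_nonneg_left (pow_le_pow_left₀ hD0 hDR 2) hs₀0.le
      nlinarith [mul_pos hs₀0 hε]
    rw [← le_div_iff₀ (by positivity)] at h4
    linarith
  · have hpt : ∀ y, w 0 y ≤ ψ y + ε / 2 + indicator Kᶜ (fun _ => C₂) y := by
      intro y
      have hle : ∀ p : T, w 0 y ≤ ψ p + ρ p y ^ 2 / (2 * s₀) := fun p => by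
        rw [hval 0 ⟨le_rfl, zero_le_one⟩]
        simp only [zero_add]
        exact softmin_le hκ (fun p : T => ψ p + ρ p y ^ 2 / (2 * s₀)) p
      by_cases hy : y ∈ K
      · obtain ⟨p, hpt, hyb, hyψ⟩ : ∃ p ∈ t, y ∈ Metric.ball p δ ∧ ψ p < ψ y + ε / 4 := by
          have := ht hy
          simp only [mem_iUnion] at this
          obtain ⟨p, hp, h1, h2⟩ := this
          exact ⟨p, hp, h1, h2⟩
        have h1 := hle ⟨p, Finset.mem_insert_of_mem hpt⟩
        have h2 := hρb ⟨p, Finset.mem_insert_of_mem hpt⟩ y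
        simp only at h1 h2
        set r := ρ ⟨p, Finset.mem_insert_of_mem hpt⟩ y
        rw [Metric.mem_ball] at hyb
        have h3 : r ≤ 2 * δ := by linarith [min_le_left (dist y p) R]
        have h4 : -(2 * δ) ≤ r := by
          linarith [le_min (dist_nonneg (x := y) (y := p)) (show 0 ≤ R by linarith)]
        have h5 : r ^ 2 / (2 * s₀) ≤ ε / 4 := by
          rw [div_le_iff₀ (by positivity)]
          have e0 : δ ^ 2 ≤ δ := by
            rw [sq]; exact mul_le_of_le_one_right hδ0.le hδ1
          calc r ^ 2 ≤ (2 * δ) ^ 2 := sq_le_sq' h4 h3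
            _ = 4 * δ ^ 2 := by ring
            _ ≤ 4 * (s₀ * ε / 16) := by linarith
            _ ≤ ε / 4 * (2 * s₀) := by linarith [mul_pos hs₀0 hε]
        rw [indicator_of_notMem (by simpa using hy)]
        linarith
      · rw [indicator_of_mem (show y ∈ Kᶜ from hy)]
        have h1 := hle ⟨p₀, Finset.mem_insert_self _ _⟩
        have h2 := hρb ⟨p₀, Finset.mem_insert_self _ _⟩ y
        simp only at h1 h2
        set r := ρ ⟨p₀, Finset.mem_insert_self _ _⟩ y
        have h3 : r ≤ R + 1 := by linarith [min_le_right (dist y p₀) R]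
        have h4 : -(R + 1) ≤ r := by
          linarith [le_min (dist_nonneg (x := y) (y := p₀)) (show 0 ≤ R by linarith)]
        have h5 : r ^ 2 / (2 * s₀) ≤ (R + 1) ^ 2 / (2 * s₀) :=
          div_le_div_of_nonneg_right (sq_le_sq' h4 h3) (by positivity)
        have h6 := (abs_le.1 (hCψ p₀)).2
        have h7 := (abs_le.1 (hCψ y)).1
        linarith
    have hiψ : Integrable ψ μ := Integrable.of_bound (hA.measurable ψ hψ).aestronglyMeasurable Cψ
      (Eventually.of_forall hCψ)
    have hw0 := hw 0 ⟨le_rfl, zero_le_one⟩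
    obtain ⟨Cw, hCw⟩ := hA.bounded _ hw0
    have hiw : Integrable (w 0) μ := Integrable.of_bound
      (hA.measurable _ hw0).aestronglyMeasurable Cw (Eventually.of_forall hCw)
    have hKm : MeasurableSet Kᶜ := hK.measurableSet.compl
    have hi2 : Integrable (indicator Kᶜ fun _ => C₂) μ := (integrable_const C₂).indicator hKm
    have hi1 : Integrable (fun y => ψ y + ε / 2) μ := hiψ.add (integrable_const _)
    calc ∫ y, w 0 y ∂μ ≤ ∫ y, (ψ y + ε / 2 + indicator Kᶜ (fun _ => C₂) y) ∂μ :=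
          integral_mono hiw (hi1.add hi2) hpt
      _ = ∫ y, ψ y ∂μ + ε / 2 + μ.real Kᶜ * C₂ := by
          rw [integral_add hi1 hi2,
            integral_add hiψ (integrable_const _), integral_indicator_const _ hKm]
          simp
      _ ≤ ∫ y, ψ y ∂μ + ε := by
          have := mul_le_mul_of_nonneg_right hμK hC₂0.le
          have e1 : ε / (2 * C₂) * C₂ = ε / 2 := by field_simp
          linarith

end HopfLax

end LocalTransport

end

/-! ### Entropy and the Gibbs variational inequality -/

noncomputable section

namespace LocalTransport

open Filter Topology Set

section Entropy

variable {M : Type*} [MeasurableSpace M] {μ : Measure M} {h : M → ℝ}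

theorem integral_weighted (hh : Measurable h) (h0 : ∀ y, 0 ≤ h y) (f : M → ℝ) :
    ∫ y, f y ∂(weighted h μ) = ∫ y, h y * f y ∂μ := by
  rw [weighted, integral_withDensity_eq_integral_toReal_smul hh.ennreal_ofReal (by simp)]
  simp [ENNReal.toReal_ofReal, h0]

theorem isProbabilityMeasure_weighted (h0 : ∀ y, 0 ≤ h y) (h1 : ∫ y, h y ∂μ = 1) :
    IsProbabilityMeasure (weighted h μ) := by
  have hi : Integrable h μ := by
    by_contra hn
    rw [integral_undef hn] at h1
    exact zero_ne_one h1
  refine ⟨?_⟩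
  rw [weighted, withDensity_apply _ MeasurableSet.univ, Measure.restrict_univ,
    ← ofReal_integral_eq_lintegral_ofReal hi (Eventually.of_forall h0), h1, ENNReal.ofReal_one]

/-- The Gibbs variational inequality. -/
theorem integral_mul_le_entropy [IsProbabilityMeasure μ] (h0 : ∀ y, 0 ≤ h y)
    (h1 : ∫ y, h y ∂μ = 1) (hlog : Integrable (fun y => h y * Real.log (h y)) μ) {f : M → ℝ}
    (hf : Measurable f) {K : ℝ} (hK : ∀ y, |f y| ≤ K) {C : ℝ} (hC : 0 < C) :
    ∫ y, h y * f y ∂μ ≤ C * ∫ y, h y * Real.log (h y) ∂μ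
      + C * Real.log (∫ y, Real.exp (f y / C) ∂μ) := by
  have hi : Integrable h μ := by
    by_contra hn
    rw [integral_undef hn] at h1
    exact zero_ne_one h1
  have hexp : Integrable (fun y => Real.exp (f y / C)) μ := by
    refine Integrable.of_bound (by fun_prop) (Real.exp (K / C)) (Eventually.of_forall fun y => ?_)
    rw [Real.norm_of_nonneg (Real.exp_pos _).le]
    exact Real.exp_le_exp.2 (div_le_div_of_nonneg_right ((le_abs_self _).trans (hK y)) hC.le)
  set I := ∫ y, Real.exp (f y / C) ∂μ with hI
  have hI0 : 0 < I := integral_exp_pos hexp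
  -- This is 1 + X ≤ e^X with X = f/C − log I − log h, multiplied by h.
  have hpt : ∀ y, h y * f y / C ≤
      h y * Real.log (h y) - h y + Real.exp (f y / C) / I + h y * Real.log I := by
    intro y
    rcases (h0 y).eq_or_lt with hy | hy
    · rw [← hy]; simp; positivity
    · have := Real.add_one_le_exp (f y / C - Real.log I - Real.log (h y))
      rw [Real.exp_sub, Real.exp_sub, Real.exp_log hI0, Real.exp_log hy, le_div_iff₀ hy] at this
      have e : h y * f y / C = h y * (f y / C) := by ring
      rw [e]; linarith
  have hfi : Integrable (fun y => h y * f y) μ :=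
    hi.mul_bdd (c := K) hf.aestronglyMeasurable (Eventually.of_forall hK)
  have key := integral_mono (hfi.div_const C)
    (((hlog.sub hi).add (hexp.div_const I)).add (hi.mul_const (Real.log I))) hpt
  have e1 : ∫ y, ((((fun y => h y * Real.log (h y)) - h) + fun y => Real.exp (f y / C) / I)
      + fun y => h y * Real.log I) y ∂μ
      = ∫ y, h y * Real.log (h y) ∂μ + Real.log I := by
    rw [integral_add' ((hlog.sub hi).add (hexp.div_const I)) (hi.mul_const (Real.log I)),
      integral_add' (hlog.sub hi) (hexp.div_const I), integral_sub' hlog hi, integral_div,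
      integral_mul_const, h1, ← hI, div_self hI0.ne']
    ring
  rw [integral_div, e1, div_le_iff₀ hC] at key
  linarith

end Entropy

/-! ### The dual form of the transport inequality -/

section Forward

variable {m : ℕ} {M : Type*} [MetricSpace M] [CompleteSpace M] [SecondCountableTopology M]
    [MeasurableSpace M] [BorelSpace M]
    [ChartedSpace (EuclideanSpace ℝ (Fin m)) M] [IsManifold (𝓡 m) ∞ M]
    [RiemannianBundle (fun x : M => TangentSpace (𝓡 m) x)]
    {P : ℝ≥0 → Kernel M M} {A : Subalgebra ℝ (M → ℝ)}

omit [CompleteSpace M] [SecondCountableTopology M] [IsManifold (𝓡 m) ∞ M] in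
theorem IsDiffusionSemigroup.isDiffusionAlgebra (hP : IsDiffusionSemigroup (m := m) P A)
    (hΓ : ∀ f ∈ A, ∀ x, carreDuChamp P f f x = ‖riemGradient (m := m) f x‖ ^ 2) :
    IsDiffusionAlgebra P A where
  toIsMarkovSemigroup := hP.toIsMarkovSemigroup
  measurable f hf := (hP.smooth f hf).continuous.measurable
  bounded := hP.bounded
  comp_mem := hP.comp_mem
  semigroup_mem := hP.semigroup_mem
  generator_mem := hP.generator_mem
  heat := hP.heat
  diffusion := hP.diffusion
  carre_nonneg f hf x := by rw [hΓ f hf]; exact sq_nonneg _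

omit [CompleteSpace M] [BorelSpace M] [RiemannianBundle (fun x : M => TangentSpace (𝓡 m) x)] in
theorem IsDiffusionSemigroup.isTestAlgebra (hP : IsDiffusionSemigroup (m := m) P A) :
    IsTestAlgebra A where
  continuous f hf := (hP.smooth f hf).continuous
  bounded := hP.bounded
  bump K U hK hU hKU := by
    have : LocallyCompactSpace M := ChartedSpace.locallyCompactSpace (EuclideanSpace ℝ (Fin m)) M
    obtain ⟨L, hL, hKL, hLU⟩ := exists_compact_between hK hU hKU
    obtain ⟨f, hf1, hf0, hf⟩ := exists_contMDiffMap_one_nhds_of_subset_interior (𝓡 m)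
      (n := (⊤ : ℕ∞)) hK.isClosed hKL
    have hs : HasCompactSupport f := HasCompactSupport.intro hL hf0
    exact ⟨f, hP.test_mem f f.contMDiff hs, hs, hf, fun x hx => hf1.self_of_nhdsSet x hx,
      fun x hx => hf0 x fun h => hx (hLU h)⟩

omit [CompleteSpace M] in
/-- The transport inequality deduced from its dual form. -/
theorem W₂_sq_le_of_log_le (hP : IsDiffusionSemigroup (m := m) P A)
    (hΓ : ∀ f ∈ A, ∀ x, carreDuChamp P f f x = ‖riemGradient (m := m) f x‖ ^ 2)
    {u₁ u₂ : ℝ≥0} {x : M} {C D : ℝ} (hC : 0 < C)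
    (hdual : ∀ φ ∈ A, ∀ ψ ∈ A, (∀ x y, φ x - ψ y ≤ dist x y ^ 2 / 2) →
      C * Real.log (realOp P u₁ (fun y => Real.exp (φ y / C)) x) ≤ realOp P u₂ ψ x + D)
    {h : M → ℝ} (hh : Measurable h) (h0 : ∀ y, 0 ≤ h y) (h1 : semigroupOp P u₁ h x = 1) :
    W₂ (weighted h (P u₁ x)) (P u₂ x) ^ 2
      ≤ ENNReal.ofReal C * entropy (P u₁ x) h + ENNReal.ofReal D := by
  have hA := hP.isDiffusionAlgebra hΓ
  have := hA.isProbabilityMeasure u₁ x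
  have := hA.isProbabilityMeasure u₂ x
  have : LocallyCompactSpace M := ChartedSpace.locallyCompactSpace (EuclideanSpace ℝ (Fin m)) M
  have h1' : ∫ y, h y ∂(P u₁ x) = 1 := h1
  have := isProbabilityMeasure_weighted h0 h1'
  by_cases hlog : Integrable (fun y => h y * Real.log (h y)) (P u₁ x)
  · rw [entropy, if_pos hlog, h1', Real.log_one, mul_zero, sub_zero, ← ENNReal.ofReal_mul hC.le]
    refine le_trans ?_ (ENNReal.ofReal_add_le)
    refine hP.isTestAlgebra.W₂_sq_le fun φ hφ ψ hψ hφψ => ?_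
    rw [integral_weighted hh h0]
    obtain ⟨K, hK⟩ := hA.bounded φ hφ
    have e1 := integral_mul_le_entropy h0 h1' hlog (hA.measurable φ hφ) hK hC
    have e2 := hdual φ hφ ψ hψ hφψ
    simp only [realOp, semigroupOp, Real.toNNReal_coe] at e2
    linarith
  · rw [entropy, if_neg hlog, ENNReal.mul_top (by simpa using hC), top_add]
    exact le_top

variable [IsContMDiffRiemannianBundle (𝓡 m) ∞ (EuclideanSpace ℝ (Fin m))
      (fun x : M => TangentSpace (𝓡 m) x)]
    [IsRiemannianManifold (𝓡 m) M]

/-- The dual form of the transport inequality. -/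
theorem log_realOp_exp_le (hP : IsDiffusionSemigroup (m := m) P A)
    (hΓ : ∀ f ∈ A, ∀ x, carreDuChamp P f f x = ‖riemGradient (m := m) f x‖ ^ 2)
    {φ ψ : M → ℝ} (hφ : φ ∈ A) (hψ : ψ ∈ A) (hφψ : ∀ x y, φ x - ψ y ≤ dist x y ^ 2 / 2)
    {u : ℝ} (hu : 0 < u) (x : M) {θ τ τ' θ' B B' a b : ℝ → ℝ} {C : ℝ} (hC : 0 < C)
    (hθ : ∀ s, HasDerivAt θ (θ' s) s) (hθ0 : θ 0 = 0) (hθu : θ u = 1)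
    (hθ' : ∀ s ∈ Icc 0 u, 0 ≤ θ' s)
    (hτ : ∀ s ∈ Icc 0 u, HasDerivWithinAt τ (τ' s) (Icc 0 u) s) (hτ0 : ∀ s ∈ Icc 0 u, 0 ≤ τ s)
    (hτu : τ u = 0)
    (hgrad : ∀ f ∈ A, ∀ s ∈ Icc 0 u, ∀ y,
      a s * carreDuChamp P (realOp P (τ s) f) (realOp P (τ s) f) y
        + b s * generator P (realOp P (τ s) f) y ^ 2 ≤ realOp P (τ s) (carreDuChamp P f f) y)
    (ha : ∀ s ∈ Icc 0 u, 1 / C ≤ θ' s / 2 * a s)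
    (hB : ∀ s ∈ Icc 0 u, HasDerivWithinAt B (B' s) (Icc 0 u) s)
    (hbB : ∀ s ∈ Icc 0 u, ∀ z : ℝ, (1 + τ' s) * z - θ' s / 2 * b s * z ^ 2 ≤ B' s) :
    C * Real.log (realOp P u (fun y => Real.exp (φ y / C)) x)
      ≤ realOp P (τ 0) ψ x + (B u - B 0) := by
  have hA := hP.isDiffusionAlgebra hΓ
  have hmono : MonotoneOn θ (Icc 0 u) := by
    refine monotoneOn_of_deriv_nonneg (convex_Icc 0 u)
      (fun s _ => (hθ s).continuousAt.continuousWithinAt)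
      (fun s _ => (hθ s).differentiableAt.differentiableWithinAt) fun s hs => ?_
    rw [(hθ s).deriv]
    exact hθ' s (interior_subset hs)
  have h0u : (0 : ℝ) ∈ Icc 0 u := ⟨le_rfl, hu.le⟩
  have huu : u ∈ Icc 0 u := ⟨hu.le, le_rfl⟩
  have hmaps : MapsTo θ (Icc 0 u) (Icc 0 1) := fun s hs =>
    ⟨hθ0 ▸ hmono h0u hs hs.1, hθu ▸ hmono hs huu hs.2⟩
  have hprob := hA.isProbabilityMeasure (τ 0).toNNReal x
  refine le_of_forall_pos_le_add fun ε hε => ?_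
  obtain ⟨w, w', hw, hw', hd, hsub, hw1, hw0⟩ := exists_subsolution hA hP.smooth hP.test_mem
    (fun f hf y => by rw [hΓ f hf, norm_riemGradient]) hφ hψ hφψ (P (τ 0).toNNReal x) (half_pos hε)
  obtain ⟨K, hK⟩ := hA.bounded φ hφ
  set e : M → ℝ := fun y => Real.exp (φ y / C) with he
  have heA : e ∈ A := hA.comp_mem (fun z => Real.exp (z / C)) (by fun_prop) φ hφ
  have hlow : ∀ y, Real.exp (-K / C) ≤ e y := fun y =>
    Real.exp_le_exp.2 (div_le_div_of_nonneg_right (abs_le.1 (hK y)).1 hC.le)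
  set I := realOp P u e x with hI
  have hI0 : 0 < I := by
    have := hA.realOp_mono (IsDiffusionAlgebra.const_mem (Real.exp (-K / C))) heA hlow u x
    rw [hA.realOp_const] at this
    exact (Real.exp_pos _).trans_le this
  -- The extremal density of the Gibbs inequality. It is bounded below by a positive constant
  -- because φ is bounded, and its entropy is exactly computable: C·Ent(h) = P_u(hφ) − C log I, so
  -- the terms P_u(hφ) cancel.
  set h : M → ℝ := I⁻¹ • e with hh
  have hhA : h ∈ A := A.smul_mem heA _
  have hhpos : ∀ y, 0 < h y := fun y => mul_pos (inv_pos.2 hI0) (Real.exp_pos _)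
  have hone : realOp P u h x = 1 := by
    rw [hh, IsDiffusionAlgebra.realOp_smul, ← hI, inv_mul_cancel₀ hI0.ne']
  have key := hA.transport_interpolation hhA (α := I⁻¹ * Real.exp (-K / C)) (by positivity)
    (fun y => mul_le_mul_of_nonneg_left (hlow y) (inv_pos.2 hI0).le) hu x hone hC
    (W := fun s => w (θ s)) (W' := fun s => θ' s • w' (θ s)) (fun s hs => hw _ (hmaps hs))
    (fun s hs => A.smul_mem (hw' _ (hmaps hs)) _)
    (fun s hs => (HasUniformDerivWithinAt.comp_time (hθ s).hasDerivWithinAt (hd _ (hmaps hs))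
      hmaps (hA.bounded _ (hw' _ (hmaps hs)))))
    hθ' (fun s hs y => by
      have h1 := mul_nonpos_of_nonneg_of_nonpos (hθ' s hs) (hsub _ (hmaps hs) y)
      simp only [Pi.smul_apply, smul_eq_mul]
      linarith) hτ hτ0 hτu hgrad ha hB hbB
  have hφhA : h * φ ∈ A := A.mul_mem hhA hφ
  have h1 : realOp P u (h * φ) x - ε / 2 ≤ realOp P u (h * w (θ u)) x := by
    have e1 : realOp P u (h * φ + (-(ε / 2)) • h) x ≤ realOp P u (h * w (θ u)) x := by
      refine hA.realOp_mono (A.add_mem hφhA (A.smul_mem hhA _))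
        (A.mul_mem hhA (hw _ (hmaps huu))) (fun y => ?_) u x
      rw [hθu]
      simp only [Pi.add_apply, Pi.mul_apply, Pi.smul_apply, smul_eq_mul]
      have := mul_le_mul_of_nonneg_left (hw1 y) (hhpos y).le
      linarith
    rw [hA.realOp_add hφhA (A.smul_mem hhA _), IsDiffusionAlgebra.realOp_smul, hone] at e1
    linarith
  have h2 : C * realOp P u (fun y => h y * Real.log (h y)) x
      = realOp P u (h * φ) x - C * Real.log I := by
    have e1 : (fun y => h y * Real.log (h y)) = C⁻¹ • (h * φ) + (-Real.log I) • h := by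
      ext y
      have : Real.log (h y) = φ y / C - Real.log I := by
        simp only [hh, he, Pi.smul_apply, smul_eq_mul]
        rw [Real.log_mul (inv_pos.2 hI0).ne' (Real.exp_pos _).ne', Real.log_exp, Real.log_inv]
        ring
      rw [this]
      simp only [Pi.add_apply, Pi.mul_apply, Pi.smul_apply, smul_eq_mul]
      ring
    rw [e1, hA.realOp_add (A.smul_mem hφhA _) (A.smul_mem hhA _), IsDiffusionAlgebra.realOp_smul,
      IsDiffusionAlgebra.realOp_smul, hone]
    field_simp
    ring
  have h3 : realOp P (τ 0) (w (θ 0)) x ≤ realOp P (τ 0) ψ x + ε / 2 := by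
    rw [hθ0]; exact hw0
  linarith

end Forward

end LocalTransport

end

/-! ### Curvature implies transport -/

noncomputable section

namespace LocalTransport

open Filter Topology Set

theorem talagrandConst_zero (ρ : ℝ) : talagrandConst ρ 0 = 0 := by
  simp [talagrandConst]

theorem talagrandConst_pos (ρ : ℝ) {u : ℝ} (hu : 0 < u) : 0 < talagrandConst ρ u := by
  rw [talagrandConst]
  split_ifs with h
  · linarith
  · rcases lt_or_gt_of_ne h with h | h
    · refine div_pos_of_neg_of_neg (sub_neg.2 (Real.one_lt_exp_iff.2 ?_)) h
      nlinarith
    · refine div_pos (sub_pos.2 (Real.exp_lt_one_iff.2 ?_)) h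
      nlinarith

/-- The speed is chosen so that (θ'/2)e^{2ρ(u−s)} = 1/C, which balances the gradient bound.
Requiring total travel one forces C to be `talagrandConst`, since 2∫₀ᵘ e^{−2ρ(u−s)} ds has that
value. -/
theorem exists_time_change (ρ : ℝ) {u : ℝ} (hu : 0 < u) :
    ∃ θ : ℝ → ℝ, (∀ s, HasDerivAt θ (2 * Real.exp (-(2 * ρ * (u - s))) / talagrandConst ρ u) s) ∧
      θ 0 = 0 ∧ θ u = 1 := by
  have hC := talagrandConst_pos ρ hu
  by_cases h : ρ = 0
  · subst h
    have : talagrandConst 0 u = 2 * u := by simp [talagrandConst]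
    refine ⟨fun s => s / u, fun s => ?_, by simp, div_self hu.ne'⟩
    refine ((hasDerivAt_id s).div_const u).congr_deriv ?_
    rw [this]
    simp
    field_simp
  · have hval : ρ * talagrandConst ρ u = 1 - Real.exp (-2 * ρ * u) := by
      rw [talagrandConst, if_neg h]; field_simp
    refine ⟨fun s => (Real.exp (-(2 * ρ * (u - s))) - Real.exp (-2 * ρ * u))
      / (ρ * talagrandConst ρ u), fun s => ?_, ?_, ?_⟩
    · have h1 : HasDerivAt (fun s : ℝ => -(2 * ρ * (u - s))) (2 * ρ) s := by
        refine ((((hasDerivAt_id s).const_sub u).const_mul (2 * ρ)).neg).congr_deriv ?_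
        ring
      refine ((h1.exp.sub_const _).div_const _).congr_deriv ?_
      field_simp
    · have : -(2 * ρ * (u - 0)) = -2 * ρ * u := by ring
      simp only [this, sub_self, zero_div]
    · simp only [sub_self, mul_zero, neg_zero, Real.exp_zero]
      rw [hval]
      refine div_self ?_
      rw [← hval]
      exact mul_ne_zero h hC.ne'

section Forward

variable {m : ℕ} {M : Type*} [MetricSpace M] [CompleteSpace M] [SecondCountableTopology M]
    [MeasurableSpace M] [BorelSpace M]
    [ChartedSpace (EuclideanSpace ℝ (Fin m)) M] [IsManifold (𝓡 m) ∞ M]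
    [RiemannianBundle (fun x : M => TangentSpace (𝓡 m) x)]
    [IsContMDiffRiemannianBundle (𝓡 m) ∞ (EuclideanSpace ℝ (Fin m))
      (fun x : M => TangentSpace (𝓡 m) x)]
    [IsRiemannianManifold (𝓡 m) M]
    {P : ℝ≥0 → Kernel M M} {A : Subalgebra ℝ (M → ℝ)}

/-- The curvature condition implies the local transport–entropy inequality. -/
theorem W₂_sq_le_of_CDInfty (hP : IsDiffusionSemigroup (m := m) P A)
    (hΓ : ∀ f ∈ A, ∀ x, carreDuChamp P f f x = ‖riemGradient (m := m) f x‖ ^ 2)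
    {ρ : ℝ} (hCD : CDInfty P A ρ) (u : ℝ≥0) (x : M) {h : M → ℝ} (hh : Measurable h)
    (h0 : ∀ y, 0 ≤ h y) (h1 : semigroupOp P u h x = 1) :
    W₂ (weighted h (P u x)) (P u x) ^ 2
      ≤ ENNReal.ofReal (talagrandConst ρ u) * entropy (P u x) h := by
  have hA := hP.isDiffusionAlgebra hΓ
  -- At u = 0 there is no time to interpolate; P_0 is a Dirac mass and h(x) = 1, so admissibility at
  -- (x, x) suffices.
  rcases eq_zero_or_pos u with rfl | hu
  · have : LocallyCompactSpace M := ChartedSpace.locallyCompactSpace (EuclideanSpace ℝ (Fin m)) M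
    have := hA.isProbabilityMeasure 0 x
    have := isProbabilityMeasure_weighted h0 h1
    rw [NNReal.coe_zero, talagrandConst_zero, ENNReal.ofReal_zero, zero_mul,
      ← ENNReal.ofReal_zero]
    refine hP.isTestAlgebra.W₂_sq_le fun φ hφ ψ hψ hφψ => ?_
    have hd : P 0 x = Measure.dirac x := by rw [hA.zero, Kernel.id_apply]
    have hhx : h x = 1 := by
      rw [semigroupOp, hd, integral_dirac' _ _ hh.stronglyMeasurable] at h1
      exact h1
    rw [integral_weighted hh h0, hd,
      integral_dirac' (fun y => h y * φ y) _ (hh.mul (hA.measurable φ hφ)).stronglyMeasurable,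
      integral_dirac' _ _ (hA.measurable ψ hψ).stronglyMeasurable, hhx]
    simpa using hφψ x x
  · have hu' : (0 : ℝ) < u := hu
    have hC := talagrandConst_pos ρ hu'
    obtain ⟨θ, hθ, hθ0, hθu⟩ := exists_time_change ρ hu'
    have key := W₂_sq_le_of_log_le hP hΓ (u₁ := u) (u₂ := u) (x := x) (D := 0) hC
      (fun φ hφ ψ hψ hφψ => ?_) hh h0 h1
    · simpa using key
    -- With τ = u − s the factor 1 + τ' vanishes, so the generator does not appear and B = b = 0.
    have := log_realOp_exp_le hP hΓ hφ hψ hφψ hu' x (τ := fun s => u - s) (τ' := fun _ => -1)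
      (B := fun _ => 0) (B' := fun _ => 0) (a := fun s => Real.exp (2 * ρ * (u - s)))
      (b := fun _ => 0) hC hθ hθ0 hθu (fun s _ => by positivity)
      (fun s _ => ((hasDerivAt_id s).const_sub (u : ℝ)).hasDerivWithinAt)
      (fun s hs => by simpa using hs.2) (sub_self _)
      (fun f hf s hs y => by
        rw [zero_mul, add_zero]
        exact hA.exp_mul_carreDuChamp_realOp_le hCD hf (by simpa using hs.2) y)
      (fun s _ => by
        rw [Real.exp_neg]
        have := Real.exp_pos (2 * ρ * (u - s))
        refine le_of_eq ?_
        field_simp)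
      (fun s _ => hasDerivWithinAt_const _ _ _) (fun s _ z => by simp)
    simpa using this

/-- The curvature–dimension condition implies the local transport–entropy inequality with a
dimensional defect. -/
theorem W₂_sq_le_of_CD (hP : IsDiffusionSemigroup (m := m) P A)
    (hΓ : ∀ f ∈ A, ∀ x, carreDuChamp P f f x = ‖riemGradient (m := m) f x‖ ^ 2)
    {n : ℝ} (hn : 0 < n) (hCD : CD P A 0 n) {u₁ : ℝ≥0} (u₂ : ℝ≥0) (hu₁ : 0 < u₁) (x : M)
    {h : M → ℝ} (hh : Measurable h) (h0 : ∀ y, 0 ≤ h y) (h1 : semigroupOp P u₁ h x = 1) :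
    W₂ (weighted h (P u₁ x)) (P u₂ x) ^ 2 ≤ ENNReal.ofReal (2 * u₁) *
      (entropy (P u₁ x) h + ENNReal.ofReal (n / 2) * dimDefect (u₂ / u₁)) := by
  have hA := hP.isDiffusionAlgebra hΓ
  have hu : (0 : ℝ) < u₁ := hu₁
  -- For u₂ = 0 the defect is infinite and there is nothing to prove.
  rcases eq_zero_or_pos u₂ with rfl | hu₂
  · have e1 : dimDefect ((0 : ℝ≥0) / u₁) = ⊤ := by simp [dimDefect]
    rw [e1, ENNReal.mul_top (by simpa using hn), add_top,
      ENNReal.mul_top (by simpa using hu₁.ne')]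
    exact le_top
  have hv : (0 : ℝ) < u₂ := hu₂
  set u : ℝ := (u₁ : ℝ) with hudef
  set l : ℝ := (u₂ : ℝ) / u with hl
  have hl0 : 0 < l := div_pos hv hu
  have hlu : l * u = u₂ := div_mul_cancel₀ _ hu.ne'
  rw [dimDefect, if_pos hl0, mul_add, ← ENNReal.ofReal_mul (by positivity),
    ← ENNReal.ofReal_mul (by positivity)]
  -- The time τ = (u−s)(1+z) goes from u₂ = lu to 0 and has 1 + τ' = −2z. B' is the maximum over q
  -- of −2zq − τq²/(nu), and its primitive B = −nu(z − log(1+z)) has total increment nu(l − 1 − log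
  -- l).
  set z : ℝ → ℝ := fun s => (l - 1) * (u - s) / u with hz
  have hz1 : ∀ s ∈ Icc 0 u, 0 < 1 + z s := fun s hs => by
    have : 1 + z s = (s + l * (u - s)) / u := by simp only [hz]; field_simp; ring
    rw [this]
    refine div_pos ?_ hu
    rcases hs.1.eq_or_lt with h | h
    · rw [← h]; simp; positivity
    · exact add_pos_of_pos_of_nonneg h (mul_nonneg hl0.le (sub_nonneg.2 hs.2))
  have hzd : ∀ s, HasDerivAt z (-(l - 1) / u) s := fun s => by
    refine ((((hasDerivAt_id s).const_sub u).const_mul (l - 1)).div_const u).congr_deriv ?_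
    ring
  refine W₂_sq_le_of_log_le hP hΓ (by positivity) (fun φ hφ ψ hψ hφψ => ?_) hh h0 h1
  have := log_realOp_exp_le hP hΓ hφ hψ hφψ hu x (C := 2 * u) (θ := fun s => s / u)
    (θ' := fun _ => 1 / u) (τ := fun s => (u - s) * (1 + z s)) (τ' := fun s => -1 - 2 * z s)
    (B := fun s => -(n * u) * (z s - Real.log (1 + z s)))
    (B' := fun s => n * (l - 1) * z s / (1 + z s)) (a := fun _ => 1)
    (b := fun s => 2 * ((u - s) * (1 + z s)) / n) (by positivity)
    (fun s => (hasDerivAt_id s).div_const u) (by simp) (div_self hu.ne')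
    (fun s _ => by positivity)
    (fun s _ => by
      refine ((((hasDerivAt_id s).const_sub u).mul
        ((hzd s).const_add 1)).congr_deriv ?_).hasDerivWithinAt
      simp only [hz, id]
      field_simp
      ring)
    (fun s hs => mul_nonneg (sub_nonneg.2 hs.2) (hz1 s hs).le) (by simp)
    (fun f hf s hs y => by
      rw [one_mul]
      exact hA.carreDuChamp_realOp_add_sq_le hn hCD hf
        (mul_nonneg (sub_nonneg.2 hs.2) (hz1 s hs).le) y)
    (fun s _ => by
      refine le_of_eq ?_
      field_simp)
    (fun s hs => by
      refine ((((hzd s).sub (((hzd s).const_add 1).log (hz1 s hs).ne')).const_mul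
        (-(n * u))).congr_deriv ?_).hasDerivWithinAt
      have := (hz1 s hs).ne'
      field_simp
      ring)
    (fun s hs q => by
      have h1 := hz1 s hs
      have hr : 0 ≤ u - s := sub_nonneg.2 hs.2
      -- B' minus the quadratic form in q is a perfect square with nonnegative coefficient.
      have e : n * (l - 1) * z s / (1 + z s)
          - ((1 + (-1 - 2 * z s)) * q - 1 / u / 2 * (2 * ((u - s) * (1 + z s)) / n) * q ^ 2)
          = (u - s) / u * (n / (1 + z s)) * ((l - 1) + (1 + z s) * q / n) ^ 2 := by
        have h2 : z s = (l - 1) * ((u - s) / u) := by simp only [hz]; ring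
        have h3 : 1 + (l - 1) * ((u - s) / u) ≠ 0 := by rw [← h2]; exact h1.ne'
        set k := (u - s) / u with hk
        have h4 : u - s = k * u := by rw [hk]; field_simp
        rw [h4, h2]
        field_simp
        ring
      have : 0 ≤ (u - s) / u * (n / (1 + z s)) * ((l - 1) + (1 + z s) * q / n) ^ 2 := by
        positivity
      linarith)
  have ez0 : z 0 = l - 1 := by simp only [hz]; field_simp; ring
  have ezu : z u = 0 := by simp [hz]
  simp only [ez0, ezu] at this
  have e2 : (u - 0) * (1 + (l - 1)) = u₂ := by rw [← hlu]; ring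
  rw [e2] at this
  refine this.trans (le_of_eq ?_)
  congr 1
  rw [add_sub_cancel]
  simp
  ring

end Forward

end LocalTransport

end

/-! ### Weak duality and elementary logarithm estimates -/

noncomputable section

namespace LocalTransport

open Filter Topology Set

section WeakDuality

variable {M : Type*} [MeasurableSpace M]

theorem ofReal_integral_le_lintegral {μ : Measure M} {f : M → ℝ} (hf : Integrable f μ) :
    ENNReal.ofReal (∫ x, f x ∂μ) ≤ ∫⁻ x, ENNReal.ofReal (f x) ∂μ := by
  have h1 : ∫ x, f x ∂μ ≤ ∫ x, max (f x) 0 ∂μ :=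
    integral_mono hf hf.pos_part fun x => le_max_left _ _
  refine (ENNReal.ofReal_le_ofReal h1).trans (le_of_eq ?_)
  rw [ofReal_integral_eq_lintegral_ofReal hf.pos_part
    (Eventually.of_forall fun x => le_max_right _ _)]
  simp [ENNReal.ofReal_max]

/-- The easy half of Kantorovich duality: integrate the constraint against any coupling. -/
theorem ofReal_le_W₂_sq [PseudoMetricSpace M] {ν μ : Measure M} {φ ψ : M → ℝ}
    (hφ : Measurable φ) (hψ : Measurable ψ)
    (bφ : ∃ C : ℝ, ∀ x, |φ x| ≤ C) (bψ : ∃ C : ℝ, ∀ x, |ψ x| ≤ C)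
    (h : ∀ x y, φ x - ψ y ≤ dist x y ^ 2 / 2) :
    ENNReal.ofReal (∫ x, φ x ∂ν - ∫ x, ψ x ∂μ) ≤ W₂ ν μ ^ 2 := by
  obtain ⟨C, bφ⟩ := bφ
  obtain ⟨C', bψ⟩ := bψ
  set K := ENNReal.ofReal (∫ x, φ x ∂ν - ∫ x, ψ x ∂μ) with hK
  have key : K ^ (1 / 2 : ℝ) ≤ W₂ ν μ := by
    refine le_iInf₂ fun κ hκ => ENNReal.rpow_le_rpow ?_ (by norm_num)
    have := hκ.isProbabilityMeasure
    have i1 : Integrable (fun z : M × M => φ z.1) κ :=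
      Integrable.of_bound (hφ.comp measurable_fst).aestronglyMeasurable C
        (Eventually.of_forall fun z => bφ z.1)
    have i2 : Integrable (fun z : M × M => ψ z.2) κ :=
      Integrable.of_bound (hψ.comp measurable_snd).aestronglyMeasurable C'
        (Eventually.of_forall fun z => bψ z.2)
    have e1 : ∫ x, φ x ∂ν = ∫ z, φ z.1 ∂κ := by
      rw [← hκ.map_fst, integral_map measurable_fst.aemeasurable hφ.aestronglyMeasurable]
    have e2 : ∫ x, ψ x ∂μ = ∫ z, ψ z.2 ∂κ := by
      rw [← hκ.map_snd, integral_map measurable_snd.aemeasurable hψ.aestronglyMeasurable]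
    rw [hK, e1, e2, ← integral_sub i1 i2]
    refine (ofReal_integral_le_lintegral (i1.sub i2)).trans (lintegral_mono fun z => ?_)
    refine (ENNReal.ofReal_le_ofReal (h z.1 z.2)).trans (le_of_eq ?_)
    rw [edist_dist, ENNReal.ofReal_div_of_pos two_pos, ENNReal.ofReal_pow dist_nonneg]
    simp
  calc K = (K ^ (1 / 2 : ℝ)) ^ 2 := by
        rw [← ENNReal.rpow_natCast, ← ENNReal.rpow_mul]; norm_num
    _ ≤ W₂ ν μ ^ 2 := pow_le_pow_left' key 2

end WeakDuality

theorem abs_log_one_add_le {t : ℝ} (ht : |t| ≤ 1 / 2) :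
    |Real.log (1 + t) - (t - t ^ 2 / 2)| ≤ 2 * |t| ^ 3 := by
  have h := Real.abs_log_sub_add_sum_range_le (x := -t) (by rw [abs_neg]; linarith) 2
  rw [abs_neg] at h
  have e : (∑ i ∈ Finset.range 2, (-t) ^ (i + 1) / ((i : ℝ) + 1)) + Real.log (1 - -t)
      = Real.log (1 + t) - (t - t ^ 2 / 2) := by
    rw [Finset.sum_range_succ, Finset.sum_range_one, sub_neg_eq_add]
    norm_num
    ring
  rw [e] at h
  refine h.trans ?_
  rw [div_le_iff₀ (by linarith)]
  have h3 := mul_le_mul_of_nonneg_left ht (pow_nonneg (abs_nonneg t) 3)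
  norm_num only
  linarith

theorem one_add_mul_log_le {t : ℝ} (ht : |t| ≤ 1 / 2) :
    (1 + t) * Real.log (1 + t) ≤ t + t ^ 2 / 2 + 4 * |t| ^ 3 := by
  have h1 := (abs_le.1 (abs_log_one_add_le ht)).2
  have h2 := abs_le.1 ht
  have h3 : |t ^ 3| = |t| ^ 3 := abs_pow t 3
  have h4 := neg_abs_le (t ^ 3)
  have h5 := le_abs_self (t ^ 3)
  have h6 : (1 + t) * (Real.log (1 + t) - (t - t ^ 2 / 2)) ≤ (1 + t) * (2 * |t| ^ 3) :=
    mul_le_mul_of_nonneg_left h1 (by linarith)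
  have h7 : t * |t| ^ 3 ≤ 1 / 2 * |t| ^ 3 :=
    mul_le_mul_of_nonneg_right h2.2 (pow_nonneg (abs_nonneg t) 3)
  nlinarith

/-! ### Small perturbations in the transport inequality -/

section HopfLaxExpansion

variable {m : ℕ} {M : Type*} [MetricSpace M] [SecondCountableTopology M]
    [MeasurableSpace M] [BorelSpace M]
    [ChartedSpace (EuclideanSpace ℝ (Fin m)) M] [IsManifold (𝓡 m) ∞ M]
    [RiemannianBundle (fun x : M => TangentSpace (𝓡 m) x)]
    [IsRiemannianManifold (𝓡 m) M]
    {P : ℝ≥0 → Kernel M M} {A : Subalgebra ℝ (M → ℝ)}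

omit [SecondCountableTopology M] [IsManifold (𝓡 m) ∞ M] in
-- Γ(f) belongs to `A`, hence is bounded, and it is the squared gradient.
theorem IsDiffusionSemigroup.exists_lipschitz (hP : IsDiffusionSemigroup (m := m) P A)
    (hΓ : ∀ f ∈ A, ∀ x, carreDuChamp P f f x = ‖riemGradient (m := m) f x‖ ^ 2)
    {f : M → ℝ} (hf : f ∈ A) : ∃ L > 0, ∀ x y, |f y - f x| ≤ L * dist x y := by
  have hA := hP.isDiffusionAlgebra hΓ
  obtain ⟨C, hC⟩ := hA.bounded _ (hA.carreDuChamp_mem hf hf)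
  refine ⟨|C| + 1, by positivity, fun x y => ?_⟩
  refine abs_sub_le_of_norm_differential_le (m := m) (R := dist x y + 1)
    ((hP.smooth f hf).of_le (by simp)) (by linarith) fun z _ => ?_
  have h1 := (le_abs_self _).trans (hC z)
  rw [hΓ f hf, norm_riemGradient] at h1
  nlinarith [le_abs_self C, sq_nonneg (‖differential (m := m) f z‖ - 1)]

omit [SecondCountableTopology M] [IsManifold (𝓡 m) ∞ M] in
/-- A lower bound for the Hopf–Lax semigroup in small time. -/
theorem IsDiffusionSemigroup.exists_hopfLax_le (hP : IsDiffusionSemigroup (m := m) P A)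
    (hΓ : ∀ f ∈ A, ∀ x, carreDuChamp P f f x = ‖riemGradient (m := m) f x‖ ^ 2)
    {f : M → ℝ} (hf : f ∈ A) : ∃ K : ℝ, ∀ ε > 0, ∀ x y,
      (ε * f x - ε ^ 2 / 2 * carreDuChamp P f f x - K * ε ^ 3) - ε * f y ≤ dist x y ^ 2 / 2 := by
  have hA := hP.isDiffusionAlgebra hΓ
  obtain ⟨L, hL0, hL⟩ := hP.exists_lipschitz hΓ hf
  obtain ⟨L', hL'0, hL'⟩ := hP.exists_lipschitz hΓ (hA.carreDuChamp_mem hf hf)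
  refine ⟨L * L', fun ε hε x y => ?_⟩
  have hΓ0 := hA.carre_nonneg f hf x
  have hd := dist_nonneg (x := x) (y := y)
  have hK0 : 0 ≤ L * L' * ε ^ 3 := by positivity
  -- Far points: the Lipschitz bound already gives εL d ≤ d²/2. Near points: the gradient on the
  -- ball is at most √S, and Young's inequality ε√S d ≤ ε²S/2 + d²/2 leaves the excess LL'ε³.
  rcases le_or_gt (2 * ε * L) (dist x y) with h | h
  · have h1 := (neg_abs_le _).trans' (neg_le_neg (hL x y))
    have h2 : ε * (f x - f y) ≤ ε * (L * dist x y) :=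
      mul_le_mul_of_nonneg_left (by linarith) hε.le
    have h3 : 0 ≤ ε ^ 2 / 2 * carreDuChamp P f f x := by positivity
    nlinarith
  · set S := carreDuChamp P f f x + L' * (2 * ε * L) with hS
    have hS0 : 0 ≤ S := by positivity
    have h1 : |f y - f x| ≤ √S * dist x y := by
      refine abs_sub_le_of_norm_differential_le (m := m) ((hP.smooth f hf).of_le (by simp)) h
        fun z hz => ?_
      refine Real.le_sqrt_of_sq_le ?_
      rw [← norm_riemGradient, ← hΓ f hf]
      have h2 := (le_abs_self _).trans (hL' x z)
      rw [Metric.mem_ball, dist_comm] at hz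
      have h3 := mul_le_mul_of_nonneg_left hz.le hL'0.le
      linarith
    have h2 := (neg_abs_le _).trans' (neg_le_neg h1)
    have h3 : ε * (f x - f y) ≤ ε * (√S * dist x y) :=
      mul_le_mul_of_nonneg_left (by linarith) hε.le
    have h4 : √S ^ 2 = S := Real.sq_sqrt hS0
    have h5 : ε ^ 2 / 2 * S = ε ^ 2 / 2 * carreDuChamp P f f x + L * L' * ε ^ 3 := by
      rw [hS]; ring
    have h6 := sq_nonneg (ε * √S - dist x y)
    rw [sub_sq, mul_pow, h4] at h6
    linarith

omit [SecondCountableTopology M] [IsManifold (𝓡 m) ∞ M] in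
/-- Second order expansion of both sides of the transport–entropy inequality for the densities
`1 + ε g`. -/
theorem IsDiffusionSemigroup.exists_expansion (hP : IsDiffusionSemigroup (m := m) P A)
    (hΓ : ∀ f ∈ A, ∀ x, carreDuChamp P f f x = ‖riemGradient (m := m) f x‖ ^ 2)
    {f g : M → ℝ} (hf : f ∈ A) (hg : g ∈ A) {u : ℝ≥0} {x : M} (hg0 : realOp P u g x = 0) :
    ∃ K, ∃ ε₀ > 0, ∀ ε ∈ Ioo 0 ε₀, ∃ h : M → ℝ, Measurable h ∧ (∀ y, 0 ≤ h y) ∧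
      semigroupOp P u h x = 1 ∧
      entropy (P u x) h ≤ ENNReal.ofReal (ε ^ 2 / 2 * realOp P u (g * g) x + K * ε ^ 3) ∧
      ∀ v : ℝ≥0, ENNReal.ofReal (ε * realOp P u f x + ε ^ 2 * realOp P u (f * g) x
        - ε ^ 2 / 2 * realOp P u (carreDuChamp P f f) x - K * ε ^ 3 - ε * realOp P v f x)
          ≤ W₂ (weighted h (P u x)) (P v x) ^ 2 := by
  have hA := hP.isDiffusionAlgebra hΓ
  have hΓA := hA.carreDuChamp_mem hf hf
  obtain ⟨K₁, hK₁⟩ := hP.exists_hopfLax_le hΓ hf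
  obtain ⟨G, hG⟩ := hA.bounded g hg
  have hG0 : 0 ≤ G := (abs_nonneg _).trans (hG x)
  obtain ⟨D, hD⟩ := hA.bounded _ (A.mul_mem hΓA hg)
  have hD0 : 0 ≤ D := (abs_nonneg _).trans (hD x)
  have := hA.isProbabilityMeasure u x
  -- The constants absorb the cubic errors of h log h, of the Hopf–Lax bound and of Γ(f)g; ε₀ keeps
  -- |εg| ≤ 1/2, so h stays positive.
  refine ⟨4 * G ^ 3 + |K₁| + D, 1 / (2 * (G + 1)), by positivity, fun ε hε => ?_⟩
  have hε0 := hε.1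
  have hεG : ε * (G + 1) ≤ 1 / 2 := by
    have := hε.2.le
    rw [le_div_iff₀ (by positivity)] at this
    linarith
  have hsmall : ∀ y, |ε * g y| ≤ 1 / 2 := fun y => by
    rw [abs_mul, abs_of_pos hε0]
    nlinarith [hG y]
  have hcA : (fun _ => (1 : ℝ)) ∈ A := IsDiffusionAlgebra.const_mem 1
  set h : M → ℝ := (fun _ => 1) + ε • g with hh
  have hhA : h ∈ A := A.add_mem hcA (A.smul_mem hg ε)
  have hval : ∀ y, h y = 1 + ε * g y := fun y => rfl
  have hpos : ∀ y, 0 ≤ h y := fun y => by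
    rw [hval]; linarith [(abs_le.1 (hsmall y)).1]
  have hone' : realOp P u h x = 1 := by
    rw [hh, hA.realOp_add hcA (A.smul_mem hg ε), hA.realOp_const, IsDiffusionAlgebra.realOp_smul,
      hg0]
    ring
  have hone : semigroupOp P u h x = 1 := by
    simpa only [realOp, Real.toNNReal_coe] using hone'
  refine ⟨h, hA.measurable h hhA, hpos, hone, ?_, fun v => ?_⟩
  · have hm : Measurable fun y => h y * Real.log (h y) :=
      (hA.measurable h hhA).mul (hA.measurable h hhA).log
    set E : M → ℝ := ε • g + (ε ^ 2 / 2) • (g * g) + fun _ => 4 * G ^ 3 * ε ^ 3 with hE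
    have hEA : E ∈ A := A.add_mem (A.add_mem (A.smul_mem hg ε)
      (A.smul_mem (A.mul_mem hg hg) (ε ^ 2 / 2))) (IsDiffusionAlgebra.const_mem _)
    have hupper : ∀ y, h y * Real.log (h y) ≤ E y := fun y => by
      have h1 := one_add_mul_log_le (hsmall y)
      have h2 : |ε * g y| ^ 3 ≤ (ε * G) ^ 3 := by
        refine pow_le_pow_left₀ (abs_nonneg _) ?_ 3
        rw [abs_mul, abs_of_pos hε0]
        exact mul_le_mul_of_nonneg_left (hG y) hε0.le
      simp only [hE, hval, Pi.add_apply, Pi.smul_apply, Pi.mul_apply, smul_eq_mul]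
      rw [mul_pow] at h2
      nlinarith
    have hint : Integrable (fun y => h y * Real.log (h y)) (P u x) := by
      obtain ⟨C, hC⟩ := hA.bounded _ hEA
      refine Integrable.of_bound hm.aestronglyMeasurable (C + 1)
        (Eventually.of_forall fun y => ?_)
      rw [Real.norm_eq_abs, abs_le]
      refine ⟨?_, (hupper y).trans (((le_abs_self _).trans (hC y)).trans (by linarith))⟩
      have h1 := Real.one_sub_inv_le_log_of_pos
        (show 0 < h y by rw [hval]; linarith [(abs_le.1 (hsmall y)).1])
      have h2 : h y - 1 ≤ h y * Real.log (h y) := by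
        have := mul_le_mul_of_nonneg_left h1 (hpos y)
        rwa [mul_sub, mul_inv_cancel₀
          (show h y ≠ 0 by rw [hval]; linarith [(abs_le.1 (hsmall y)).1]), mul_one] at this
      have h3 := (abs_nonneg _).trans (hC y)
      linarith [hpos y]
    have h1' : ∫ y, h y ∂(P u x) = 1 := hone
    rw [entropy, if_pos hint, h1', Real.log_one, mul_zero, sub_zero]
    refine ENNReal.ofReal_le_ofReal ?_
    have h4 := integral_mono hint (hA.integrable hEA u x) hupper
    have h5 : ∫ y, E y ∂(P u x)
        = ε ^ 2 / 2 * realOp P u (g * g) x + 4 * G ^ 3 * ε ^ 3 := by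
      have h6 : realOp P u E x
          = ε ^ 2 / 2 * realOp P u (g * g) x + 4 * G ^ 3 * ε ^ 3 := by
        rw [hE, hA.realOp_add (A.add_mem (A.smul_mem hg ε) (A.smul_mem (A.mul_mem hg hg) _))
          (IsDiffusionAlgebra.const_mem _), hA.realOp_add (A.smul_mem hg ε)
          (A.smul_mem (A.mul_mem hg hg) _), IsDiffusionAlgebra.realOp_smul,
          IsDiffusionAlgebra.realOp_smul, hA.realOp_const, hg0]
        ring
      simpa only [realOp, semigroupOp, Real.toNNReal_coe] using h6
    rw [h5] at h4
    have h7 : 0 ≤ (|K₁| + D) * ε ^ 3 := by positivity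
    linarith
  -- The pair (φ, εf) is admissible by the small-time Hopf–Lax bound, so weak duality bounds W₂²
  -- below.
  · set φ : M → ℝ := ε • f + (-(ε ^ 2 / 2)) • carreDuChamp P f f + fun _ => -(K₁ * ε ^ 3) with hφ
    have hφA : φ ∈ A := A.add_mem (A.add_mem (A.smul_mem hf _) (A.smul_mem hΓA _))
      (IsDiffusionAlgebra.const_mem _)
    have hψA : ε • f ∈ A := A.smul_mem hf ε
    refine le_trans (ENNReal.ofReal_le_ofReal ?_) (ofReal_le_W₂_sq (hA.measurable φ hφA)
      (hA.measurable _ hψA) (hA.bounded φ hφA) (hA.bounded _ hψA) fun y z => ?_)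
    · rw [integral_weighted (hA.measurable h hhA) hpos]
      have e1 : ∫ y, (ε • f) y ∂(P v x) = ε * realOp P v f x := by
        have := IsDiffusionAlgebra.realOp_smul (P := P) ε f v x
        simpa only [realOp, semigroupOp, Real.toNNReal_coe] using this
      have e2 : h * φ = ε • f + (ε ^ 2) • (f * g) + (-(ε ^ 2 / 2)) • carreDuChamp P f f
          + (-(ε ^ 3 / 2)) • (carreDuChamp P f f * g) + (-(K₁ * ε ^ 3)) • h := by
        ext y
        simp only [hφ, hh, Pi.add_apply, Pi.smul_apply, Pi.mul_apply, smul_eq_mul]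
        ring
      have m1 := A.smul_mem hf ε
      have m2 := A.add_mem m1 (A.smul_mem (A.mul_mem hf hg) (ε ^ 2))
      have m3 := A.add_mem m2 (A.smul_mem hΓA (-(ε ^ 2 / 2)))
      have m4 := A.add_mem m3 (A.smul_mem (A.mul_mem hΓA hg) (-(ε ^ 3 / 2)))
      have e3 : realOp P u (h * φ) x = ε * realOp P u f x + ε ^ 2 * realOp P u (f * g) x
          - ε ^ 2 / 2 * realOp P u (carreDuChamp P f f) x
          - ε ^ 3 / 2 * realOp P u (carreDuChamp P f f * g) x - K₁ * ε ^ 3 := by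
        rw [e2, hA.realOp_add m4 (A.smul_mem hhA _),
          hA.realOp_add m3 (A.smul_mem (A.mul_mem hΓA hg) _),
          hA.realOp_add m2 (A.smul_mem hΓA _),
          hA.realOp_add m1 (A.smul_mem (A.mul_mem hf hg) _)]
        simp only [IsDiffusionAlgebra.realOp_smul, hone']
        ring
      have e4 : ∫ y, h y * φ y ∂(P u x) = realOp P u (h * φ) x := by
        simp only [realOp, semigroupOp, Real.toNNReal_coe, Pi.mul_apply]
      rw [e1, e4, e3]
      have e5 := (le_abs_self _).trans (hA.abs_realOp_le hD (u : ℝ) x)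
      have hε3 : 0 < ε ^ 3 := by positivity
      have e6 := mul_le_mul_of_nonneg_left e5 hε3.le
      have e7 := mul_le_mul_of_nonneg_left (le_abs_self K₁) hε3.le
      have e8 : 0 ≤ G ^ 3 * ε ^ 3 := by positivity
      have e9 : 0 ≤ D * ε ^ 3 := by positivity
      linarith
    · have := hK₁ ε hε0 y z
      simp only [hφ, Pi.add_apply, Pi.smul_apply, smul_eq_mul]
      linarith

end HopfLaxExpansion

end LocalTransport

end

/-! ### From variance bounds to Γ₂ -/

noncomputable section

namespace LocalTransport

open Filter Topology Set

theorem nonpos_of_sq_mul_le_cube {X K ε₀ : ℝ} (hε₀ : 0 < ε₀)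
    (h : ∀ ε ∈ Ioo 0 ε₀, ε ^ 2 * X ≤ K * ε ^ 3) : X ≤ 0 := by
  have h1 : Tendsto (fun ε : ℝ => K * ε) (𝓝[>] 0) (𝓝 (K * 0)) :=
    ((continuous_const.mul continuous_id).tendsto _).mono_left nhdsWithin_le_nhds
  rw [mul_zero] at h1
  refine ge_of_tendsto h1 ?_
  filter_upwards [Ioo_mem_nhdsGT hε₀] with ε hε
  have h2 := h ε hε
  have h3 : 0 < ε ^ 2 := pow_pos hε.1 2
  refine le_of_mul_le_mul_left ?_ h3
  linarith

theorem tendsto_div_pow_of_abs_sub_le {N : ℝ → ℝ} {k : ℕ} {d C : ℝ}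
    (h : ∀ t > 0, |N t - t ^ k * d| ≤ C * t ^ (k + 1)) :
    Tendsto (fun t => N t / t ^ k) (𝓝[>] 0) (𝓝 d) := by
  have h1 : Tendsto (fun t : ℝ => C * t) (𝓝[>] 0) (𝓝 (C * 0)) :=
    ((continuous_const.mul continuous_id).tendsto _).mono_left nhdsWithin_le_nhds
  rw [mul_zero] at h1
  rw [tendsto_iff_norm_sub_tendsto_zero]
  refine squeeze_zero' (Eventually.of_forall fun t => norm_nonneg _) ?_ h1
  filter_upwards [self_mem_nhdsWithin] with t ht
  have ht' : (0 : ℝ) < t := ht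
  have hk : 0 < t ^ k := pow_pos ht' k
  have h2 : N t / t ^ k - d = (N t - t ^ k * d) / t ^ k := by field_simp
  rw [h2, norm_div, Real.norm_eq_abs, Real.norm_of_nonneg hk.le, div_le_iff₀ hk]
  refine (h t ht').trans (le_of_eq ?_)
  ring

section Variance

variable {M : Type*} [MeasurableSpace M] {P : ℝ≥0 → Kernel M M} {A : Subalgebra ℝ (M → ℝ)}

/-- A second order Taylor expansion at time zero turns a variance bound along the semigroup into a
bound on `Γ₂`. -/
theorem IsDiffusionAlgebra.le_gammaTwo_of_variance_le (hA : IsDiffusionAlgebra P A) {f : M → ℝ}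
    (hf : f ∈ A) (x : M) {c d : ℝ → ℝ} {c₀ d₀ : ℝ} (hc : Tendsto c (𝓝[>] 0) (𝓝 c₀))
    (hd : Tendsto d (𝓝[>] 0) (𝓝 d₀))
    (h : ∀ᶠ u in 𝓝[>] 0, realOp P u (f * f) x - realOp P u f x ^ 2
      ≤ (2 * u + u ^ 2 * c u) * realOp P u (carreDuChamp P f f) x - u ^ 2 * d u) :
    d₀ - c₀ * carreDuChamp P f f x ≤ 2 * gammaTwo P f x := by
  have hff := A.mul_mem hf hf
  have hLf := hA.generator_mem f hf
  have hΓA := hA.carreDuChamp_mem hf hf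
  have second : ∀ k ∈ A, Tendsto (fun t => (realOp P t k x - k x - t * generator P k x) / t ^ 2)
      (𝓝[>] 0) (𝓝 (generator P (generator P k) x / 2)) := by
    intro k hk
    have hL := hA.generator_mem k hk
    have hLL := hA.generator_mem _ hL
    obtain ⟨C, hC⟩ := hA.bounded _ (hA.generator_mem _ hLL)
    refine tendsto_div_pow_of_abs_sub_le (C := C) fun t ht => ?_
    have := hA.abs_realOp_taylor_two_le hk hC le_rfl ht.le x
    rw [sub_zero, hA.realOp_zero hk, hA.realOp_zero hL, hA.realOp_zero hLL, abs_of_pos ht] at this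
    convert this using 2
    ring
  have first : ∀ k ∈ A, Tendsto (fun t => (realOp P t k x - k x) / t) (𝓝[>] 0)
      (𝓝 (generator P k x)) := by
    intro k hk
    have hL := hA.generator_mem k hk
    obtain ⟨C, hC⟩ := hA.bounded _ (hA.generator_mem _ hL)
    have := tendsto_div_pow_of_abs_sub_le (N := fun t => realOp P t k x - k x) (k := 1)
      (d := generator P k x) (C := C) fun t ht => ?_
    · simpa using this
    have := hA.abs_realOp_sub_sub_le hk hC le_rfl ht.le x
    rw [sub_zero, hA.realOp_zero hk, hA.realOp_zero hL, abs_of_pos ht] at this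
    simpa using this
  have hid : Tendsto (fun t : ℝ => t) (𝓝[>] 0) (𝓝 0) := tendsto_id.mono_left nhdsWithin_le_nhds
  -- The common leading term 2uΓ(f) is removed and both sides are divided by u². The limits are
  -- LΓ(f) + 2Γ(f,Lf) on the left and c₀Γ(f) + 2LΓ(f) − d₀ on the right.
  have lhs := ((second _ hff).sub ((second _ hf).const_mul (2 * f x))).sub ((first _ hf).pow 2)
  have rhs := (((hc.mul_const (carreDuChamp P f f x)).add ((first _ hΓA).const_mul 2)).add
    ((hid.mul hc).mul (first _ hΓA))).sub hd
  have hfirst : generator P (f * f) x = 2 * f x * generator P f x + 2 * carreDuChamp P f f x := by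
    rw [IsDiffusionAlgebra.generator_mul]; ring
  have hsecond : generator P (generator P (f * f)) x = 2 * (f x * generator P (generator P f) x
      + generator P f x ^ 2 + 2 * carreDuChamp P f (generator P f) x)
      + 2 * generator P (carreDuChamp P f f) x := by
    have e : generator P (f * f)
        = (2 : ℝ) • (f * generator P f) + (2 : ℝ) • carreDuChamp P f f := by
      ext y
      rw [IsDiffusionAlgebra.generator_mul]
      simp only [Pi.add_apply, Pi.smul_apply, Pi.mul_apply, smul_eq_mul]
      ring
    rw [e, hA.generator_add (A.smul_mem (A.mul_mem hf hLf) _) (A.smul_mem hΓA _),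
      hA.generator_smul (A.mul_mem hf hLf), hA.generator_smul hΓA]
    simp only [Pi.add_apply, Pi.smul_apply, smul_eq_mul]
    rw [IsDiffusionAlgebra.generator_mul]
    ring
  have key := le_of_tendsto_of_tendsto lhs rhs ?_
  · rw [hsecond] at key
    rw [gammaTwo]
    linarith
  · filter_upwards [h, self_mem_nhdsWithin] with u hu hu0
    have hu0' : (0 : ℝ) < u := hu0
    have hsq : 0 < u ^ 2 := pow_pos hu0' 2
    refine le_of_mul_le_mul_left ?_ hsq
    have e1 : u ^ 2 * ((realOp P u (f * f) x - (f * f) x - u * generator P (f * f) x) / u ^ 2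
        - 2 * f x * ((realOp P u f x - f x - u * generator P f x) / u ^ 2)
        - ((realOp P u f x - f x) / u) ^ 2)
        = realOp P u (f * f) x - realOp P u f x ^ 2 - 2 * u * carreDuChamp P f f x := by
      rw [hfirst, Pi.mul_apply]
      field_simp
      ring
    have e2 : u ^ 2 * (c u * carreDuChamp P f f x
        + 2 * ((realOp P u (carreDuChamp P f f) x - carreDuChamp P f f x) / u)
        + u * c u * ((realOp P u (carreDuChamp P f f) x - carreDuChamp P f f x) / u) - d u)
        = (2 * u + u ^ 2 * c u) * realOp P u (carreDuChamp P f f) x - u ^ 2 * d u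
          - 2 * u * carreDuChamp P f f x := by
      field_simp
      ring
    rw [e1, e2]
    linarith

end Variance

/-! ### Transport implies curvature -/

section Converse

variable {m : ℕ} {M : Type*} [MetricSpace M] [SecondCountableTopology M]
    [MeasurableSpace M] [BorelSpace M]
    [ChartedSpace (EuclideanSpace ℝ (Fin m)) M] [IsManifold (𝓡 m) ∞ M]
    [RiemannianBundle (fun x : M => TangentSpace (𝓡 m) x)]
    [IsRiemannianManifold (𝓡 m) M]
    {P : ℝ≥0 → Kernel M M} {A : Subalgebra ℝ (M → ℝ)}

omit [SecondCountableTopology M] [IsManifold (𝓡 m) ∞ M] in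
/-- Linearization of the transport–entropy inequality. -/
theorem IsDiffusionSemigroup.variance_le_of_transport (hP : IsDiffusionSemigroup (m := m) P A)
    (hΓ : ∀ f ∈ A, ∀ x, carreDuChamp P f f x = ‖riemGradient (m := m) f x‖ ^ 2)
    {u : ℝ≥0} {x : M} {C κ a : ℝ} (hC : 0 < C) (hκ : 0 ≤ κ)
    (hT : ∀ ε : ℝ, 0 < ε → |ε * a| ≤ 1 / 2 → ∀ h : M → ℝ, Measurable h → (∀ y, 0 ≤ h y) →
      semigroupOp P u h x = 1 →
      W₂ (weighted h (P u x)) (P (u * (1 + ε * a)).toNNReal x) ^ 2 ≤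
        ENNReal.ofReal C * (entropy (P u x) h
          + ENNReal.ofReal (κ * (ε * a - Real.log (1 + ε * a)))))
    {f : M → ℝ} (hf : f ∈ A) :
    (realOp P u (f * f) x - realOp P u f x ^ 2) / C ≤ realOp P u (carreDuChamp P f f) x
      + 2 * u * a * realOp P u (generator P f) x + C * κ * a ^ 2 := by
  have hA := hP.isDiffusionAlgebra hΓ
  have hcA : (fun _ => realOp P u f x) ∈ A := IsDiffusionAlgebra.const_mem _
  -- This direction maximizes P_u(fg) − (C/2)P_u(g²) among mean-zero g; the maximum is V/(2C).
  set g : M → ℝ := C⁻¹ • (f - fun _ => realOp P u f x) with hg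
  have hgA : g ∈ A := A.smul_mem (A.sub_mem hf hcA) _
  set V := realOp P u (f * f) x - realOp P u f x ^ 2 with hV
  have hV0 : 0 ≤ V := sub_nonneg.2 (hA.sq_realOp_le hf u x)
  have hg0 : realOp P u g x = 0 := by
    rw [hg, IsDiffusionAlgebra.realOp_smul, hA.realOp_sub hf hcA, hA.realOp_const]; ring
  have hfg : realOp P u (f * g) x = V / C := by
    have e : f * g = C⁻¹ • (f * f + (-realOp P u f x) • f) := by
      ext y
      simp only [hg, Pi.mul_apply, Pi.smul_apply, Pi.sub_apply, Pi.add_apply, smul_eq_mul]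
      ring
    rw [e, IsDiffusionAlgebra.realOp_smul, hA.realOp_add (A.mul_mem hf hf) (A.smul_mem hf _),
      IsDiffusionAlgebra.realOp_smul, hV]
    ring
  have hgg : realOp P u (g * g) x = V / C ^ 2 := by
    have e : g * g = C⁻¹ • (f * g + (-realOp P u f x) • g) := by
      ext y
      simp only [hg, Pi.mul_apply, Pi.smul_apply, Pi.sub_apply, Pi.add_apply, smul_eq_mul]
      ring
    rw [e, IsDiffusionAlgebra.realOp_smul, hA.realOp_add (A.mul_mem hf hgA) (A.smul_mem hgA _),
      IsDiffusionAlgebra.realOp_smul, hg0, hfg]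
    field_simp
    ring
  obtain ⟨K, ε₁, hε₁, hexp⟩ := hP.exists_expansion hΓ hf hgA hg0
  have hLf := hA.generator_mem f hf
  obtain ⟨D, hD⟩ := hA.bounded _ (hA.generator_mem _ hLf)
  set ε₀ := min ε₁ (1 / (2 * (|a| + 1))) with hε₀
  have hε₀0 : 0 < ε₀ := lt_min hε₁ (by positivity)
  -- The left side is the ε² coefficient. The order ε cancels except that moving the time to u(1+εa)
  -- shifts εP_u f by ε²ua P_u Lf, and κ(εa − log(1+εa)) contributes κε²a²/2.
  have key : V / (2 * C) - realOp P u (carreDuChamp P f f) x / 2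
      - u * a * realOp P u (generator P f) x - C * κ * a ^ 2 / 2 ≤ 0 := by
    refine nonpos_of_sq_mul_le_cube (K := |K| + D * (u * a) ^ 2
      + C * (|K| + κ * (2 * |a| ^ 3))) hε₀0 fun ε hε => ?_
    have hε0 := hε.1
    have hεa : |ε * a| ≤ 1 / 2 := by
      have h1 := (hε.2.le).trans (min_le_right _ _)
      rw [le_div_iff₀ (by positivity)] at h1
      rw [abs_mul, abs_of_pos hε0]
      nlinarith
    have hpos : 0 ≤ 1 + ε * a := by linarith [(abs_le.1 hεa).1]
    obtain ⟨h, hm, h0, h1, hent, hW⟩ := hexp ε ⟨hε0, hε.2.trans_le (min_le_left _ _)⟩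
    have h2 := (hW (u * (1 + ε * a)).toNNReal).trans (hT ε hε0 hεa h hm h0 h1)
    have hcube : |ε * a| ^ 3 = ε ^ 3 * |a| ^ 3 := by rw [abs_mul, abs_of_pos hε0, mul_pow]
    have hε3 : 0 < ε ^ 3 := by positivity
    have h3 : ε * a - Real.log (1 + ε * a) ≤ ε ^ 2 * a ^ 2 / 2 + 2 * (ε ^ 3 * |a| ^ 3) := by
      have := (abs_le.1 (abs_log_one_add_le hεa)).1
      rw [hcube] at this
      nlinarith
    set E := ε ^ 2 / 2 * (V / C ^ 2) + |K| * ε ^ 3 with hE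
    set F := κ * (ε ^ 2 * a ^ 2 / 2 + 2 * (ε ^ 3 * |a| ^ 3)) with hF
    have hE0 : 0 ≤ E := by positivity
    have hF0 : 0 ≤ F := by positivity
    have h4 : ENNReal.ofReal C * (entropy (P u x) h
          + ENNReal.ofReal (κ * (ε * a - Real.log (1 + ε * a))))
        ≤ ENNReal.ofReal (C * (E + F)) := by
      rw [ENNReal.ofReal_mul hC.le, ENNReal.ofReal_add hE0 hF0]
      refine mul_le_mul_right (add_le_add (hent.trans (ENNReal.ofReal_le_ofReal ?_))
        (ENNReal.ofReal_le_ofReal (mul_le_mul_of_nonneg_left h3 hκ))) _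
      rw [hgg, hE]
      have := mul_le_mul_of_nonneg_right (le_abs_self K) hε3.le
      linarith
    have h5 := (ENNReal.ofReal_le_ofReal_iff (by positivity)).1 (h2.trans h4)
    have hv0 : (0 : ℝ) ≤ u * (1 + ε * a) := mul_nonneg u.2 hpos
    have h6 := (abs_le.1 (hA.abs_realOp_sub_sub_le hf hD u.2 hv0 x)).2
    rw [Real.coe_toNNReal _ hv0, hfg] at h5
    rw [sq_abs] at h6
    have h7 : ε * (realOp P (u * (1 + ε * a)) f x - realOp P u f x
        - (u * (1 + ε * a) - u) * realOp P u (generator P f) x)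
        ≤ ε * (D * (u * (1 + ε * a) - u) ^ 2) := mul_le_mul_of_nonneg_left h6 hε0.le
    have h8 := mul_le_mul_of_nonneg_right (le_abs_self K) hε3.le
    have h9 : C * (E + F) = ε ^ 2 * (V / (2 * C) + C * κ * a ^ 2 / 2)
        + C * (|K| + κ * (2 * |a| ^ 3)) * ε ^ 3 := by
      rw [hE, hF]
      field_simp
      ring
    rw [h9] at h5
    have h10 : ε ^ 2 * (V / C) = ε ^ 2 * (V / (2 * C)) + ε ^ 2 * (V / (2 * C)) := by
      field_simp
      ring
    rw [h10] at h5
    have h11 : ε * ((u * (1 + ε * a) - u) * realOp P u (generator P f) x)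
        = ε ^ 2 * (u * a * realOp P u (generator P f) x) := by ring
    have h12 : ε * (D * (u * (1 + ε * a) - u) ^ 2) = D * (u * a) ^ 2 * ε ^ 3 := by ring
    rw [mul_sub, mul_sub, h11, h12] at h7
    linarith
  have e : V / (2 * C) = V / C / 2 := by field_simp
  rw [e] at key
  linarith

omit [SecondCountableTopology M] [IsManifold (𝓡 m) ∞ M] in
-- Linearizing with a = 0 bounds the variance of f under P_u by `talagrandConst` times P_uΓ(f). The
-- expansion 2u − 2ρu² + O(u³) of that constant carries ρ to the order u² where Γ₂ appears.
theorem IsDiffusionSemigroup.CDInfty_of_transport (hP : IsDiffusionSemigroup (m := m) P A)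
    (hΓ : ∀ f ∈ A, ∀ x, carreDuChamp P f f x = ‖riemGradient (m := m) f x‖ ^ 2) {ρ : ℝ}
    (hT : ∀ (u : ℝ≥0) (x : M) (h : M → ℝ), Measurable h → (∀ y, 0 ≤ h y) →
      semigroupOp P u h x = 1 → W₂ (weighted h (P u x)) (P u x) ^ 2 ≤
        ENNReal.ofReal (talagrandConst ρ u) * entropy (P u x) h) : CDInfty P A ρ := by
  intro f hf x
  have hA := hP.isDiffusionAlgebra hΓ
  have hΓ0 : ∀ u, 0 ≤ realOp P u (carreDuChamp P f f) x := fun u =>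
    IsDiffusionAlgebra.realOp_nonneg (hA.carre_nonneg f hf) u x
  obtain ⟨K, u₀, hu₀, hK⟩ : ∃ K, ∃ u₀ > 0, ∀ u ∈ Ioo 0 u₀,
      talagrandConst ρ u ≤ 2 * u - 2 * ρ * u ^ 2 + K * u ^ 3 := by
    by_cases h : ρ = 0
    · exact ⟨0, 1, one_pos, fun u _ => by simp [talagrandConst, h]⟩
    · refine ⟨2 * ρ ^ 2, 1 / (2 * |ρ|), by positivity, fun u hu => ?_⟩
      have hu0 := hu.1
      have h1 : |-2 * ρ * u| = 2 * |ρ| * u := by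
        rw [abs_mul, abs_mul, abs_of_pos hu0]; norm_num
      have h2 : |-2 * ρ * u| ≤ 1 := by
        rw [h1]
        have := hu.2.le
        rw [le_div_iff₀ (by positivity)] at this
        linarith
      have h3 := Real.exp_bound h2 (n := 3) (by norm_num)
      rw [h1] at h3
      have h4 : ∑ i ∈ Finset.range 3, (-2 * ρ * u) ^ i / (i.factorial : ℝ)
          = 1 - 2 * ρ * u + 2 * ρ ^ 2 * u ^ 2 := by
        simp [Finset.sum_range_succ, Nat.factorial]
        ring
      rw [h4] at h3
      have h5 : (2 * |ρ| * u) ^ 3 * (((3 : ℕ).succ : ℝ) / ((3 : ℕ).factorial * (3 : ℕ)))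
          ≤ |ρ| * (2 * ρ ^ 2 * u ^ 3) := by
        have : (((3 : ℕ).succ : ℝ) / ((3 : ℕ).factorial * (3 : ℕ))) = 2 / 9 := by
          norm_num [Nat.factorial]
        rw [this]
        have h6 : |ρ| ^ 3 = |ρ| * ρ ^ 2 := by rw [pow_succ, sq_abs]; ring
        have h7 : 0 ≤ |ρ| * ρ ^ 2 * u ^ 3 := by positivity
        rw [mul_pow, mul_pow, h6]
        linarith
      have h8 : talagrandConst ρ u - (2 * u - 2 * ρ * u ^ 2)
          = -(Real.exp (-2 * ρ * u) - (1 - 2 * ρ * u + 2 * ρ ^ 2 * u ^ 2)) / ρ := by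
        rw [talagrandConst, if_neg h]; field_simp; ring
      have h9 : |talagrandConst ρ u - (2 * u - 2 * ρ * u ^ 2)| ≤ 2 * ρ ^ 2 * u ^ 3 := by
        rw [h8, abs_div, abs_neg, div_le_iff₀ (abs_pos.2 h)]
        linarith
      linarith [(abs_le.1 h9).2]
  have hc : Tendsto (fun u : ℝ => -2 * ρ + K * u) (𝓝[>] 0) (𝓝 (-2 * ρ + K * 0)) :=
    ((continuous_const.add (continuous_const.mul continuous_id)).tendsto _).mono_left
      nhdsWithin_le_nhds
  have key := hA.le_gammaTwo_of_variance_le hf x hc (d := fun _ => 0) tendsto_const_nhds ?_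
  · linarith
  · filter_upwards [Ioo_mem_nhdsGT hu₀] with u hu
    have hu0 := hu.1
    have hC := talagrandConst_pos ρ hu0
    have h1 := hP.variance_le_of_transport hΓ (u := u.toNNReal) (x := x) (κ := 0) (a := 0) hC le_rfl
      (fun ε _ _ h hm h0 h1 => by
        simpa [Real.coe_toNNReal _ hu0.le] using hT u.toNNReal x h hm h0 h1) hf
    rw [Real.coe_toNNReal _ hu0.le, div_le_iff₀ hC] at h1
    have h2 := mul_le_mul_of_nonneg_right (hK u hu) (hΓ0 u)
    linarith

omit [SecondCountableTopology M] [IsManifold (𝓡 m) ∞ M] in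
theorem IsDiffusionSemigroup.CD_of_transport (hP : IsDiffusionSemigroup (m := m) P A)
    (hΓ : ∀ f ∈ A, ∀ x, carreDuChamp P f f x = ‖riemGradient (m := m) f x‖ ^ 2) {n : ℝ}
    (hn : 0 < n)
    (hT : ∀ (u₁ u₂ : ℝ≥0), 0 < u₁ → ∀ (x : M) (h : M → ℝ), Measurable h → (∀ y, 0 ≤ h y) →
      semigroupOp P u₁ h x = 1 → W₂ (weighted h (P u₁ x)) (P u₂ x) ^ 2 ≤
        ENNReal.ofReal (2 * u₁) *
          (entropy (P u₁ x) h + ENNReal.ofReal (n / 2) * dimDefect (u₂ / u₁))) : CD P A 0 n := by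
  intro f hf x
  have hA := hP.isDiffusionAlgebra hΓ
  have hLf := hA.generator_mem f hf
  have hd : Tendsto (fun u : ℝ => 2 / n * realOp P u (generator P f) x ^ 2) (𝓝[>] 0)
      (𝓝 (2 / n * generator P f x ^ 2)) := by
    have h1 : Tendsto (fun s => realOp P s (generator P f) x) (𝓝[>] 0)
        (𝓝 (realOp P 0 (generator P f) x)) :=
      (hA.continuousOn_realOp hLf x 0 self_mem_Ici).mono_left
        (nhdsWithin_mono 0 Ioi_subset_Ici_self)
    rw [hA.realOp_zero hLf] at h1
    exact (h1.pow 2).const_mul _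
  have key := hA.le_gammaTwo_of_variance_le hf x (c := fun _ => 0) tendsto_const_nhds hd ?_
  · have e : 2 / n * generator P f x ^ 2 = 2 * (1 / n * generator P f x ^ 2) := by ring
    rw [e] at key
    linarith
  · filter_upwards [self_mem_nhdsWithin] with u hu
    have hu0 : (0 : ℝ) < u := hu
    set l := realOp P u (generator P f) x with hl
    -- With C = 2u and κ = n/2 the terms in a are 2ual + nua². Their minimum, at a = −l/n, is
    -- −ul²/n, the source of the (Lf)²/n term.
    have h1 := hP.variance_le_of_transport hΓ (u := u.toNNReal) (x := x) (C := 2 * u) (κ := n / 2)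
      (a := -l / n) (by positivity) (by positivity)
      (fun ε hε hεa h hm h0 h1 => by
        have hpos : 0 < 1 + ε * (-l / n) := by linarith [(abs_le.1 hεa).1]
        have := hT u.toNNReal (u * (1 + ε * (-l / n))).toNNReal
          (Real.toNNReal_pos.2 hu0) x h hm h0 h1
        rw [Real.coe_toNNReal _ hu0.le, Real.coe_toNNReal _ (mul_pos hu0 hpos).le,
          mul_div_cancel_left₀ _ hu0.ne', dimDefect, if_pos hpos,
          ← ENNReal.ofReal_mul (by positivity), add_sub_cancel_left] at this
        rw [Real.coe_toNNReal _ hu0.le]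
        exact this) hf
    rw [Real.coe_toNNReal _ hu0.le, div_le_iff₀ (by positivity), ← hl] at h1
    have e : (realOp P u (carreDuChamp P f f) x + 2 * u * (-l / n) * l
        + 2 * u * (n / 2) * (-l / n) ^ 2) * (2 * u)
        = (2 * u + u ^ 2 * 0) * realOp P u (carreDuChamp P f f) x - u ^ 2 * (2 / n * l ^ 2) := by
      field_simp
      ring
    rw [e] at h1
    exact h1

end Converse

end LocalTransport

end

theorem mainTheorem5 {m : ℕ} {M : Type*} [MetricSpace M] [CompleteSpace M]
    [SecondCountableTopology M] [MeasurableSpace M] [BorelSpace M]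
    [ChartedSpace (EuclideanSpace ℝ (Fin m)) M] [IsManifold (𝓡 m) ∞ M]
    [RiemannianBundle (fun x : M => TangentSpace (𝓡 m) x)]
    [IsContMDiffRiemannianBundle (𝓡 m) ∞ (EuclideanSpace ℝ (Fin m))
      (fun x : M => TangentSpace (𝓡 m) x)]
    [IsRiemannianManifold (𝓡 m) M]
    (P : ℝ≥0 → Kernel M M) (A : Subalgebra ℝ (M → ℝ))
    (hP : IsDiffusionSemigroup (m := m) P A)
    (hΓ : ∀ f ∈ A, ∀ x, carreDuChamp P f f x = ‖riemGradient (m := m) f x‖ ^ 2) :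
    (∀ ρ : ℝ, CDInfty P A ρ ↔
      ∀ (u : ℝ≥0) (x : M) (h : M → ℝ), Measurable h → (∀ y, 0 ≤ h y) →
        semigroupOp P u h x = 1 →
        W₂ (weighted h (P u x)) (P u x) ^ 2 ≤
          ENNReal.ofReal (talagrandConst ρ u) * entropy (P u x) h) ∧
    (∀ n : ℝ, 1 ≤ n → (CD P A 0 n ↔
      ∀ (u₁ u₂ : ℝ≥0), 0 < u₁ → ∀ (x : M) (h : M → ℝ), Measurable h → (∀ y, 0 ≤ h y) →
        semigroupOp P u₁ h x = 1 →
        W₂ (weighted h (P u₁ x)) (P u₂ x) ^ 2 ≤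
          ENNReal.ofReal (2 * u₁) *
            (entropy (P u₁ x) h + ENNReal.ofReal (n / 2) * dimDefect (u₂ / u₁)))) := by
  exact ⟨fun ρ => ⟨fun hCD u x _ hh h0 h1 => W₂_sq_le_of_CDInfty hP hΓ hCD u x hh h0 h1,
      hP.CDInfty_of_transport hΓ⟩,
    fun n hn => ⟨fun hCD u₁ u₂ hu₁ x _ hh h0 h1 =>
      W₂_sq_le_of_CD hP hΓ (by linarith) hCD u₂ hu₁ x hh h0 h1,
      hP.CD_of_transport hΓ (by linarith)⟩⟩
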